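/- Let $n\ge 2$, let $\mathbf a,\mathbf b\in\mathbb R_{\ge 0}^n$ be two score vectors, and let $\mathbf w=(w_1,\dots,w_n)$ be a weight vector with $w_1\ge w_2\ge\dots\ge w_n\ge 0$. Let $f(\alpha,\beta)$ be a real function that is concave on $\{\alpha,\beta\ge 0\}$ and strictly increasing in each coordinate there. For a ranking (permutation) $\pi$ of $[n]$ put $\mathsf{cs}_{\mathbf w}(\mathbf a,\pi)=\sum_{j=1}^n w_j a_{\pi(j)}$ and $\mathsf{co}_{\mathbf w}(\mathbf a,\mathbf b,\pi)=f(\mathsf{cs}_{\mathbf w}(\mathbf a,\pi),\mathsf{cs}_{\mathbf w}(\mathbf b,\pi))$, and let $\mathsf{co}^*_{\mathbf w}(\mathbf a,\mathbf b)=\max_\pi \mathsf{co}_{\mathbf w}(\mathbf a,\mathbf b,\pi)$. Call $\pi$ good for $(\mathbf a,\mathbf b,\mathbf w,f)$ if $\mathsf{co}_{\mathbf w'}(\mathbf a,\mathbf b,\pi)\ge \mathsf{co}^*_{\mathbf w}(\mathbf a,\mathbf b)$ for some $\mathbf w'$ that is obtained from $\mathbf w$ by replacing $w_{i+1}$ with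 $w_i$ for a single index $i\in[n-1]$. The machine is a randomized real RAM with words of $O(\log n)$ bits. Exact arithmetic and comparison of real numbers, word operations, array access, drawing a uniformly random integer below a given word, and evaluation of $f$ at a given point each take unit time. (1) There is a Las Vegas algorithm (one program for all $n$ and all instances) that, on every instance $(\mathbf a,\mathbf b,\mathbf w,f)$ as above, always halts and outputs a good ranking, and that runs in $O(n\log^2 n)$ time with high probability: for every $d\in\mathbb N$ there is a constant $C$, independent of $n$ and of the instance, such that the running time exceeds $C\,n\log^2 n$ with probability at most $n^{-d}$. (2) There is an algorithm that, if moreover all $a_j,b_j$ are integers bounded in absolute value by an integer $B\ge 2$, always outputs a good ranking in time $O(n\log n\log B)$, with a constant independent of $n$, $B$ and the instance. -/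

import Mathlib

open scoped ENNReal

namespace Ranking

/-! ### The ranking problem -/

/-- The cumulative score `cs_w(a, π) = ∑ j, w j * a (π j)`; position `j` of the ranking `π` holds
the result `π j`. -/
def cumScore {n : ℕ} (w a : Fin n → ℝ) (π : Equiv.Perm (Fin n)) : ℝ :=
  ∑ j, w j * a (π j)

/-- The combined objective `co_w(a, b, π) = f (cs_w(a, π), cs_w(b, π))`. -/
def combined {n : ℕ} (f : ℝ → ℝ → ℝ) (w a b : Fin n → ℝ) (π : Equiv.Perm (Fin n)) : ℝ :=
  f (cumScore w a π) (cumScore w b π)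

/-- The optimum `co*_w(a, b)`: the maximum of `co_w(a, b, π)` over all rankings `π`. -/
noncomputable def optCombined {n : ℕ} (f : ℝ → ℝ → ℝ) (w a b : Fin n → ℝ) : ℝ :=
  Finset.univ.sup' Finset.univ_nonempty (combined f w a b)

/-- The weight vector obtained from `w` by replacing its entry at `i + 1` with its entry
at `i` (positions are counted from `0`). -/
def advantaged {n : ℕ} (w : Fin n → ℝ) (i : ℕ) (hi : i + 1 < n) : Fin n → ℝ :=
  Function.update w ⟨i + 1, hi⟩ (w ⟨i, Nat.lt_of_succ_lt hi⟩)

/-- The instances of the ranking problem: nonnegative scores, nonnegative weakly decreasing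
weights, and an objective that is concave on the closed nonnegative quadrant and strictly
increasing in each coordinate there. -/
structure IsInstance {n : ℕ} (a b w : Fin n → ℝ) (f : ℝ → ℝ → ℝ) : Prop where
  a_nonneg : ∀ j, 0 ≤ a j
  b_nonneg : ∀ j, 0 ≤ b j
  w_nonneg : ∀ j, 0 ≤ w j
  w_antitone : Antitone w
  concave : ConcaveOn ℝ {p : ℝ × ℝ | 0 ≤ p.1 ∧ 0 ≤ p.2} (fun p => f p.1 p.2)
  strictMono_left : ∀ y, 0 ≤ y → StrictMonoOn (fun x => f x y) (Set.Ici 0)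
  strictMono_right : ∀ x, 0 ≤ x → StrictMonoOn (fun y => f x y) (Set.Ici 0)

/-- `π` does, for some weight vector `w'` that arises from `w` by replacing one entry with its
predecessor, at least as well as the optimum for `w`. -/
def IsGood {n : ℕ} (a b w : Fin n → ℝ) (f : ℝ → ℝ → ℝ) (π : Equiv.Perm (Fin n)) : Prop :=
  ∃ (i : ℕ) (hi : i + 1 < n),
    optCombined f w a b ≤ combined f (advantaged w i hi) a b π

/-! ### The machine: a randomized real RAM

A program is a finite piece of syntax. It works on registers and arrays of two sorts: words (natural
numbers below a word bound `W`, used for addresses and counters) and real numbers. Word arithmetic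
is modulo `W`. Real numbers can be added, subtracted, multiplied, divided and compared exactly, and
the objective `f` can be evaluated; there is no rounding and no conversion from reals to words.
Every elementary statement and every test takes one step. The expressions in it are part of the
fixed program, so each step performs a number of elementary operations that is bounded by a
constant depending only on the program. -/

/-- Word-valued expressions. -/
inductive NExpr : Type
  | const (k : ℕ)
  | reg (x : ℕ)
  | get (arr : ℕ) (i : NExpr)
  | add (e₁ e₂ : NExpr)
  | sub (e₁ e₂ : NExpr)
  | mul (e₁ e₂ : NExpr)
  | div (e₁ e₂ : NExpr)

/-- Real-valued expressions; `app` evaluates the objective. -/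
inductive RExpr : Type
  | ofWord (e : NExpr)
  | reg (x : ℕ)
  | get (arr : ℕ) (i : NExpr)
  | add (e₁ e₂ : RExpr)
  | sub (e₁ e₂ : RExpr)
  | mul (e₁ e₂ : RExpr)
  | div (e₁ e₂ : RExpr)
  | app (e₁ e₂ : RExpr)

/-- Tests. -/
inductive BExpr : Type
  | nlt (e₁ e₂ : NExpr)
  | nle (e₁ e₂ : NExpr)
  | rlt (e₁ e₂ : RExpr)
  | rle (e₁ e₂ : RExpr)
  | not (t : BExpr)
  | and (t₁ t₂ : BExpr)

/-- Programs. `rand x e` puts a uniformly random element of `{0, …, m - 1}` into the word register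
`x`, where `m` is the value of `e`. -/
inductive Stmt : Type
  | skip
  | setN (x : ℕ) (e : NExpr)
  | setR (x : ℕ) (e : RExpr)
  | putN (arr : ℕ) (i e : NExpr)
  | putR (arr : ℕ) (i : NExpr) (e : RExpr)
  | rand (x : ℕ) (e : NExpr)
  | seq (s₁ s₂ : Stmt)
  | ite (t : BExpr) (s₁ s₂ : Stmt)
  | while (t : BExpr) (s : Stmt)

/-- The memory: word registers, real registers, word arrays, real arrays. -/
structure Memory : Type where
  nreg : ℕ → ℕ
  rreg : ℕ → ℝ
  narr : ℕ → ℕ → ℕ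
  rarr : ℕ → ℕ → ℝ

/-- The value of a word expression, with word bound `W`. -/
def NExpr.eval (W : ℕ) (M : Memory) : NExpr → ℕ
  | .const k => k % W
  | .reg x => M.nreg x
  | .get arr i => M.narr arr (i.eval W M)
  | .add e₁ e₂ => (e₁.eval W M + e₂.eval W M) % W
  | .sub e₁ e₂ => e₁.eval W M - e₂.eval W M
  | .mul e₁ e₂ => (e₁.eval W M * e₂.eval W M) % W
  | .div e₁ e₂ => e₁.eval W M / e₂.eval W M

/-- The value of a real expression. -/
noncomputable def RExpr.eval (W : ℕ) (f : ℝ → ℝ → ℝ) (M : Memory) : RExpr → ℝ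
  | .ofWord e => (e.eval W M : ℝ)
  | .reg x => M.rreg x
  | .get arr i => M.rarr arr (i.eval W M)
  | .add e₁ e₂ => e₁.eval W f M + e₂.eval W f M
  | .sub e₁ e₂ => e₁.eval W f M - e₂.eval W f M
  | .mul e₁ e₂ => e₁.eval W f M * e₂.eval W f M
  | .div e₁ e₂ => e₁.eval W f M / e₂.eval W f M
  | .app e₁ e₂ => f (e₁.eval W f M) (e₂.eval W f M)

/-- Whether a test succeeds. -/
def BExpr.Holds (W : ℕ) (f : ℝ → ℝ → ℝ) (M : Memory) : BExpr → Prop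
  | .nlt e₁ e₂ => e₁.eval W M < e₂.eval W M
  | .nle e₁ e₂ => e₁.eval W M ≤ e₂.eval W M
  | .rlt e₁ e₂ => e₁.eval W f M < e₂.eval W f M
  | .rle e₁ e₂ => e₁.eval W f M ≤ e₂.eval W f M
  | .not t => ¬ t.Holds W f M
  | .and t₁ t₂ => t₁.Holds W f M ∧ t₂.Holds W f M

/-- Write a word register. -/
def Memory.setN (M : Memory) (x v : ℕ) : Memory :=
  { M with nreg := Function.update M.nreg x v }

/-- Write a real register. -/
def Memory.setR (M : Memory) (x : ℕ) (v : ℝ) : Memory :=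
  { M with rreg := Function.update M.rreg x v }

/-- Write an entry of a word array. -/
def Memory.putN (M : Memory) (arr i v : ℕ) : Memory :=
  { M with narr := Function.update M.narr arr (Function.update (M.narr arr) i v) }

/-- Write an entry of a real array. -/
def Memory.putR (M : Memory) (arr i : ℕ) (v : ℝ) : Memory :=
  { M with rarr := Function.update M.rarr arr (Function.update (M.rarr arr) i v) }

/-- A configuration: the statements still to be executed, in order, and the memory. The machine
has halted when no statement is left. -/
structure Config : Type where
  todo : List Stmt
  mem : Memory

/-- The uniform distribution on `{0, …, m - 1}` (on `{0}` if `m = 0`). -/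
noncomputable def uniformBelow (m : ℕ) : PMF ℕ :=
  (PMF.uniformOfFintype (Fin (m - 1 + 1))).map (fun v => (v : ℕ))

open Classical in
/-- One step of the machine. A halted configuration stays as it is. -/
noncomputable def step (W : ℕ) (f : ℝ → ℝ → ℝ) : Config → PMF Config
  | ⟨[], M⟩ => PMF.pure ⟨[], M⟩
  | ⟨.skip :: K, M⟩ => PMF.pure ⟨K, M⟩
  | ⟨.setN x e :: K, M⟩ => PMF.pure ⟨K, M.setN x (e.eval W M)⟩
  | ⟨.setR x e :: K, M⟩ => PMF.pure ⟨K, M.setR x (e.eval W f M)⟩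
  | ⟨.putN arr i e :: K, M⟩ => PMF.pure ⟨K, M.putN arr (i.eval W M) (e.eval W M)⟩
  | ⟨.putR arr i e :: K, M⟩ => PMF.pure ⟨K, M.putR arr (i.eval W M) (e.eval W f M)⟩
  | ⟨.rand x e :: K, M⟩ => (uniformBelow (e.eval W M)).map (fun v => ⟨K, M.setN x v⟩)
  | ⟨.seq s₁ s₂ :: K, M⟩ => PMF.pure ⟨s₁ :: s₂ :: K, M⟩
  | ⟨.ite t s₁ s₂ :: K, M⟩ =>
      PMF.pure (if t.Holds W f M then ⟨s₁ :: K, M⟩ else ⟨s₂ :: K, M⟩)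
  | ⟨.while t s :: K, M⟩ =>
      PMF.pure (if t.Holds W f M then ⟨s :: .while t s :: K, M⟩ else ⟨K, M⟩)

/-- The distribution of the configuration after `T` steps; successive random choices are
independent. -/
noncomputable def run (W : ℕ) (f : ℝ → ℝ → ℝ) : ℕ → Config → PMF Config
  | 0, c => PMF.pure c
  | T + 1, c => (step W f c).bind (run W f T)

/-- A vector as the content of an array; the entries outside its range are `0`. -/
def arrayOf {n : ℕ} (v : Fin n → ℝ) (i : ℕ) : ℝ :=
  if h : i < n then v ⟨i, h⟩ else 0

/-- The initial memory: word register `0` holds `n`, the real arrays `0`, `1`, `2` hold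
`a`, `b`, `w`, and everything else is `0`. -/
def inputMemory {n : ℕ} (a b w : Fin n → ℝ) : Memory where
  nreg := Function.update (fun _ => 0) 0 n
  rreg := fun _ => 0
  narr := fun _ _ => 0
  rarr
    | 0 => arrayOf a
    | 1 => arrayOf b
    | 2 => arrayOf w
    | _ => fun _ => 0

/-- The distribution of the configuration after `T` steps of the program `P` on the given input,
on a machine whose words have `κ` times as many bits as the binary expansion of `n`. -/
noncomputable def runOn (P : Stmt) (κ : ℕ) {n : ℕ} (a b w : Fin n → ℝ) (f : ℝ → ℝ → ℝ) (T : ℕ) :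
    PMF Config :=
  run (2 ^ (κ * Nat.size n)) f T ⟨[P], inputMemory a b w⟩

/-- The machine has halted. -/
def Config.Halted (c : Config) : Prop := c.todo = []

/-- The first `n` entries of word array `0` are the ranking `π`. -/
def Config.Outputs {n : ℕ} (c : Config) (π : Equiv.Perm (Fin n)) : Prop :=
  ∀ j : Fin n, c.mem.narr 0 j = π j

/-- Whatever the random choices, after `T` steps the program has halted with a ranking as output
that is good for the instance. -/
def SolvesWithin (P : Stmt) (κ : ℕ) {n : ℕ} (a b w : Fin n → ℝ) (f : ℝ → ℝ → ℝ) (T : ℕ) : Prop :=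
  ∀ c ∈ (runOn P κ a b w f T).support,
    c.Halted ∧ ∃ π : Equiv.Perm (Fin n), c.Outputs π ∧ IsGood a b w f π

/-- The probability that the program is still running after `T` steps. -/
noncomputable def probRunning (P : Stmt) (κ : ℕ) {n : ℕ} (a b w : Fin n → ℝ) (f : ℝ → ℝ → ℝ)
    (T : ℕ) : ℝ≥0∞ :=
  (runOn P κ a b w f T).toOuterMeasure {c | ¬ c.Halted}

end Ranking

/-! Picture a ranking `π` as the point with coordinates `cumScore w a π` and `cumScore w b π`. By
the rearrangement inequality, a ranking `σ` sorted by decreasing `key a b l` lies on a supporting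
line of all these points, with normal `(1 - l, l)` (`SortedAt.cumScore_le`). The direction test
compares `f` at `σ` with `f` at one further point of this line, the probe, which is higher by `S` in
the second coordinate. Here `S` is the largest gain in the second score that raising one weight to
its predecessor can bring. A ranking that beats `σ` by at most `S` in the second score, and not at
all in the first, is dominated by `σ` with such a raised weight; that value is offered to the
record, the best value seen so far of a ranking with advantaged weights. Concavity along the line
takes care of the rest of the losing side.

So a test has one of two outcomes: either all rankings with a larger second score are at most the
record (`excludesRight_of_not_lt`), or all rankings whose second score is at most that of `σ` plus a
slack are (`excludesLeft_of_lt`). The slack bridges an adjacent transposition: if `lo` excludes the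
left, `hi` excludes the right, and they differ by exchanging two neighbours, no ranking beats the
record (`combined_le_of_adjacent`), and the recorded ranking is good.

Such a pair has to be found with few tests. The search keeps `lo` and `hi`, sorted for weightings
`ll ≤ lh`. Every pair of results inverted between them has one crossing, the weighting at which its
keys agree, and stably sorting `lo` or `hi` for `l` keeps exactly the inversions with crossings
strictly on one side of `l` (`SearchInv.inverted_left`, `SearchInv.inverted_right`). A round costs
at most two merge sorts and two linear tests. At the crossing of a uniformly random inversion it
leaves at most three quarters of the inversions on average, however the tests turn out
(`four_mul_sum_le`). As there are at most `n * n` inversions, `O(log n)` rounds suffice with high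
probability; as the drawn inversion always disappears, the search ends in any case. Merge sort also
counts inversions, which makes the one with a given number accessible. For integer scores up to `β`,
crossings are fractions with denominators at most `2 * β`, so `O(log β)` halvings of `[ll, lh]`
leave at most one crossing (`crossing_eq_of_close`), and one more round removes it.

At the end `lo` and `hi` are sorted for the same weighting. They are joined by a path of `n * n`
steps, each trivial or an adjacent transposition, through rankings sorted for that weighting
(`OnPath.step`, `OnPath.sortedAt`). Each ranking on the path is computable in linear time, so a
binary search with `O(log n)` tests finds the desired neighbours. -/

namespace Ranking

/-! ### Big-step semantics of the deterministic fragment -/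

/-- `Big W f s M t M'`: the statement `s`, which draws no random numbers, leads from the memory `M`
to the memory `M'` in `t` steps. -/
inductive Big (W : ℕ) (f : ℝ → ℝ → ℝ) : Stmt → Memory → ℕ → Memory → Prop
  | skip (M) : Big W f .skip M 1 M
  | setN (x e M) : Big W f (.setN x e) M 1 (M.setN x (e.eval W M))
  | setR (x e M) : Big W f (.setR x e) M 1 (M.setR x (e.eval W f M))
  | putN (arr i e M) : Big W f (.putN arr i e) M 1 (M.putN arr (i.eval W M) (e.eval W M))
  | putR (arr i e M) : Big W f (.putR arr i e) M 1 (M.putR arr (i.eval W M) (e.eval W f M))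
  | seq {s₁ s₂ M t₁ M₁ t₂ M₂} : Big W f s₁ M t₁ M₁ → Big W f s₂ M₁ t₂ M₂ →
      Big W f (.seq s₁ s₂) M (t₁ + t₂ + 1) M₂
  | iteT {t s₁ s₂ M t₁ M₁} : t.Holds W f M → Big W f s₁ M t₁ M₁ →
      Big W f (.ite t s₁ s₂) M (t₁ + 1) M₁
  | iteF {t s₁ s₂ M t₁ M₁} : ¬ t.Holds W f M → Big W f s₂ M t₁ M₁ →
      Big W f (.ite t s₁ s₂) M (t₁ + 1) M₁
  | whileF {t s M} : ¬ t.Holds W f M → Big W f (.while t s) M 1 M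
  | whileT {t s M t₁ M₁ t₂ M₂} : t.Holds W f M → Big W f s M t₁ M₁ →
      Big W f (.while t s) M₁ t₂ M₂ → Big W f (.while t s) M (t₁ + t₂ + 1) M₂

theorem run_succ_of_step {W : ℕ} {f : ℝ → ℝ → ℝ} {c c' : Config} (h : step W f c = PMF.pure c')
    (T : ℕ) : run W f (T + 1) c = run W f T c' := by
  rw [run, h, PMF.pure_bind]

/-- The continuation `K` and the surplus `T` are general so that consecutive statements chain in the
induction, and so that a deterministic piece can be cut off the front of a randomized run. -/
theorem Big.run_eq {W : ℕ} {f : ℝ → ℝ → ℝ} {s : Stmt} {M M' : Memory} {t : ℕ}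
    (h : Big W f s M t M') (K : List Stmt) (T : ℕ) :
    run W f (t + T) ⟨s :: K, M⟩ = run W f T ⟨K, M'⟩ := by
  induction h generalizing K T with
  | skip | setN | setR | putN | putR => rw [add_comm]; exact run_succ_of_step rfl T
  | @seq s₁ s₂ M t₁ M₁ t₂ M₂ _ _ ih₁ ih₂ =>
    rw [show t₁ + t₂ + 1 + T = (t₁ + (t₂ + T)) + 1 by ring,
      run_succ_of_step (c' := ⟨s₁ :: s₂ :: K, M⟩) rfl, ih₁, ih₂]
  | @iteT t s₁ s₂ M t₁ M₁ ht _ ih =>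
    rw [show t₁ + 1 + T = (t₁ + T) + 1 by ring,
      run_succ_of_step (c' := ⟨s₁ :: K, M⟩) (by simp [step, ht]), ih]
  | @iteF t s₁ s₂ M t₁ M₁ ht _ ih =>
    rw [show t₁ + 1 + T = (t₁ + T) + 1 by ring,
      run_succ_of_step (c' := ⟨s₂ :: K, M⟩) (by simp [step, ht]), ih]
  | @whileF t s M ht =>
    rw [add_comm, run_succ_of_step (c' := ⟨K, M⟩) (by simp [step, ht])]
  | @whileT t s M t₁ M₁ t₂ M₂ ht _ _ ih₁ ih₂ =>
    rw [show t₁ + t₂ + 1 + T = (t₁ + (t₂ + T)) + 1 by ring,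
      run_succ_of_step (c' := ⟨s :: .while t s :: K, M⟩) (by simp [step, ht]), ih₁, ih₂]

/-! ### What a statement can change -/

/-- The word registers that a statement may write. -/
def Stmt.writesN : Stmt → ℕ → Bool
  | .setN x _, r => r == x
  | .rand x _, r => r == x
  | .seq s₁ s₂, r => s₁.writesN r || s₂.writesN r
  | .ite _ s₁ s₂, r => s₁.writesN r || s₂.writesN r
  | .while _ s, r => s.writesN r
  | _, _ => false

/-- The real registers that a statement may write. -/
def Stmt.writesR : Stmt → ℕ → Bool
  | .setR x _, r => r == x
  | .seq s₁ s₂, r => s₁.writesR r || s₂.writesR r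
  | .ite _ s₁ s₂, r => s₁.writesR r || s₂.writesR r
  | .while _ s, r => s.writesR r
  | _, _ => false

/-- The word arrays that a statement may write. -/
def Stmt.writesNA : Stmt → ℕ → Bool
  | .putN x _ _, r => r == x
  | .seq s₁ s₂, r => s₁.writesNA r || s₂.writesNA r
  | .ite _ s₁ s₂, r => s₁.writesNA r || s₂.writesNA r
  | .while _ s, r => s.writesNA r
  | _, _ => false

/-- The real arrays that a statement may write. -/
def Stmt.writesRA : Stmt → ℕ → Bool
  | .putR x _ _, r => r == x
  | .seq s₁ s₂, r => s₁.writesRA r || s₂.writesRA r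
  | .ite _ s₁ s₂, r => s₁.writesRA r || s₂.writesRA r
  | .while _ s, r => s.writesRA r
  | _, _ => false

/-- `M` and `M'` agree on everything that `s` does not write. -/
structure Frame (s : Stmt) (M M' : Memory) : Prop where
  n : ∀ r, s.writesN r = false → M'.nreg r = M.nreg r
  r : ∀ r, s.writesR r = false → M'.rreg r = M.rreg r
  na : ∀ r, s.writesNA r = false → M'.narr r = M.narr r
  ra : ∀ r, s.writesRA r = false → M'.rarr r = M.rarr r

/-- Write sets are Boolean functions of the syntax, so preservation of a given register or array is
settled by evaluation. This carries everything that a statement leaves alone through the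
specifications. -/
theorem Big.frame {W : ℕ} {f : ℝ → ℝ → ℝ} {s : Stmt} {M M' : Memory} {t : ℕ}
    (h : Big W f s M t M') : Frame s M M' := by
  induction h with
  | skip | whileF => exact ⟨fun _ _ => rfl, fun _ _ => rfl, fun _ _ => rfl, fun _ _ => rfl⟩
  | setN | setR | putN | putR =>
    constructor <;> intro r hr <;>
      simp_all [Memory.setN, Memory.setR, Memory.putN, Memory.putR, Stmt.writesN, Stmt.writesR,
        Stmt.writesNA, Stmt.writesRA]
  | seq _ _ ih₁ ih₂ =>
    constructor <;> intro r hr <;>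
      simp only [Stmt.writesN, Stmt.writesR, Stmt.writesNA, Stmt.writesRA,
        Bool.or_eq_false_iff] at hr
    · rw [ih₂.n r hr.2, ih₁.n r hr.1]
    · rw [ih₂.r r hr.2, ih₁.r r hr.1]
    · rw [ih₂.na r hr.2, ih₁.na r hr.1]
    · rw [ih₂.ra r hr.2, ih₁.ra r hr.1]
  | iteT _ _ ih =>
    constructor <;> intro r hr <;>
      simp only [Stmt.writesN, Stmt.writesR, Stmt.writesNA, Stmt.writesRA,
        Bool.or_eq_false_iff] at hr
    · rw [ih.n r hr.1]
    · rw [ih.r r hr.1]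
    · rw [ih.na r hr.1]
    · rw [ih.ra r hr.1]
  | iteF _ _ ih =>
    constructor <;> intro r hr <;>
      simp only [Stmt.writesN, Stmt.writesR, Stmt.writesNA, Stmt.writesRA,
        Bool.or_eq_false_iff] at hr
    · rw [ih.n r hr.2]
    · rw [ih.r r hr.2]
    · rw [ih.na r hr.2]
    · rw [ih.ra r hr.2]
  | whileT _ _ _ ih₁ ih₂ =>
    constructor <;> intro r hr
    · rw [ih₂.n r hr, ih₁.n r hr]
    · rw [ih₂.r r hr, ih₁.r r hr]
    · rw [ih₂.na r hr, ih₁.na r hr]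
    · rw [ih₂.ra r hr, ih₁.ra r hr]

/-! ### Specifications -/

/-- `s` terminates from `M`, and the number of steps and the final memory satisfy `Q`. -/
def Spec (W : ℕ) (f : ℝ → ℝ → ℝ) (s : Stmt) (M : Memory) (Q : ℕ → Memory → Prop) : Prop :=
  ∃ t M', Big W f s M t M' ∧ Q t M'

variable {W : ℕ} {f : ℝ → ℝ → ℝ}

theorem Spec.mono {s : Stmt} {M : Memory} {Q Q' : ℕ → Memory → Prop} (h : Spec W f s M Q)
    (hQ : ∀ t M', Frame s M M' → Q t M' → Q' t M') : Spec W f s M Q' := by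
  obtain ⟨t, M', hb, hq⟩ := h
  exact ⟨t, M', hb, hQ t M' hb.frame hq⟩

theorem spec_skip {M : Memory} {Q : ℕ → Memory → Prop} : Spec W f .skip M Q ↔ Q 1 M :=
  ⟨fun ⟨_, _, hb, hq⟩ => by cases hb; exact hq, fun h => ⟨_, _, .skip M, h⟩⟩

theorem spec_setN {x : ℕ} {e : NExpr} {M : Memory} {Q : ℕ → Memory → Prop} :
    Spec W f (.setN x e) M Q ↔ Q 1 (M.setN x (e.eval W M)) :=
  ⟨fun ⟨_, _, hb, hq⟩ => by cases hb; exact hq, fun h => ⟨_, _, .setN x e M, h⟩⟩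

theorem spec_setR {x : ℕ} {e : RExpr} {M : Memory} {Q : ℕ → Memory → Prop} :
    Spec W f (.setR x e) M Q ↔ Q 1 (M.setR x (e.eval W f M)) :=
  ⟨fun ⟨_, _, hb, hq⟩ => by cases hb; exact hq, fun h => ⟨_, _, .setR x e M, h⟩⟩

theorem spec_putN {arr : ℕ} {i e : NExpr} {M : Memory} {Q : ℕ → Memory → Prop} :
    Spec W f (.putN arr i e) M Q ↔ Q 1 (M.putN arr (i.eval W M) (e.eval W M)) :=
  ⟨fun ⟨_, _, hb, hq⟩ => by cases hb; exact hq, fun h => ⟨_, _, .putN arr i e M, h⟩⟩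

theorem spec_putR {arr : ℕ} {i : NExpr} {e : RExpr} {M : Memory} {Q : ℕ → Memory → Prop} :
    Spec W f (.putR arr i e) M Q ↔ Q 1 (M.putR arr (i.eval W M) (e.eval W f M)) :=
  ⟨fun ⟨_, _, hb, hq⟩ => by cases hb; exact hq, fun h => ⟨_, _, .putR arr i e M, h⟩⟩

theorem spec_seq {s₁ s₂ : Stmt} {M : Memory} {Q : ℕ → Memory → Prop} :
    Spec W f (.seq s₁ s₂) M Q ↔
      Spec W f s₁ M (fun t₁ M₁ => Spec W f s₂ M₁ (fun t₂ M₂ => Q (t₁ + t₂ + 1) M₂)) := by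
  constructor
  · rintro ⟨_, _, hb, hq⟩
    cases hb with
    | seq h₁ h₂ => exact ⟨_, _, h₁, _, _, h₂, hq⟩
  · rintro ⟨_, _, h₁, _, _, h₂, hq⟩
    exact ⟨_, _, .seq h₁ h₂, hq⟩

open Classical in
theorem spec_ite {t : BExpr} {s₁ s₂ : Stmt} {M : Memory} {Q : ℕ → Memory → Prop} :
    Spec W f (.ite t s₁ s₂) M Q ↔
      if t.Holds W f M then Spec W f s₁ M (fun t₁ M₁ => Q (t₁ + 1) M₁)
      else Spec W f s₂ M (fun t₁ M₁ => Q (t₁ + 1) M₁) := by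
  split_ifs with h
  · constructor
    · rintro ⟨_, _, hb, hq⟩
      cases hb with
      | iteT _ h₁ => exact ⟨_, _, h₁, hq⟩
      | iteF h' _ => exact absurd h h'
    · rintro ⟨_, _, h₁, hq⟩
      exact ⟨_, _, .iteT h h₁, hq⟩
  · constructor
    · rintro ⟨_, _, hb, hq⟩
      cases hb with
      | iteT h' _ => exact absurd h' h
      | iteF _ h₁ => exact ⟨_, _, h₁, hq⟩
    · rintro ⟨_, _, h₁, hq⟩
      exact ⟨_, _, .iteF h h₁, hq⟩

/-- Sequential composition with the frame of the first statement at hand. -/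
theorem Spec.seq {s₁ s₂ : Stmt} {M : Memory} {P Q : ℕ → Memory → Prop}
    (h : Spec W f s₁ M P)
    (h' : ∀ t₁ M₁, Frame s₁ M M₁ → P t₁ M₁ →
      Spec W f s₂ M₁ (fun t₂ M₂ => Q (t₁ + t₂ + 1) M₂)) :
    Spec W f (.seq s₁ s₂) M Q :=
  spec_seq.2 (h.mono h')

/-- A loop with the invariant `I j`, where `j` bounds the number of remaining iterations. -/
theorem Spec.while {t : BExpr} {s : Stmt} (I : ℕ → Memory → Prop) (B : ℕ)
    (hI : ∀ j M, I j M → t.Holds W f M →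
      ∃ i < j, Spec W f s M (fun t' M' => t' ≤ B ∧ I i M'))
    (j : ℕ) (M : Memory) (h : I j M) :
    Spec W f (.while t s) M
      (fun t' M' => t' ≤ j * (B + 1) + 1 ∧ (∃ i, I i M') ∧ ¬ t.Holds W f M') := by
  induction j using Nat.strong_induction_on generalizing M with
  | _ j ih =>
    by_cases ht : t.Holds W f M
    · obtain ⟨i, hi, t₁, M₁, hb, ht₁, h₁⟩ := hI j M h ht
      obtain ⟨t₂, M₂, hb₂, ht₂, h₂⟩ := ih i hi M₁ h₁
      refine ⟨_, _, .whileT ht hb hb₂, ?_, h₂⟩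
      -- This iteration costs its test and at most `B` steps, hence `B + 1`; the counter may drop by
      -- more than one.
      have : (i + 1) * (B + 1) ≤ j * (B + 1) := Nat.mul_le_mul_right _ hi
      nlinarith
    · exact ⟨_, _, .whileF ht, by omega, ⟨j, h⟩, ht⟩

/-- The statement `for r := 0 to n - 1 do s`, where `n` is the content of word register `0`. -/
def forLoop (r : ℕ) (s : Stmt) : Stmt :=
  .seq (.setN r (.const 0)) (.while (.nlt (.reg r) (.reg 0))
    (.seq s (.setN r (.add (.reg r) (.const 1)))))

/-- Each pass adds three steps to its body (test, sequencing, increment), and three more occur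
outside the passes (sequencing, initialization, last test). The condition `hW` keeps the counter
from wrapping around modulo `W`. -/
theorem Spec.for {r : ℕ} {s : Stmt} {n : ℕ} (hr : r ≠ 0) (I : ℕ → Memory → Prop) (B : ℕ)
    (hW : n + 1 < W) (M : Memory) (hn : M.nreg 0 = n) (h0 : I 0 (M.setN r 0))
    (hs : s.writesN 0 = false ∧ s.writesN r = false)
    (h : ∀ q < n, ∀ M', M'.nreg 0 = n → M'.nreg r = q → I q M' →
      Spec W f s M' (fun t M'' => t ≤ B ∧ I (q + 1) (M''.setN r (q + 1)))) :
    Spec W f (forLoop r s) M (fun t M' => t ≤ n * (B + 3) + 3 ∧ I n M') := by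
  rw [forLoop, spec_seq, spec_setN]
  have h0' : NExpr.eval W M (.const 0) = 0 := by simp [NExpr.eval]
  rw [h0']
  have := Spec.while (W := W) (f := f) (t := .nlt (.reg r) (.reg 0))
    (s := .seq s (.setN r (.add (.reg r) (.const 1))))
    (fun j M' => ∃ q, q + j = n ∧ M'.nreg 0 = n ∧ M'.nreg r = q ∧ I q M') (B + 2) ?_ n
    (M.setN r 0) ⟨0, by simp, by simp [Memory.setN, hr.symm, hn], by simp [Memory.setN], h0⟩
  · refine this.mono ?_
    rintro t M' - ⟨ht, ⟨j, q, hq, hn', hr', hI⟩, hh⟩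
    simp only [BExpr.Holds, NExpr.eval, hn', hr', not_lt] at hh
    have : q = n := by omega
    subst this
    exact ⟨by nlinarith, hI⟩
  · rintro j M' ⟨q, hq, hn', hr', hI⟩ hh
    simp only [BExpr.Holds, NExpr.eval, hn', hr'] at hh
    refine ⟨j - 1, by omega, ?_⟩
    refine Spec.seq (h q hh M' hn' hr' hI) ?_
    rintro t₁ M₁ hF ⟨ht₁, hI₁⟩
    rw [spec_setN]
    have e : NExpr.eval W M₁ (.add (.reg r) (.const 1)) = q + 1 := by
      have e1 : M₁.nreg r = q := by rw [hF.n r hs.2, hr']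
      simp only [NExpr.eval, e1]
      rw [Nat.mod_eq_of_lt (a := 1) (by omega), Nat.mod_eq_of_lt (by omega)]
    rw [e]
    refine ⟨by omega, q + 1, by omega, ?_, by simp [Memory.setN], hI₁⟩
    simp [Memory.setN, hr.symm, hF.n 0 hs.1, hn']

/-! ### Reading the memory after a write -/

@[simp] theorem Memory.setN_nreg (M : Memory) (x v r : ℕ) :
    (M.setN x v).nreg r = if r = x then v else M.nreg r := by
  simp [Memory.setN, Function.update_apply]
@[simp] theorem Memory.setN_rreg (M : Memory) (x v : ℕ) : (M.setN x v).rreg = M.rreg := rfl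
@[simp] theorem Memory.setN_narr (M : Memory) (x v : ℕ) : (M.setN x v).narr = M.narr := rfl
@[simp] theorem Memory.setN_rarr (M : Memory) (x v : ℕ) : (M.setN x v).rarr = M.rarr := rfl
@[simp] theorem Memory.setR_rreg (M : Memory) (x : ℕ) (v : ℝ) (r : ℕ) :
    (M.setR x v).rreg r = if r = x then v else M.rreg r := by
  simp [Memory.setR, Function.update_apply]
@[simp] theorem Memory.setR_nreg (M : Memory) (x : ℕ) (v : ℝ) : (M.setR x v).nreg = M.nreg := rfl
@[simp] theorem Memory.setR_narr (M : Memory) (x : ℕ) (v : ℝ) : (M.setR x v).narr = M.narr := rfl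
@[simp] theorem Memory.setR_rarr (M : Memory) (x : ℕ) (v : ℝ) : (M.setR x v).rarr = M.rarr := rfl
@[simp] theorem Memory.putN_narr (M : Memory) (x i v r : ℕ) :
    (M.putN x i v).narr r = if r = x then Function.update (M.narr x) i v else M.narr r := by
  simp [Memory.putN, Function.update_apply]
@[simp] theorem Memory.putN_nreg (M : Memory) (x i v : ℕ) : (M.putN x i v).nreg = M.nreg := rfl
@[simp] theorem Memory.putN_rreg (M : Memory) (x i v : ℕ) : (M.putN x i v).rreg = M.rreg := rfl
@[simp] theorem Memory.putN_rarr (M : Memory) (x i v : ℕ) : (M.putN x i v).rarr = M.rarr := rfl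
@[simp] theorem Memory.putR_rarr (M : Memory) (x i : ℕ) (v : ℝ) (r : ℕ) :
    (M.putR x i v).rarr r = if r = x then Function.update (M.rarr x) i v else M.rarr r := by
  simp [Memory.putR, Function.update_apply]
@[simp] theorem Memory.putR_nreg (M : Memory) (x i : ℕ) (v : ℝ) :
    (M.putR x i v).nreg = M.nreg := rfl
@[simp] theorem Memory.putR_rreg (M : Memory) (x i : ℕ) (v : ℝ) :
    (M.putR x i v).rreg = M.rreg := rfl
@[simp] theorem Memory.putR_narr (M : Memory) (x i : ℕ) (v : ℝ) :
    (M.putR x i v).narr = M.narr := rfl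

/-- The statement that copies the first `n` entries of a word array. -/
def copyArr (src dst : ℕ) : Stmt :=
  forLoop 7 (.putN dst (.reg 7) (.get src (.reg 7)))

theorem copyArr_spec {n src dst : ℕ} (hsd : src ≠ dst) (hW : n + 1 < W) {M : Memory}
    (hn : M.nreg 0 = n) :
    Spec W f (copyArr src dst) M
      (fun t M' => t ≤ 4 * n + 3 ∧ ∀ q < n, M'.narr dst q = M.narr src q) := by
  refine (Spec.for (by decide) (fun q M' => M'.narr src = M.narr src ∧
    ∀ p < q, M'.narr dst p = M.narr src p) 1 hW M hn (by simp) (by simp [Stmt.writesN]) ?_).mono ?_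
  · rintro q hq M' hn' hr ⟨h1, h2⟩
    simp only [spec_putN, NExpr.eval, hr, h1]
    simp only [le_refl, Memory.setN_narr, Memory.putN_narr, hsd, if_false, h1, true_and, if_true]
    intro p hp
    rcases Nat.lt_succ_iff_lt_or_eq.1 hp with h | rfl
    · rw [Function.update_of_ne (by omega), h2 p h]
    · simp
  · rintro t M' - ⟨ht, -, h⟩
    exact ⟨by omega, h⟩

end Ranking

namespace Ranking

/-! ### Rankings stored in arrays -/

/-- The first `n` entries of `V` are a permutation of `{0, …, n - 1}`. -/
def IsRank (n : ℕ) (V : ℕ → ℕ) : Prop :=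
  (∀ q < n, V q < n) ∧ ∀ p < n, ∀ q < n, V p = V q → p = q

/-- `x` stands before `y` in the ranking `V`. -/
def Before (n : ℕ) (V : ℕ → ℕ) (x y : ℕ) : Prop :=
  ∃ p q, p < q ∧ q < n ∧ V p = x ∧ V q = y

theorem IsRank.congr {n : ℕ} {V V' : ℕ → ℕ} (h : IsRank n V) (e : ∀ q < n, V' q = V q) :
    IsRank n V' :=
  ⟨fun q hq => by rw [e q hq]; exact h.1 q hq,
    fun p hp q hq => by rw [e q hq, e p hp]; exact h.2 p hp q hq⟩

theorem Before.congr {n : ℕ} {V V' : ℕ → ℕ} {x y : ℕ} (e : ∀ q < n, V' q = V q)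
    (h : Before n V x y) : Before n V' x y := by
  obtain ⟨p, q, hpq, hq, hx, hy⟩ := h
  exact ⟨p, q, hpq, hq, by rw [e p (by omega), hx], by rw [e q hq, hy]⟩

theorem before_congr {n : ℕ} {V V' : ℕ → ℕ} {x y : ℕ} (e : ∀ q < n, V' q = V q) :
    Before n V' x y ↔ Before n V x y :=
  ⟨fun h => h.congr fun q hq => (e q hq).symm, fun h => h.congr e⟩

theorem IsRank.before_iff {n : ℕ} {V : ℕ → ℕ} (h : IsRank n V) {p q : ℕ} (hp : p < n)
    (hq : q < n) : Before n V (V p) (V q) ↔ p < q := by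
  constructor
  · rintro ⟨p', q', hpq, hq', hx, hy⟩
    rw [← h.2 p' (by omega) p hp hx, ← h.2 q' hq' q hq hy]
    exact hpq
  · exact fun hpq => ⟨p, q, hpq, hq, rfl, rfl⟩

theorem IsRank.surj {n : ℕ} {V : ℕ → ℕ} (h : IsRank n V) {x : ℕ} (hx : x < n) :
    ∃ p < n, V p = x := by
  have := Finset.surj_on_of_inj_on_of_card_le (s := Finset.range n) (t := Finset.range n)
    (fun a _ => V a) (fun a ha => Finset.mem_range.2 (h.1 a (Finset.mem_range.1 ha)))
    (fun a b ha hb e => h.2 a (Finset.mem_range.1 ha) b (Finset.mem_range.1 hb) e) le_rfl x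
    (Finset.mem_range.2 hx)
  obtain ⟨p, hp, e⟩ := this
  exact ⟨p, Finset.mem_range.1 hp, e.symm⟩

theorem IsRank.asymm {n : ℕ} {V : ℕ → ℕ} (h : IsRank n V) {x y : ℕ} (hb : Before n V x y) :
    ¬ Before n V y x := by
  obtain ⟨p, q, hpq, hq, rfl, rfl⟩ := hb
  rw [h.before_iff hq (by omega)]
  omega

theorem IsRank.total {n : ℕ} {V : ℕ → ℕ} (h : IsRank n V) {x y : ℕ} (hx : x < n) (hy : y < n)
    (hxy : x ≠ y) : Before n V x y ∨ Before n V y x := by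
  obtain ⟨p, hp, rfl⟩ := h.surj hx
  obtain ⟨q, hq, rfl⟩ := h.surj hy
  rw [h.before_iff hp hq, h.before_iff hq hp]
  have : p ≠ q := fun e => hxy (by rw [e])
  omega

/-! ### Moving one entry ahead -/

/-- The index map of the rotation that brings the entry at `k` to position `o ≤ k`. -/
def rot (o k r : ℕ) : ℕ := if r = o then k else if o < r ∧ r ≤ k then r - 1 else r

theorem rot_of_lt {o k r : ℕ} (h : r < o) : rot o k r = r := by unfold rot; split_ifs <;> omega

theorem rot_self (o k : ℕ) : rot o k o = k := by simp [rot]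

theorem rot_of_mem {o k r : ℕ} (h : o < r) (h' : r ≤ k) : rot o k r = r - 1 := by
  unfold rot; split_ifs <;> omega

theorem rot_of_gt {o k r : ℕ} (ho : o ≤ k) (h : k < r) : rot o k r = r := by
  unfold rot; split_ifs <;> omega

theorem rot_lt {n o k r : ℕ} (hk : k < n) (hr : r < n) : rot o k r < n := by
  unfold rot; split_ifs <;> omega

theorem rot_inj {o k r s : ℕ} (ho : o ≤ k) (h : rot o k r = rot o k s) : r = s := by
  unfold rot at h; split_ifs at h <;> omega

theorem IsRank.rot {n o k : ℕ} {V : ℕ → ℕ} (h : IsRank n V) (ho : o ≤ k) (hk : k < n) :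
    IsRank n (fun r => V (rot o k r)) :=
  ⟨fun _ hq => h.1 _ (rot_lt hk hq), fun _ hp _ hq e =>
    rot_inj ho (h.2 _ (rot_lt hk hp) _ (rot_lt hk hq) e)⟩

/-- A rotation changes only the order between the moved entry and the entries that it passes. -/
theorem Before.of_rot {n o k : ℕ} {V : ℕ → ℕ} (ho : o ≤ k) (hk : k < n) {x y : ℕ}
    (hb : Before n (fun r => V (rot o k r)) x y) :
    Before n V x y ∨ (x = V k ∧ ∃ q, o ≤ q ∧ q < k ∧ y = V q) := by
  obtain ⟨p, q, hpq, hq, rfl, rfl⟩ := hb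
  by_cases h : p = o ∧ q ≤ k
  · right
    refine ⟨by simp [Ranking.rot, h.1], q - 1, by omega, by omega, ?_⟩
    simp only [Ranking.rot]
    rw [if_neg (by omega), if_pos (by omega)]
  · left
    refine ⟨_, _, ?_, rot_lt hk hq, rfl, rfl⟩
    unfold Ranking.rot
    split_ifs <;> omega

theorem Before.to_rot {n o k : ℕ} {V : ℕ → ℕ} (ho : o ≤ k) (hk : k < n) {x y : ℕ}
    (hb : Before n V x y) :
    Before n (fun r => V (rot o k r)) x y ∨ (y = V k ∧ ∃ q, o ≤ q ∧ q < k ∧ x = V q) := by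
  obtain ⟨p, q, hpq, hq, rfl, rfl⟩ := hb
  by_cases h : q = k ∧ o ≤ p
  · right
    exact ⟨by rw [h.1], p, h.2, by omega, rfl⟩
  · left
    -- `g` inverts `rot o k`: it sends old positions to new ones.
    let g : ℕ → ℕ := fun r => if r = k then o else if o ≤ r ∧ r < k then r + 1 else r
    have hg : ∀ r, Ranking.rot o k (g r) = r := by
      intro r; simp only [g, Ranking.rot]; split_ifs <;> omega
    refine ⟨g p, g q, ?_, ?_, by simp only [hg], by simp only [hg]⟩
    · simp only [g]; split_ifs <;> omega
    · simp only [g]; split_ifs <;> omega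

theorem before_rot {n o k q : ℕ} {V : ℕ → ℕ} (hoq : o ≤ q) (hqk : q < k) (hk : k < n) :
    Before n (fun r => V (rot o k r)) (V k) (V q) := by
  refine ⟨o, q + 1, by omega, by omega, by simp [rot], ?_⟩
  simp only [rot]
  rw [if_neg (by omega), if_pos (by omega)]
  rfl

/-! ### Overtakings in a stable sort -/

open Classical in
/-- The invariant of a stable sort of the ranking `L` by decreasing keys: `V` is the current ranking,
and `cnt x` counts the entries that `x` has overtaken. -/
structure SortInv (n : ℕ) (L : ℕ → ℕ) (K : ℕ → ℝ) (V cnt : ℕ → ℕ) : Prop where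
  rank : IsRank n V
  mono : ∀ x y, Before n L y x → Before n V x y → K y < K x
  cnt : ∀ x < n, cnt x = ((Finset.range n).filter
    (fun y => Before n L y x ∧ Before n V x y)).card

theorem SortInv.congr {n : ℕ} {L V V' cnt cnt' : ℕ → ℕ} {K : ℕ → ℝ} (h : SortInv n L K V cnt)
    (hV : ∀ q < n, V' q = V q) (hc : ∀ q < n, cnt' q = cnt q) : SortInv n L K V' cnt' := by
  refine ⟨h.rank.congr hV, fun x y h1 h2 => h.mono x y h1 ((before_congr hV).1 h2),
    fun x hx => ?_⟩
  rw [hc x hx, h.cnt x hx]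
  congr 1
  ext y
  simp only [Finset.mem_filter, before_congr (n := n) hV]

theorem SortInv.init {n : ℕ} {L cnt : ℕ → ℕ} {K : ℕ → ℝ} (h : IsRank n L)
    (hc : ∀ x < n, cnt x = 0) : SortInv n L K L cnt := by
  refine ⟨h, fun x y h1 h2 => absurd h2 (h.asymm h1), fun x hx => ?_⟩
  classical
  rw [hc x hx, eq_comm, Finset.card_eq_zero, Finset.filter_eq_empty_iff]
  rintro y - ⟨h1, h2⟩
  exact h.asymm h1 h2

/-- The passed entries have smaller keys, so by `mono` none of them can have overtaken `V k`
earlier: all of them precede it in `L`. Hence every passing is a new overtaking, the counter of `V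
k` grows by exactly `k - o`, and no other counter changes. -/
theorem SortInv.jump {n o k : ℕ} {L V cnt : ℕ → ℕ} {K : ℕ → ℝ} (hL : IsRank n L)
    (h : SortInv n L K V cnt) (ho : o ≤ k) (hk : k < n)
    (hK : ∀ q, o ≤ q → q < k → K (V q) < K (V k)) :
    SortInv n L K (fun r => V (rot o k r))
      (Function.update cnt (V k) (cnt (V k) + (k - o))) := by
  classical
  have hov : ∀ q, o ≤ q → q < k → Before n L (V q) (V k) := by
    intro q hoq hqk
    have hne : V q ≠ V k := fun e => by
      have := h.rank.2 q (by omega) k hk e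
      omega
    rcases hL.total (h.rank.1 q (by omega)) (h.rank.1 k hk) hne with h1 | h1
    · exact h1
    · have := h.mono _ _ h1 ((h.rank.before_iff (by omega) hk).2 hqk)
      exact absurd (hK q hoq hqk) (not_lt.2 this.le)
  refine ⟨h.rank.rot ho hk, fun x y h1 h2 => ?_, fun x hx => ?_⟩
  · rcases h2.of_rot ho hk with h3 | ⟨rfl, q, hoq, hqk, rfl⟩
    · exact h.mono x y h1 h3
    · exact hK q hoq hqk
  · by_cases hxk : x = V k
    · subst hxk
      rw [Function.update_self, h.cnt _ hx]
      have himg : ((Finset.Ico o k).image V).card = k - o := by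
        rw [Finset.card_image_of_injOn, Nat.card_Ico]
        intro p hp q hq e
        simp only [Finset.coe_Ico, Set.mem_Ico] at hp hq
        exact h.rank.2 p (by omega) q (by omega) e
      rw [← himg, ← Finset.card_union_of_disjoint]
      · congr 1
        ext y
        simp only [Finset.mem_union, Finset.mem_filter, Finset.mem_range, Finset.mem_image,
          Finset.mem_Ico]
        constructor
        · rintro (⟨hy, h1, h2⟩ | ⟨q, ⟨hoq, hqk⟩, rfl⟩)
          · refine ⟨hy, h1, ?_⟩
            rcases h2.to_rot ho hk with h3 | ⟨e, q, hoq, hqk, e'⟩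
            · exact h3
            · subst e
              exact absurd h2 (h.rank.asymm h2)
          · exact ⟨h.rank.1 q (by omega), hov q hoq hqk, before_rot hoq hqk hk⟩
        · rintro ⟨hy, h1, h2⟩
          rcases h2.of_rot ho hk with h3 | ⟨-, q, hoq, hqk, rfl⟩
          · exact Or.inl ⟨hy, h1, h3⟩
          · exact Or.inr ⟨q, ⟨hoq, hqk⟩, rfl⟩
      · rw [Finset.disjoint_left]
        rintro y hy hy'
        simp only [Finset.mem_filter, Finset.mem_image, Finset.mem_Ico] at hy hy'
        obtain ⟨q, ⟨hoq, hqk⟩, rfl⟩ := hy'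
        have := (h.rank.before_iff hk (by omega)).1 hy.2.2
        omega
    · rw [Function.update_of_ne hxk, h.cnt x hx]
      congr 1
      ext y
      simp only [Finset.mem_filter, Finset.mem_range]
      refine and_congr_right fun hy => and_congr_right fun h1 => ⟨fun h2 => ?_, fun h2 => ?_⟩
      · rcases h2.to_rot ho hk with h3 | ⟨rfl, q, hoq, hqk, rfl⟩
        · exact h3
        · exact absurd (hov q hoq hqk) (hL.asymm h1)
      · rcases h2.of_rot ho hk with h3 | ⟨rfl, -⟩
        · exact h3
        · exact absurd rfl hxk

end Ranking

namespace Ranking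
variable {W : ℕ} {f : ℝ → ℝ → ℝ}

/-! ### Merge sort -/

/-- Every aligned block of length `wd` of `A`, below `n`, is sorted by decreasing keys. -/
def RunSorted (n wd : ℕ) (K : ℕ → ℝ) (A : ℕ → ℕ) : Prop :=
  ∀ c p q, c * wd ≤ p → p < q → q < (c + 1) * wd → q < n → K (A q) ≤ K (A p)

/-- The ranking that results from the merged part `T` and the two remaining runs of `A`. -/
def merging (A T : ℕ → ℕ) (k m j : ℕ) : ℕ → ℕ :=
  fun q => if q < k then T q else if q < j then A (q - (j - m)) else A q

/-- The invariant of a merging pass: `k` entries have been written to `T`, and the runs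
`[i, m)` and `[j, e)` of `A` are being merged. -/
structure MergeInv (n wd : ℕ) (L : ℕ → ℕ) (K : ℕ → ℝ) (A T cnt : ℕ → ℕ) (k i m j e : ℕ) :
    Prop where
  ke : k ≤ e
  en : e ≤ n
  im : i ≤ m
  mj : m ≤ j
  je : j ≤ e
  sum : i + j = k + m
  block : ∃ c, e = min (c * (2 * wd)) n
  cur : k < e → ∃ c, e = min ((c + 1) * (2 * wd)) n ∧ c * (2 * wd) ≤ k ∧
    ∀ p, c * (2 * wd) ≤ p → p < k → ∀ q, (i ≤ q ∧ q < m ∨ j ≤ q ∧ q < e) → K (A q) ≤ K (T p)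
  run₁ : ∀ p q, i ≤ p → p < q → q < m → K (A q) ≤ K (A p)
  run₂ : ∀ p q, j ≤ p → p < q → q < e → K (A q) ≤ K (A p)
  sorted : RunSorted k (2 * wd) K T
  inv : SortInv n L K (merging A T k m j) cnt

theorem MergeInv.init {n wd : ℕ} {L : ℕ → ℕ} {K : ℕ → ℝ} {A T cnt : ℕ → ℕ}
    (h : SortInv n L K A cnt) : MergeInv n wd L K A T cnt 0 0 0 0 0 := by
  refine ⟨le_rfl, by omega, le_rfl, le_rfl, le_rfl, rfl, ⟨0, by simp⟩, by omega, ?_, ?_, ?_, ?_⟩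
  · intros; omega
  · intros; omega
  · intro c p q _ _ _ h; omega
  · exact h.congr (fun q _ => by simp [merging]) fun _ _ => rfl

/-- The previous block is complete and ends before `n`, so `k` is a multiple of `2 * wd`. The next
two runs are then aligned blocks of `A` with consecutive numbers, clipped at `n`. -/
theorem MergeInv.start {n wd : ℕ} {L : ℕ → ℕ} {K : ℕ → ℝ} {A T cnt : ℕ → ℕ} {k i m j e : ℕ}
    (hA : RunSorted n wd K A) (hwd : 0 < wd)
    (h : MergeInv n wd L K A T cnt k i m j e) (hek : e ≤ k) (hk : k < n) :
    MergeInv n wd L K A T cnt k e (min (e + wd) n) (min (e + wd) n) (min (e + 2 * wd) n) ∧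
      k < min (e + 2 * wd) n := by
  obtain rfl : k = e := le_antisymm h.ke hek
  obtain ⟨c, hc⟩ := h.block
  have hc' : k = c * (2 * wd) := by omega
  have hkc : (c + 1) * (2 * wd) = k + 2 * wd := by rw [hc']; ring
  have him := h.im
  have hmj := h.mj
  have hje := h.je
  have hsum := h.sum
  refine ⟨⟨by omega, by omega, by omega, by omega, by omega, by omega, ⟨c + 1, by rw [hkc]⟩,
    fun _ => ⟨c, by rw [hkc], hc'.ge, fun p h1 h2 => by omega⟩, ?_, ?_, h.sorted, ?_⟩, by omega⟩
  · intro p q h1 h2 h3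
    have e1 : 2 * c * wd = k := by rw [hc']; ring
    refine hA (2 * c) p q (by omega) h2 ?_ (by omega)
    have : (2 * c + 1) * wd = k + wd := by rw [hc']; ring
    omega
  · intro p q h1 h2 h3
    have e1 : (2 * c + 1) * wd = k + wd := by rw [hc']; ring
    refine hA (2 * c + 1) p q (by omega) h2 ?_ (by omega)
    have : (2 * c + 1 + 1) * wd = k + 2 * wd := by rw [hc']; ring
    omega
  · refine h.inv.congr (fun q _ => ?_) fun _ _ => rfl
    simp only [merging, Nat.sub_self, Nat.sub_zero, ite_self]
    have : j = k := by omega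
    subst this
    split_ifs <;> rfl

/-- Only entries of the current aligned block are compared with the new one, and `cur` bounds all
remaining keys by theirs. -/
theorem MergeInv.sorted_succ {n wd : ℕ} {L : ℕ → ℕ} {K : ℕ → ℝ} {A T cnt : ℕ → ℕ}
    {k i m j e : ℕ} (h : MergeInv n wd L K A T cnt k i m j e) (hk : k < e) {x : ℕ}
    (hx : i ≤ x ∧ x < m ∨ j ≤ x ∧ x < e) :
    RunSorted (k + 1) (2 * wd) K (Function.update T k (A x)) := by
  intro c p q h1 h2 h3 h4
  rw [Function.update_of_ne (show p ≠ k by omega)]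
  rcases Nat.lt_succ_iff_lt_or_eq.1 h4 with h5 | rfl
  · rw [Function.update_of_ne (by omega)]
    exact h.sorted c p q h1 h2 h3 h5
  · rw [Function.update_self]
    obtain ⟨c', e1, e2, e3⟩ := h.cur hk
    refine e3 p ?_ h2 x hx
    have hcc : c' ≤ c := by
      by_contra hlt
      have : (c + 1) * (2 * wd) ≤ c' * (2 * wd) := Nat.mul_le_mul_right _ (by omega)
      omega
    exact (Nat.mul_le_mul_right _ hcc).trans h1

/-- Taking the head of the left run does not change the ranking `merging`, so the counters stay.
Ties are resolved this way, which makes the sort stable. -/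
theorem MergeInv.left {n wd : ℕ} {L : ℕ → ℕ} {K : ℕ → ℝ} {A T cnt : ℕ → ℕ} {k i m j e : ℕ}
    (h : MergeInv n wd L K A T cnt k i m j e) (hk : k < e) (hi : i < m)
    (hj : j < e → K (A j) ≤ K (A i)) :
    MergeInv n wd L K A (Function.update T k (A i)) cnt (k + 1) (i + 1) m j e := by
  have hsum := h.sum
  have hmj := h.mj
  refine ⟨hk, h.en, hi, h.mj, h.je, by omega, h.block, fun hk' => ?_, ?_, h.run₂,
    h.sorted_succ hk (Or.inl ⟨le_rfl, hi⟩), ?_⟩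
  · obtain ⟨c, e1, e2, e3⟩ := h.cur hk
    refine ⟨c, e1, by omega, fun p h1 h2 q hq => ?_⟩
    rcases Nat.lt_succ_iff_lt_or_eq.1 h2 with h5 | rfl
    · rw [Function.update_of_ne (by omega)]
      exact e3 p h1 h5 q (by omega)
    · rw [Function.update_self]
      rcases hq with hq | hq
      · exact h.run₁ i q le_rfl (by omega) hq.2
      · refine le_trans ?_ (hj (by omega))
        rcases hq.1.eq_or_lt with rfl | h6
        · exact le_rfl
        · exact h.run₂ j q le_rfl h6 hq.2
  · intro p q h1 h2 h3
    exact h.run₁ p q (by omega) h2 h3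
  · refine h.inv.congr (fun q _ => ?_) fun _ _ => rfl
    simp only [merging]
    rcases lt_trichotomy q k with h1 | rfl | h1
    · rw [if_pos (by omega), if_pos h1, Function.update_of_ne (by omega)]
    · rw [if_pos (by omega), if_neg (by omega), if_pos (by omega), Function.update_self]
      congr 1; omega
    · rw [if_neg (show ¬ q < k + 1 by omega), if_neg (show ¬ q < k by omega)]

/-- Taking the head of the right run moves it from position `j` to position `k`, past the `m - i`
entries left in the other run. The strict inequality in `hi` is what `SortInv.jump` requires. -/
theorem MergeInv.right {n wd : ℕ} {L : ℕ → ℕ} {K : ℕ → ℝ} {A T cnt : ℕ → ℕ} {k i m j e : ℕ}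
    (hL : IsRank n L) (h : MergeInv n wd L K A T cnt k i m j e) (hk : k < e)
    (hj : j < e) (hi : i < m → K (A i) < K (A j)) :
    MergeInv n wd L K A (Function.update T k (A j))
      (Function.update cnt (A j) (cnt (A j) + (m - i))) (k + 1) i m (j + 1) e := by
  have hsum := h.sum
  have hmj := h.mj
  have him := h.im
  have hen := h.en
  refine ⟨hk, h.en, h.im, by omega, hj, by omega, h.block, fun hk' => ?_, h.run₁, ?_,
    h.sorted_succ hk (Or.inr ⟨le_rfl, hj⟩), ?_⟩
  · obtain ⟨c, e1, e2, e3⟩ := h.cur hk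
    refine ⟨c, e1, by omega, fun p h1 h2 q hq => ?_⟩
    rcases Nat.lt_succ_iff_lt_or_eq.1 h2 with h5 | rfl
    · rw [Function.update_of_ne (by omega)]
      exact e3 p h1 h5 q (by omega)
    · rw [Function.update_self]
      rcases hq with hq | hq
      · refine le_trans ?_ (hi (by omega)).le
        rcases hq.1.eq_or_lt with rfl | h6
        · exact le_rfl
        · exact h.run₁ i q le_rfl h6 hq.2
      · exact h.run₂ j q le_rfl (by omega) hq.2
  · intro p q h1 h2 h3
    exact h.run₂ p q (by omega) h2 h3
  · have hkj : k ≤ j := by omega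
    have hVj : merging A T k m j j = A j := by simp [merging, hkj]
    have := h.inv.jump hL hkj (by omega) (fun q h1 h2 => ?_)
    · rw [hVj, show j - k = m - i by omega] at this
      refine this.congr (fun q _ => ?_) fun _ _ => rfl
      rcases lt_trichotomy q k with h1 | rfl | h1
      · rw [rot_of_lt h1]
        simp only [merging]
        rw [if_pos (by omega), Function.update_of_ne (by omega), if_pos h1]
      · rw [rot_self, hVj]
        simp only [merging]
        rw [if_pos (by omega), Function.update_self]
      · by_cases h2 : q ≤ j
        · rw [rot_of_mem h1 h2]
          simp only [merging]
          rw [if_neg (by omega), if_pos (by omega), if_neg (by omega), if_pos (by omega)]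
          congr 1; omega
        · rw [rot_of_gt hkj (by omega)]
          simp only [merging]
          rw [if_neg (by omega), if_neg (by omega), if_neg (by omega), if_neg (by omega)]
    · rw [hVj]
      simp only [merging]
      rw [if_neg (by omega), if_pos h2]
      refine lt_of_le_of_lt ?_ (hi (by omega))
      rcases h1.eq_or_lt with rfl | h6
      · rw [show k - (j - m) = i by omega]
      · exact h.run₁ i _ le_rfl (by omega) (by omega)

/-- One step of a merging pass on word array `3`, writing to word array `4`, with the keys in real
array `3`; word array `5` counts how many entries each entry has overtaken. -/
def mergeStep : Stmt :=
  .seq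
    (.ite (.nle (.reg 6) (.reg 2))
      (.seq (.setN 3 (.reg 6))
      (.seq (.setN 4 (.sub (.reg 0) (.sub (.reg 0) (.add (.reg 6) (.reg 1)))))
      (.seq (.setN 5 (.reg 4))
        (.setN 6 (.sub (.reg 0) (.sub (.reg 0) (.add (.reg 6) (.mul (.const 2) (.reg 1)))))))))
      .skip)
    (.ite (.and (.nlt (.reg 3) (.reg 4)) (.not (.and (.nlt (.reg 5) (.reg 6))
        (.rlt (.get 3 (.get 3 (.reg 3))) (.get 3 (.get 3 (.reg 5)))))))
      (.seq (.putN 4 (.reg 2) (.get 3 (.reg 3))) (.setN 3 (.add (.reg 3) (.const 1))))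
      (.seq (.putN 5 (.get 3 (.reg 5))
          (.add (.get 5 (.get 3 (.reg 5))) (.sub (.reg 4) (.reg 3))))
        (.seq (.putN 4 (.reg 2) (.get 3 (.reg 5))) (.setN 5 (.add (.reg 5) (.const 1))))))

/-- Merge sort of word array `3`, stable and by decreasing keys. -/
def sortStmt : Stmt :=
  .seq (forLoop 7 (.putN 5 (.reg 7) (.const 0)))
  (.seq (.setN 1 (.const 1))
    (.while (.nlt (.reg 1) (.reg 0))
      (.seq (.setN 3 (.const 0)) (.seq (.setN 4 (.const 0)) (.seq (.setN 5 (.const 0))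
      (.seq (.setN 6 (.const 0)) (.seq (forLoop 2 mergeStep) (.seq (copyArr 4 3)
        (.setN 1 (.mul (.const 2) (.reg 1)))))))))))

theorem SortInv.cnt_le {n : ℕ} {L V cnt : ℕ → ℕ} {K : ℕ → ℝ} (h : SortInv n L K V cnt) {x : ℕ}
    (hx : x < n) : cnt x ≤ n := by
  classical
  rw [h.cnt x hx]
  exact (Finset.card_filter_le _ _).trans (by simp)

theorem mergeStep_spec {n wd k : ℕ} {L A : ℕ → ℕ} {K : ℕ → ℝ} {M : Memory}
    (hW : 8 * n + 8 ≤ W) (hL : IsRank n L) (hA : RunSorted n wd K A) (hAr : IsRank n A)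
    (hwd : 0 < wd) (hwn : wd < n) (hk : k < n)
    (h0 : M.nreg 0 = n) (h1 : M.nreg 1 = wd) (h2 : M.nreg 2 = k) (hMA : M.narr 3 = A)
    (hMK : M.rarr 3 = K)
    (h : MergeInv n wd L K A (M.narr 4) (M.narr 5) k (M.nreg 3) (M.nreg 4) (M.nreg 5)
      (M.nreg 6)) :
    Spec W f mergeStep M (fun t M' => t ≤ 15 ∧
      MergeInv n wd L K A (M'.narr 4) (M'.narr 5) (k + 1) (M'.nreg 3) (M'.nreg 4) (M'.nreg 5)
        (M'.nreg 6)) := by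
  have hstart : Spec W f (.ite (.nle (.reg 6) (.reg 2))
      (.seq (.setN 3 (.reg 6))
      (.seq (.setN 4 (.sub (.reg 0) (.sub (.reg 0) (.add (.reg 6) (.reg 1)))))
      (.seq (.setN 5 (.reg 4))
        (.setN 6 (.sub (.reg 0) (.sub (.reg 0) (.add (.reg 6) (.mul (.const 2) (.reg 1)))))))))
      .skip) M (fun t M' => t ≤ 8 ∧ M'.narr 4 = M.narr 4 ∧ M'.narr 5 = M.narr 5 ∧
        M'.nreg 2 = k ∧ M'.narr 3 = A ∧ M'.rarr 3 = K ∧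
        MergeInv n wd L K A (M.narr 4) (M.narr 5) k (M'.nreg 3) (M'.nreg 4) (M'.nreg 5)
        (M'.nreg 6) ∧ k < M'.nreg 6) := by
    have hen := h.en
    have m2 : 2 % W = 2 := Nat.mod_eq_of_lt (by omega)
    have m3 : 2 * wd % W = 2 * wd := Nat.mod_eq_of_lt (by omega)
    have m4 : (M.nreg 6 + wd) % W = M.nreg 6 + wd := Nat.mod_eq_of_lt (by omega)
    have m5 : (M.nreg 6 + 2 * wd) % W = M.nreg 6 + 2 * wd := Nat.mod_eq_of_lt (by omega)
    -- Truncated subtraction serves as a minimum and clips the runs at the end of the array.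
    have s1 : n - (n - (M.nreg 6 + wd)) = min (M.nreg 6 + wd) n := by omega
    have s2 : n - (n - (M.nreg 6 + 2 * wd)) = min (M.nreg 6 + 2 * wd) n := by omega
    simp only [spec_ite, spec_seq, spec_setN, spec_skip, BExpr.Holds, NExpr.eval, h2]
    split_ifs with hek
    · have := h.start hA hwd hek hk
      simp [h0, h1, h2, hMA, hMK, m2, m3, m4, m5, s1, s2]
      simpa using this
    · exact ⟨by omega, trivial, trivial, trivial, hMA, hMK, h, by omega⟩
  rw [mergeStep]
  refine Spec.seq hstart ?_
  rintro t M₁ - ⟨ht, e4, e5, e2, eA, eK, hI, hke⟩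
  have hen := hI.en
  have him := hI.im
  have hmj := hI.mj
  have hje := hI.je
  have hsum := hI.sum
  have m1 : 1 % W = 1 := Nat.mod_eq_of_lt (by omega)
  simp only [spec_ite, spec_seq, spec_setN, spec_putN, BExpr.Holds, NExpr.eval, RExpr.eval, eA, eK,
    e2, m1]
  split_ifs with hc
  · have m4 : (M₁.nreg 3 + 1) % W = M₁.nreg 3 + 1 := Nat.mod_eq_of_lt (by omega)
    have := hI.left hke hc.1 (fun hj => by
      have := hc.2
      push Not at this
      exact this hj)
    refine ⟨by omega, ?_⟩
    simpa [m4, e4, e5] using this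
  · have hj : M₁.nreg 5 < M₁.nreg 6 := by
      by_contra hj
      refine hc ⟨by omega, fun h => hj h.1⟩
    have m4 : (M₁.nreg 5 + 1) % W = M₁.nreg 5 + 1 := Nat.mod_eq_of_lt (by omega)
    have := hI.right hL hke hj (fun hi => by
      by_contra hh
      exact hc ⟨hi, fun h => hh h.2⟩)
    have hx := hAr.1 (M₁.nreg 5) (by omega)
    have hcn := hI.inv.cnt_le hx
    have m5 : (M.narr 5 (A (M₁.nreg 5)) + (M₁.nreg 4 - M₁.nreg 3)) % W =
      M.narr 5 (A (M₁.nreg 5)) + (M₁.nreg 4 - M₁.nreg 3) := Nat.mod_eq_of_lt (by omega)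
    refine ⟨by omega, ?_⟩
    simpa [m4, m5, e2, e4, e5, eA] using this

theorem sortStmt_spec {n : ℕ} {M : Memory} (hW : 8 * n + 8 ≤ W) (h0 : M.nreg 0 = n)
    (hL : IsRank n (M.narr 3)) :
    Spec W f sortStmt M (fun t M' => t ≤ Nat.size n * (22 * n + 20) + 4 * n + 10 ∧
      SortInv n (M.narr 3) (M.rarr 3) (M'.narr 3) (M'.narr 5) ∧
      ∀ p q, p < q → q < n → M.rarr 3 (M'.narr 3 q) ≤ M.rarr 3 (M'.narr 3 p)) := by
  rw [sortStmt]
  refine Spec.seq (Spec.for (n := n) (by decide) (fun q M' => ∀ p < q, M'.narr 5 p = 0) 1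
    (by omega) M h0 (by simp) (by decide) ?_) ?_
  · rintro q hq M' hn' hr h
    simp only [spec_putN, NExpr.eval, hr, Nat.zero_mod]
    refine ⟨le_rfl, fun p hp => ?_⟩
    rcases Nat.lt_succ_iff_lt_or_eq.1 hp with h1 | rfl
    · simp [Function.update_of_ne (show p ≠ q by omega), h p h1]
    · simp
  rintro t₁ M₁ hF₁ ⟨ht₁, hz⟩
  have m1 : 1 % W = 1 := Nat.mod_eq_of_lt (by omega)
  have m2 : 2 % W = 2 := Nat.mod_eq_of_lt (by omega)
  rw [spec_seq, spec_setN]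
  -- `j` bounds the number of doublings of the width that are still needed; from width `1`,
  -- `Nat.size n` of them suffice.
  refine (Spec.while (fun j M' => ∃ wd, 0 < wd ∧ n ≤ 2 ^ j * wd ∧ M'.nreg 1 = wd ∧ M'.nreg 0 = n ∧
    M'.rarr 3 = M.rarr 3 ∧ RunSorted n wd (M.rarr 3) (M'.narr 3) ∧
    SortInv n (M.narr 3) (M.rarr 3) (M'.narr 3) (M'.narr 5)) (22 * n + 19) ?_ (Nat.size n) _
    ⟨1, one_pos, ?_, by simp [NExpr.eval, m1], ?_, ?_, ?_, ?_⟩).mono ?_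
  · rintro j M₂ ⟨wd, hwd, hj, e1, e0, eK, hR, hS⟩ ht
    simp only [BExpr.Holds, NExpr.eval, e0, e1] at ht
    have hj0 : j ≠ 0 := by rintro rfl; simp at hj; omega
    refine ⟨j - 1, by omega, ?_⟩
    simp only [spec_seq (s₁ := .setN _ _), spec_setN, NExpr.eval, Nat.zero_mod]
    have hmod : (2 * wd) % W = 2 * wd := Nat.mod_eq_of_lt (by omega)
    refine Spec.seq (Spec.for (n := n) (by decide) (fun k M' => M'.nreg 1 = wd ∧
      M'.narr 3 = M₂.narr 3 ∧ M'.rarr 3 = M.rarr 3 ∧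
      MergeInv n wd (M.narr 3) (M.rarr 3) (M₂.narr 3) (M'.narr 4) (M'.narr 5) k (M'.nreg 3)
        (M'.nreg 4) (M'.nreg 5) (M'.nreg 6)) 15 (by omega) _ (by simp [e0]) ?_ (by decide) ?_) ?_
    · refine ⟨by simp [e1], rfl, eK, ?_⟩
      simpa using MergeInv.init hS
    · rintro k hk M₃ e0' e2 ⟨e1', eA, eK', hI⟩
      refine (mergeStep_spec hW hL hR hS.rank hwd ht hk e0' e1' e2 eA eK' hI).mono ?_
      rintro t M₄ hF ⟨ht, hI'⟩
      refine ⟨ht, ?_, ?_, ?_, ?_⟩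
      · simp [hF.n 1 (by decide), e1']
      · simp [hF.na 3 (by decide), eA]
      · simp [hF.ra 3 (by decide), eK']
      · simpa using hI'
    rintro t₃ M₃ hF₃ ⟨ht₃, e1', eA, eK', hI⟩
    have e0' : M₃.nreg 0 = n := by rw [hF₃.n 0 (by decide)]; simp [e0]
    refine Spec.seq (copyArr_spec (by decide) (by omega) e0') ?_
    rintro t₄ M₄ hF₄ ⟨ht₄, hcopy⟩
    rw [spec_setN]
    have e1'' : M₄.nreg 1 = wd := by rw [hF₄.n 1 (by decide), e1']
    have hke := hI.ke
    have hen := hI.en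
    have him := hI.im
    have hje := hI.je
    have hmj := hI.mj
    have hsum := hI.sum
    -- At `k = n` the interpolated ranking is the merged array alone.
    have hmg : ∀ q < n, M₄.narr 3 q = merging (M₂.narr 3) (M₃.narr 4) n (M₃.nreg 4) (M₃.nreg 5) q :=
      fun q hq => by rw [hcopy q hq]; simp [merging, hq]
    refine ⟨by omega, 2 * wd, by omega, ?_, ?_, ?_, ?_, ?_, ?_⟩
    · calc n ≤ 2 ^ j * wd := hj
        _ = 2 ^ (j - 1 + 1) * wd := by rw [Nat.sub_add_cancel (by omega)]
        _ = _ := by ring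
    · simp [NExpr.eval, e1'', m2, hmod]
    · simp [hF₄.n 0 (by decide), e0']
    · simp [hF₄.ra 3 (by decide), eK']
    · intro c p q h1 h2 h3 h4
      simp only [Memory.setN_narr]
      rw [hcopy p (by omega), hcopy q h4]
      exact hI.sorted c p q h1 h2 h3 h4
    · refine hI.inv.congr hmg fun q _ => ?_
      simp [hF₄.na 5 (by decide)]
  · have := (Nat.lt_size_self n).le
    omega
  · simp [hF₁.n 0 (by decide), h0]
  · simp [hF₁.ra 3 (by decide)]
  · intro c p q h1 h2 h3
    omega
  · simp only [Memory.setN_narr, hF₁.na 3 (by decide)]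
    exact SortInv.init hL hz
  · rintro t M₂ - ⟨ht, ⟨j, wd, hwd, -, e1, e0, -, hR, hS⟩, hh⟩
    simp only [BExpr.Holds, NExpr.eval, e0, e1, not_lt] at hh
    refine ⟨?_, hS, fun p q hpq hq => hR 0 p q (by simp) hpq (by omega) hq⟩
    have : Nat.size n * (22 * n + 19 + 1) = Nat.size n * (22 * n + 20) := by ring
    omega

end Ranking

namespace Ranking

/-! ### Rankings sorted by a weighted score -/

section Geometry

variable {n : ℕ} {a b w : Fin n → ℝ} {f : ℝ → ℝ → ℝ}

/-- The weighted score of a result. -/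
def key (a b : Fin n → ℝ) (l : ℝ) (x : Fin n) : ℝ := (1 - l) * a x + l * b x

/-- The ranking is sorted by decreasing weighted scores. -/
def SortedAt (a b : Fin n → ℝ) (l : ℝ) (π : Equiv.Perm (Fin n)) : Prop :=
  ∀ i j, i ≤ j → key a b l (π j) ≤ key a b l (π i)

/-- This is the rearrangement inequality: the weights and the keys along `σ` decrease together.
Geometrically, `σ` lies on a supporting line with normal `(1 - l, l)`. -/
theorem SortedAt.cumScore_le {l : ℝ} {σ : Equiv.Perm (Fin n)} (hσ : SortedAt a b l σ)
    (hw : Antitone w) (z : Equiv.Perm (Fin n)) :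
    (1 - l) * cumScore w a z + l * cumScore w b z ≤
      (1 - l) * cumScore w a σ + l * cumScore w b σ := by
  have e : ∀ π : Equiv.Perm (Fin n), (1 - l) * cumScore w a π + l * cumScore w b π =
      ∑ j, w j * key a b l (π j) := by
    intro π
    simp only [cumScore, key, Finset.mul_sum, ← Finset.sum_add_distrib]
    exact Finset.sum_congr rfl fun j _ => by ring
  rw [e, e]
  have hm : Monovary w (fun j => key a b l (σ j)) := by
    intro i j hij
    by_contra! h
    have h1 : i ≤ j := by
      by_contra! h2
      exact absurd (hw h2.le) (not_le.2 h)
    exact absurd (hσ i j h1) (not_le.2 hij)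
  have := hm.sum_mul_comp_perm_le_sum_mul (σ := σ⁻¹ * z)
  simpa using this

theorem cumScore_nonneg (hw : ∀ j, 0 ≤ w j) (ha : ∀ j, 0 ≤ a j) (π : Equiv.Perm (Fin n)) :
    0 ≤ cumScore w a π :=
  Finset.sum_nonneg fun j _ => mul_nonneg (hw j) (ha _)

theorem IsInstance.mono (h : IsInstance a b w f) {x x' y y' : ℝ} (hx : 0 ≤ x) (hy : 0 ≤ y)
    (hxx : x ≤ x') (hyy : y ≤ y') : f x y ≤ f x' y' :=
  ((h.strictMono_left y hy).monotoneOn hx (hx.trans hxx : (0 : ℝ) ≤ x') hxx).trans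
    ((h.strictMono_right x' (hx.trans hxx)).monotoneOn hy (hy.trans hyy : (0 : ℝ) ≤ y') hyy)

theorem IsInstance.segment (h : IsInstance a b w f) {x y x' y' t : ℝ} (hx : 0 ≤ x) (hy : 0 ≤ y)
    (hx' : 0 ≤ x') (hy' : 0 ≤ y') (h0 : 0 ≤ t) (h1 : t ≤ 1) :
    (1 - t) * f x y + t * f x' y' ≤ f ((1 - t) * x + t * x') ((1 - t) * y + t * y') := by
  have := h.concave.2 (x := (x, y)) (y := (x', y')) ⟨hx, hy⟩ ⟨hx', hy'⟩ (sub_nonneg.2 h1) h0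
    (by ring)
  simpa using this

/-- Everything that does at most slightly better than `σ` in the second score has an objective of at
most `β`. -/
def ExcludesLeft (a b w : Fin n → ℝ) (f : ℝ → ℝ → ℝ) (β : ℝ) (σ : Equiv.Perm (Fin n)) : Prop :=
  ∀ (i : ℕ) (hi : i + 1 < n) (z : Equiv.Perm (Fin n)),
    cumScore w b z ≤ cumScore w b σ +
      (w ⟨i, Nat.lt_of_succ_lt hi⟩ - w ⟨i + 1, hi⟩) * b (σ ⟨i + 1, hi⟩) → combined f w a b z ≤ β

/-- Everything that does better than `σ` in the second score has an objective of at most `β`. -/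
def ExcludesRight (a b w : Fin n → ℝ) (f : ℝ → ℝ → ℝ) (β : ℝ) (σ : Equiv.Perm (Fin n)) : Prop :=
  ∀ z : Equiv.Perm (Fin n), cumScore w b σ < cumScore w b z → combined f w a b z ≤ β

theorem ExcludesLeft.mono {β β' : ℝ} {σ : Equiv.Perm (Fin n)} (h : ExcludesLeft a b w f β σ)
    (hβ : β ≤ β') : ExcludesLeft a b w f β' σ := fun i hi z hz => (h i hi z hz).trans hβ

theorem ExcludesRight.mono {β β' : ℝ} {σ : Equiv.Perm (Fin n)} (h : ExcludesRight a b w f β σ)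
    (hβ : β ≤ β') : ExcludesRight a b w f β' σ := fun z hz => (h z hz).trans hβ

/-- `D` is the gain of weight that some position obtains, and `u` a result that can be put there, such
that the gain in the second score is as large as possible. -/
structure IsSlack (b w : Fin n → ℝ) (σ : Equiv.Perm (Fin n)) (D : ℝ) (u : Fin n) : Prop where
  nonneg : 0 ≤ D
  le : ∀ (i : ℕ) (hi : i + 1 < n) (m : Fin n), i + 1 ≤ (m : ℕ) → w m = w ⟨i + 1, hi⟩ →
    (w ⟨i, Nat.lt_of_succ_lt hi⟩ - w ⟨i + 1, hi⟩) * b (σ m) ≤ D * b u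

/-- If no position can gain, every result placed at a weight below the largest one has second score
zero. So `σ` already gives all of `b` the largest weight. For this, `IsSlack` has to range over all
positions `m` of a block of equal weights, not only over the first. -/
theorem IsSlack.cumScore_le {σ : Equiv.Perm (Fin n)} {D : ℝ} {u : Fin n} (h : IsSlack b w σ D u)
    (hI : IsInstance a b w f) (h0 : D * b u ≤ 0) (z : Equiv.Perm (Fin n)) :
    cumScore w b z ≤ cumScore w b σ := by
  rcases Nat.eq_zero_or_pos n with rfl | hn
  · simp [cumScore]
  set w0 := w ⟨0, hn⟩ with hw0
  have hle : ∀ j, w j ≤ w0 := fun j => hI.w_antitone (Fin.mk_le_of_le_val (Nat.zero_le _))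
  have hz : ∀ j, w0 * b (σ j) = w j * b (σ j) := by
    intro j
    rcases (hle j).eq_or_lt with e | hlt
    · rw [e]
    · have hex : ∃ s, ∃ hs : s < n, w ⟨s, hs⟩ = w j := ⟨j, j.2, rfl⟩
      classical
      obtain ⟨hs, hws⟩ := Nat.find_spec hex
      -- `s` is the start of the block of weights equal to `w j`, so the weight drops strictly just
      -- before it.
      set s := Nat.find hex with hsdef
      have hsj : s ≤ j := Nat.find_min' hex ⟨j.2, rfl⟩
      have hs0 : s ≠ 0 := by
        intro e
        have : w ⟨s, hs⟩ = w0 := by simp only [e, hw0]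
        rw [this] at hws
        exact hlt.ne hws.symm
      obtain ⟨i, hi⟩ := Nat.exists_eq_succ_of_ne_zero hs0
      have hin : i + 1 < n := by omega
      have hne : w ⟨i, Nat.lt_of_succ_lt hin⟩ ≠ w j := fun e =>
        Nat.find_min hex (m := i) (by omega) ⟨by omega, e⟩
      have hwi : w ⟨i + 1, hin⟩ = w j := by rw [← hws]; congr 2; omega
      have hgt : w j < w ⟨i, Nat.lt_of_succ_lt hin⟩ := by
        refine lt_of_le_of_ne ?_ hne.symm
        rw [← hwi]
        exact hI.w_antitone (Fin.mk_le_mk.2 (Nat.le_succ i))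
      have h1 := h.le i hin j (by omega) hwi.symm
      rw [hwi] at h1
      have hb := hI.b_nonneg (σ j)
      have : b (σ j) = 0 := by nlinarith
      rw [this]; ring
  calc cumScore w b z ≤ ∑ j, w0 * b (z j) :=
        Finset.sum_le_sum fun j _ => mul_le_mul_of_nonneg_right (hle j) (hI.b_nonneg _)
    _ = ∑ j, w0 * b (σ j) := by
        rw [Equiv.sum_comp z (fun x => w0 * b x), Equiv.sum_comp σ (fun x => w0 * b x)]
    _ = cumScore w b σ := Finset.sum_congr rfl fun j _ => hz j

/-! ### Excluding one side of a sorted ranking -/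

variable {σ : Equiv.Perm (Fin n)} {D l β : ℝ} {u : Fin n}

/-- Here `z` is dominated in both coordinates by `σ` with additional weight `D` on `u`. This is
where the relaxation of the weights is spent; concavity plays no role. -/
theorem combined_le_of_slack (hI : IsInstance a b w f) (hD : 0 ≤ D)
    (hv : f (cumScore w a σ + D * a u) (cumScore w b σ + D * b u) ≤ β) {z : Equiv.Perm (Fin n)}
    (hx : cumScore w a z ≤ cumScore w a σ) (hy : cumScore w b z ≤ cumScore w b σ + D * b u) :
    combined f w a b z ≤ β :=
  (hI.mono (cumScore_nonneg hI.w_nonneg hI.a_nonneg z) (cumScore_nonneg hI.w_nonneg hI.b_nonneg z)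
    (hx.trans (le_add_of_nonneg_right (mul_nonneg hD (hI.a_nonneg u)))) hy).trans hv

/-- If no ranking beats `σ` in the first score, domination suffices. This starts the search at `l =
0`, without a probe. -/
theorem excludesLeft_of_max (hI : IsInstance a b w f) (hs : IsSlack b w σ D u)
    (hv : f (cumScore w a σ + D * a u) (cumScore w b σ + D * b u) ≤ β)
    (hx : ∀ z, cumScore w a z ≤ cumScore w a σ) : ExcludesLeft a b w f β σ :=
  fun i hi z hz => combined_le_of_slack hI hs.nonneg hv (hx z)
    (hz.trans (add_le_add le_rfl (hs.le i hi _ le_rfl rfl)))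

/-- The objective rises from `σ` to the probe, so by concavity it is no larger than at `σ` on the
opposite part of the supporting line. A ranking with a larger first score lies on or below that
part; any other ranking in question is dominated by the candidate for the record. -/
theorem excludesLeft_of_lt (hI : IsInstance a b w f) (hs : IsSlack b w σ D u)
    (hv : f (cumScore w a σ + D * a u) (cumScore w b σ + D * b u) ≤ β)
    (hσ : SortedAt a b l σ) (hl : 0 ≤ l) (hl1 : l < 1) (hS : 0 < D * b u)
    (hq : 0 ≤ cumScore w a σ - l / (1 - l) * (D * b u))
    (hlt : f (cumScore w a σ) (cumScore w b σ) <
      f (cumScore w a σ - l / (1 - l) * (D * b u)) (cumScore w b σ + D * b u)) :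
    ExcludesLeft a b w f β σ := by
  intro i hi z hz
  have hz' := hz.trans (add_le_add le_rfl (hs.le i hi _ le_rfl rfl))
  rcases le_or_gt (cumScore w a z) (cumScore w a σ) with hx | hx
  · exact combined_le_of_slack hI hs.nonneg hv hx hz'
  have hY0 := cumScore_nonneg (w := w) hI.w_nonneg hI.b_nonneg σ
  have hX0 := cumScore_nonneg (w := w) hI.w_nonneg hI.a_nonneg σ
  have hzY0 := cumScore_nonneg (w := w) hI.w_nonneg hI.b_nonneg z
  have hline := hσ.cumScore_le hI.w_antitone z
  set X := cumScore w a σ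
  set Y := cumScore w b σ
  have hc : combined f w a b z = f (cumScore w a z) (cumScore w b z) := rfl
  rw [hc]
  set x := cumScore w a z
  set y := cumScore w b z
  set S := D * b u
  -- For `l = 0` the supporting line is vertical, and no ranking has a larger first score.
  have hl0 : 0 < l := by
    rcases hl.eq_or_lt with e | h
    · subst e; linarith
    · exact h
  have h1l : 0 < 1 - l := by linarith
  have hβ : f X Y ≤ β := (hI.mono hX0 hY0 (le_add_of_nonneg_right
    (mul_nonneg hs.nonneg (hI.a_nonneg u))) (le_add_of_nonneg_right hS.le)).trans hv
  refine le_trans ?_ hβ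
  by_contra! hgt
  -- the point of the supporting line above `z`
  set y' := Y - (1 - l) / l * (x - X) with hy'
  have hyy' : y ≤ y' := by
    rw [hy', le_sub_iff_add_le, div_mul_eq_mul_div, ← le_sub_iff_add_le', div_le_iff₀ hl0]
    nlinarith
  have hfz : f x y ≤ f x y' := hI.mono (hX0.trans hx.le) hzY0 le_rfl hyy'
  -- `σ` lies between it and the probe
  set r := (x - X) * (1 - l) / l with hr
  have hr0 : 0 < r := div_pos (mul_pos (sub_pos.2 hx) h1l) hl0
  have ht0 : 0 ≤ r / (r + S) := by positivity
  have ht1 : r / (r + S) < 1 := (div_lt_one (by linarith)).2 (by linarith)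
  have hseg := hI.segment (hX0.trans hx.le) (hzY0.trans hyy') hq (add_nonneg hY0 hS.le) ht0 ht1.le
  have e1 : (1 - r / (r + S)) * x + r / (r + S) * (X - l / (1 - l) * S) = X := by
    have hx' : x = X + r * l / (1 - l) := by
      rw [hr]; field_simp; ring
    rw [hx']
    have : r + S ≠ 0 := by linarith
    field_simp
    ring
  have e2 : (1 - r / (r + S)) * y' + r / (r + S) * (Y + S) = Y := by
    have hx' : y' = Y - r := by
      rw [hy', hr]; ring
    rw [hx']
    have : r + S ≠ 0 := by linarith
    field_simp
    ring
  rw [e1, e2] at hseg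
  set t := r / (r + S)
  nlinarith

/-- The objective does not rise from `σ` to the probe, so by concavity it does not exceed its value
at `σ` beyond the probe. Below the height of the probe the supporting line bounds the first score by
that of `σ`, and domination applies. If the gain is zero, or if the probe leaves the quadrant, there
is nothing to compare: in the first case no second score exceeds that of `σ`, in the second no
ranking lies above the probe. -/
theorem excludesRight_of_not_lt (hI : IsInstance a b w f) (hs : IsSlack b w σ D u)
    (hv : f (cumScore w a σ + D * a u) (cumScore w b σ + D * b u) ≤ β)
    (hσ : SortedAt a b l σ) (hl : 0 ≤ l) (hl1 : l < 1)
    (hlt : 0 < D * b u → 0 ≤ cumScore w a σ - l / (1 - l) * (D * b u) →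
      f (cumScore w a σ - l / (1 - l) * (D * b u)) (cumScore w b σ + D * b u) ≤
      f (cumScore w a σ) (cumScore w b σ)) :
    ExcludesRight a b w f β σ := by
  intro z hz
  have h1l : 0 < 1 - l := by linarith
  have hS : 0 < D * b u := by
    by_contra! h
    exact absurd (hs.cumScore_le hI h z) (not_le.2 hz)
  have hY0 := cumScore_nonneg (w := w) hI.w_nonneg hI.b_nonneg σ
  have hX0 := cumScore_nonneg (w := w) hI.w_nonneg hI.a_nonneg σ
  have hzX0 := cumScore_nonneg (w := w) hI.w_nonneg hI.a_nonneg z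
  have hline := hσ.cumScore_le hI.w_antitone z
  rcases le_or_gt (cumScore w b z) (cumScore w b σ + D * b u) with hy | hy
  · refine combined_le_of_slack hI hs.nonneg hv ?_ hy
    nlinarith
  have hβ : f (cumScore w a σ) (cumScore w b σ) ≤ β :=
    (hI.mono hX0 hY0 (le_add_of_nonneg_right
      (mul_nonneg hs.nonneg (hI.a_nonneg u))) (le_add_of_nonneg_right hS.le)).trans hv
  have hc : combined f w a b z = f (cumScore w a z) (cumScore w b z) := rfl
  rw [hc]
  set X := cumScore w a σ
  set Y := cumScore w b σ
  set x := cumScore w a z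
  set y := cumScore w b z
  set S := D * b u
  refine le_trans ?_ hβ
  by_contra! hgt
  set x' := X - l / (1 - l) * (y - Y) with hx'
  have hxx' : x ≤ x' := by
    rw [hx', le_sub_iff_add_le, div_mul_eq_mul_div, ← le_sub_iff_add_le', div_le_iff₀ h1l]
    nlinarith
  have hl' : 0 ≤ l / (1 - l) := div_nonneg hl h1l.le
  -- The probe lies between `σ` and the point of the line to the right of `z`, which both belong to
  -- the quadrant.
  have hq : 0 ≤ X - l / (1 - l) * S := by
    have : l / (1 - l) * S ≤ l / (1 - l) * (y - Y) :=
      mul_le_mul_of_nonneg_left (by linarith) hl'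
    linarith
  have hle := hlt hS hq
  have hfz : f x y ≤ f x' y := hI.mono hzX0 (hY0.trans hz.le) hxx' le_rfl
  have hyY : 0 < y - Y := by linarith
  have ht0 : 0 < S / (y - Y) := div_pos hS hyY
  have ht1 : S / (y - Y) ≤ 1 := (div_le_one hyY).2 (by linarith)
  have hseg := hI.segment hX0 hY0 (hzX0.trans hxx') (hY0.trans hz.le) ht0.le ht1
  have e1 : (1 - S / (y - Y)) * X + S / (y - Y) * x' = X - l / (1 - l) * S := by
    rw [hx']
    field_simp
    ring
  have e2 : (1 - S / (y - Y)) * Y + S / (y - Y) * y = Y + S := by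
    field_simp
    ring
  rw [e1, e2] at hseg
  set t := S / (y - Y)
  nlinarith

/-- Exchanging two positions of equal weight costs nothing, and afterwards the raised weight
benefits the result that stood at `m`. Thus the shifted points used in the exclusions are attained
by rankings with advantaged weights. -/
theorem cumScore_advantaged_swap (c : Fin n → ℝ) {i : ℕ} (hi : i + 1 < n) {m : Fin n}
    (hm : w m = w ⟨i + 1, hi⟩) :
    cumScore (advantaged w i hi) c (σ * Equiv.swap ⟨i + 1, hi⟩ m) =
      cumScore w c σ + (w ⟨i, Nat.lt_of_succ_lt hi⟩ - w ⟨i + 1, hi⟩) * c (σ m) := by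
  set J : Fin n := ⟨i + 1, hi⟩
  set s := Equiv.swap J m
  have hws : ∀ j, w (s j) = w j := by
    intro j
    rcases eq_or_ne j J with rfl | h1
    · simp [s, hm]
    rcases eq_or_ne j m with rfl | h2
    · simp [s, hm]
    rw [Equiv.swap_apply_of_ne_of_ne h1 h2]
  have e1 : cumScore w c (σ * s) = cumScore w c σ := by
    simp only [cumScore]
    rw [← Equiv.sum_comp s (fun j => w j * c (σ j))]
    exact Finset.sum_congr rfl fun j _ => by simp [hws]
  rw [← e1]
  simp only [cumScore, advantaged]
  rw [← Finset.sum_erase_add _ _ (Finset.mem_univ J),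
    ← Finset.sum_erase_add _ (fun j => w j * c ((σ * s) j)) (Finset.mem_univ J)]
  have : ∑ j ∈ Finset.univ.erase J, Function.update w J (w ⟨i, Nat.lt_of_succ_lt hi⟩) j *
      c ((σ * s) j) = ∑ j ∈ Finset.univ.erase J, w j * c ((σ * s) j) :=
    Finset.sum_congr rfl fun j hj => by
      rw [Function.update_of_ne (Finset.ne_of_mem_erase hj)]
  rw [this, Function.update_self]
  have : (σ * s) J = σ m := by simp [s]
  rw [this]
  ring

/-- All rankings are covered between `lo` and an adjacent transposition of it. -/
theorem combined_le_of_adjacent {lo hi : Equiv.Perm (Fin n)} (hI : IsInstance a b w f)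
    (hL : ExcludesLeft a b w f β lo) (hR : ExcludesRight a b w f β hi) {i : ℕ} (hin : i + 1 < n)
    (hadj : hi = lo * Equiv.swap ⟨i, Nat.lt_of_succ_lt hin⟩ ⟨i + 1, hin⟩)
    (z : Equiv.Perm (Fin n)) : combined f w a b z ≤ β := by
  rcases lt_or_ge (cumScore w b hi) (cumScore w b z) with h | h
  · exact hR z h
  refine hL i hin z (h.trans ?_)
  set I : Fin n := ⟨i, Nat.lt_of_succ_lt hin⟩
  set J : Fin n := ⟨i + 1, hin⟩
  have hIJ : I ≠ J := by simp [I, J]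
  -- The change is the weight drop times a difference of second scores; discarding the term with `b
  -- (lo I)` leaves exactly the slack of `ExcludesLeft`.
  have e : cumScore w b hi = cumScore w b lo + (w I - w J) * (b (lo J) - b (lo I)) := by
    subst hadj
    simp only [cumScore]
    rw [← sub_eq_iff_eq_add', ← Finset.sum_sub_distrib]
    have : ∀ j, w j * b ((lo * Equiv.swap I J) j) - w j * b (lo j) =
        (if j = I then w I * (b (lo J) - b (lo I)) else 0) +
        (if j = J then w J * (b (lo I) - b (lo J)) else 0) := by
      intro j
      rcases eq_or_ne j I with rfl | h1
      · simp [hIJ]; ring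
      rcases eq_or_ne j J with rfl | h2
      · simp [hIJ.symm]; ring
      simp [Equiv.swap_apply_of_ne_of_ne h1 h2, h1, h2]
    simp only [this, Finset.sum_add_distrib, Finset.sum_ite_eq', Finset.mem_univ, if_true]
    ring
  rw [e]
  have h1 : 0 ≤ w I - w J := sub_nonneg.2 (hI.w_antitone (Fin.mk_le_mk.2 (Nat.le_succ i)))
  have h2 := hI.b_nonneg (lo I)
  nlinarith

/-- This settles a trivial step of the path, with the same ranking at both ends. Since every slack
is nonnegative, index `0` will do. -/
theorem combined_le_of_excludes (hn : 2 ≤ n) (hI : IsInstance a b w f)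
    (hL : ExcludesLeft a b w f β σ) (hR : ExcludesRight a b w f β σ)
    (z : Equiv.Perm (Fin n)) : combined f w a b z ≤ β := by
  rcases lt_or_ge (cumScore w b σ) (cumScore w b z) with h | h
  · exact hR z h
  refine hL 0 (by omega) z (h.trans (le_add_of_nonneg_right (mul_nonneg ?_ (hI.b_nonneg _))))
  exact sub_nonneg.2 (hI.w_antitone (Fin.mk_le_mk.2 (Nat.zero_le 1)))

end Geometry

end Ranking

namespace Ranking

/-! ### Inversions between two rankings -/

section Inversions

variable {n : ℕ} {a b : Fin n → ℝ}

/-- `x` stands before `y` in `lo` and after `y` in `hi`. -/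
def Inverted (lo hi : Equiv.Perm (Fin n)) (x y : Fin n) : Prop :=
  lo.symm x < lo.symm y ∧ hi.symm y < hi.symm x

/-- `σ` arises from `π` by stable sorting with decreasing keys. -/
def StableSort (K : Fin n → ℝ) (π σ : Equiv.Perm (Fin n)) : Prop :=
  ∀ x y, σ.symm x < σ.symm y ↔ K y < K x ∨ K x = K y ∧ π.symm x < π.symm y

/-- The invariant of the search for the optimal weighting of the two scores. -/
structure SearchInv (a b : Fin n → ℝ) (lo hi : Equiv.Perm (Fin n)) (ll lh : ℝ) : Prop where
  lo_sorted : SortedAt a b ll lo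
  hi_sorted : SortedAt a b lh hi
  nonneg : 0 ≤ ll
  le : ll ≤ lh
  le_one : lh ≤ 1
  inv : ∀ x y, Inverted lo hi x y → a y ≤ a x ∧ b x < b y

/-- The weighting at which `x` and `y` have the same score. -/
noncomputable def crossing (a b : Fin n → ℝ) (x y : Fin n) : ℝ :=
  (a x - a y) / ((a x - a y) + (b y - b x))

/-- The difference of the keys of `y` and `x` is affine in `l`, with the positive slope `(a x - a y)
+ (b y - b x)`, and vanishes at the crossing. -/
theorem key_lt_iff {x y : Fin n} {l : ℝ} (h : a y ≤ a x ∧ b x < b y) :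
    key a b l x < key a b l y ↔ crossing a b x y < l := by
  have h1 := h.1
  have h2 := h.2
  rw [crossing, div_lt_iff₀ (by linarith), key, key]
  constructor <;> intro h3 <;> nlinarith

theorem lt_key_iff {x y : Fin n} {l : ℝ} (h : a y ≤ a x ∧ b x < b y) :
    key a b l y < key a b l x ↔ l < crossing a b x y := by
  have h1 := h.1
  have h2 := h.2
  rw [crossing, lt_div_iff₀ (by linarith), key, key]
  constructor <;> intro h3 <;> nlinarith

/-- Strictness in the second score keeps crossings away from `1`, where the supporting line is
horizontal and has no probe above `σ`. -/
theorem crossing_lt_one {x y : Fin n} (h : a y ≤ a x ∧ b x < b y) : crossing a b x y < 1 := by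
  rw [crossing, div_lt_one (by linarith [h.1, h.2])]
  linarith [h.2]

theorem SortedAt.key_le {l : ℝ} {π : Equiv.Perm (Fin n)} (h : SortedAt a b l π) {x y : Fin n}
    (hxy : π.symm x < π.symm y) : key a b l y ≤ key a b l x := by
  simpa using h _ _ hxy.le

theorem sortedAt_of_key_le {l : ℝ} {π : Equiv.Perm (Fin n)}
    (h : ∀ x y, π.symm x < π.symm y → key a b l y ≤ key a b l x) : SortedAt a b l π := by
  intro i j hij
  rcases hij.eq_or_lt with rfl | hlt
  · exact le_rfl
  · exact h _ _ (by simpa using hlt)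

theorem StableSort.sortedAt {l : ℝ} {π σ : Equiv.Perm (Fin n)}
    (h : StableSort (key a b l) π σ) : SortedAt a b l σ := by
  refine sortedAt_of_key_le fun x y hxy => ?_
  rcases (h x y).1 hxy with h1 | h1
  · exact h1.le
  · exact h1.1.ge

/-- The difference of two keys is affine in the weighting, so its sign at `ll` and `lh` persists in
between. -/
theorem SearchInv.key_le {lo hi : Equiv.Perm (Fin n)} {ll lh l : ℝ}
    (h : SearchInv a b lo hi ll lh) (h1 : ll ≤ l) (h2 : l ≤ lh) {x y : Fin n}
    (hlo : lo.symm x < lo.symm y) (hhi : hi.symm x < hi.symm y) :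
    key a b l y ≤ key a b l x := by
  have e1 := h.lo_sorted.key_le hlo
  have e2 := h.hi_sorted.key_le hhi
  simp only [key] at *
  by_contra! hc
  rcases le_total ((b y - b x) - (a y - a x)) 0 with h3 | h3 <;> nlinarith

theorem symm_trichotomy (π : Equiv.Perm (Fin n)) {x y : Fin n} (hxy : x ≠ y) :
    π.symm x < π.symm y ∨ π.symm y < π.symm x :=
  lt_or_gt_of_ne fun e => hxy (π.symm.injective e)

/-- A stable sort of `lo` exchanges a pair only if the keys demand it strictly. Pairs in the same
order in `lo` and `hi` never do; an inverted pair does as soon as `l` has passed its crossing. -/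
theorem SearchInv.inverted_left {lo hi σ : Equiv.Perm (Fin n)} {ll lh l : ℝ}
    (h : SearchInv a b lo hi ll lh) (h1 : ll ≤ l) (h2 : l ≤ lh)
    (hσ : StableSort (key a b l) lo σ) (x y : Fin n) :
    Inverted lo σ x y ↔ Inverted lo hi x y ∧ crossing a b x y < l := by
  constructor
  · rintro ⟨hx, hy⟩
    have hk : key a b l x < key a b l y := by
      rcases (hσ y x).1 hy with h3 | h3
      · exact h3
      · exact absurd h3.2 hx.asymm
    have hne : x ≠ y := by rintro rfl; exact lt_irrefl _ hx
    have hI : Inverted lo hi x y := by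
      refine ⟨hx, (symm_trichotomy hi hne).resolve_left fun hh => ?_⟩
      exact absurd (h.key_le h1 h2 hx hh) (not_le.2 hk)
    exact ⟨hI, (key_lt_iff (h.inv x y hI)).1 hk⟩
  · rintro ⟨hI, hc⟩
    exact ⟨hI.1, (hσ y x).2 (Or.inl ((key_lt_iff (h.inv x y hI)).2 hc))⟩

/-- Seen from `hi`, sorting restores the order of `lo` exactly for the pairs whose crossing lies
beyond `l`. Crossings equal to `l` survive on neither side, which guarantees progress. -/
theorem SearchInv.inverted_right {lo hi σ : Equiv.Perm (Fin n)} {ll lh l : ℝ}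
    (h : SearchInv a b lo hi ll lh) (h1 : ll ≤ l) (h2 : l ≤ lh)
    (hσ : StableSort (key a b l) hi σ) (x y : Fin n) :
    Inverted σ hi x y ↔ Inverted lo hi x y ∧ l < crossing a b x y := by
  constructor
  · rintro ⟨hx, hy⟩
    have hk : key a b l y < key a b l x := by
      rcases (hσ x y).1 hx with h3 | h3
      · exact h3
      · exact absurd h3.2 hy.asymm
    have hne : x ≠ y := by rintro rfl; exact lt_irrefl _ hx
    have hI : Inverted lo hi x y := by
      refine ⟨(symm_trichotomy lo hne).resolve_right fun hh => ?_, hy⟩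
      exact absurd (h.key_le h1 h2 hh hy) (not_le.2 hk)
    exact ⟨hI, (lt_key_iff (h.inv x y hI)).1 hk⟩
  · rintro ⟨hI, hc⟩
    exact ⟨(hσ x y).2 (Or.inl ((lt_key_iff (h.inv x y hI)).2 hc)), hI.2⟩

theorem SearchInv.left {lo hi σ : Equiv.Perm (Fin n)} {ll lh l : ℝ}
    (h : SearchInv a b lo hi ll lh) (h1 : ll ≤ l) (h2 : l ≤ lh)
    (hσ : StableSort (key a b l) lo σ) : SearchInv a b lo σ ll l :=
  ⟨h.lo_sorted, hσ.sortedAt, h.nonneg, h1, h2.trans h.le_one,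
    fun x y hI => h.inv x y ((h.inverted_left h1 h2 hσ x y).1 hI).1⟩

theorem SearchInv.right {lo hi σ : Equiv.Perm (Fin n)} {ll lh l : ℝ}
    (h : SearchInv a b lo hi ll lh) (h1 : ll ≤ l) (h2 : l ≤ lh)
    (hσ : StableSort (key a b l) hi σ) : SearchInv a b σ hi l lh :=
  ⟨hσ.sortedAt, h.hi_sorted, h.nonneg.trans h1, h2, h.le_one,
    fun x y hI => h.inv x y ((h.inverted_right h1 h2 hσ x y).1 hI).1⟩

/-- A pair inverted between `σ` and `τ` is tied at `l`; both stable sorts kept its order, so it was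
inverted before. -/
theorem SearchInv.mid {lo hi σ τ : Equiv.Perm (Fin n)} {ll lh l : ℝ}
    (h : SearchInv a b lo hi ll lh) (h1 : ll ≤ l) (h2 : l ≤ lh)
    (hσ : StableSort (key a b l) lo σ) (hτ : StableSort (key a b l) hi τ) :
    SearchInv a b σ τ l l := by
  refine ⟨hσ.sortedAt, hτ.sortedAt, h.nonneg.trans h1, le_rfl, h2.trans h.le_one,
    fun x y hI => h.inv x y ?_⟩
  have e1 := (hσ x y).1 hI.1
  have e2 := (hτ y x).1 hI.2
  rcases e1 with e1 | e1
  · rcases e2 with e2 | e2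
    · exact absurd e1 e2.asymm
    · exact absurd e2.1 e1.ne
  · rcases e2 with e2 | e2
    · exact absurd e1.1 e2.ne
    · exact ⟨e1.2, e2.2⟩

theorem SearchInv.crossing_mem {lo hi : Equiv.Perm (Fin n)} {ll lh : ℝ}
    (h : SearchInv a b lo hi ll lh) {x y : Fin n} (hI : Inverted lo hi x y) :
    ll ≤ crossing a b x y ∧ crossing a b x y ≤ lh := by
  have hab := h.inv x y hI
  constructor
  · by_contra! hc
    exact absurd (h.lo_sorted.key_le hI.1) (not_le.2 ((key_lt_iff hab).2 hc))
  · by_contra! hc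
    exact absurd (h.hi_sorted.key_le hI.2) (not_le.2 ((lt_key_iff hab).2 hc))

/-- Sorting `hi` from `lo`, not from the input order, keeps ties in `b` in the order of `lo`, so
inversions are strict in `b`. -/
theorem SearchInv.init {π lo hi : Equiv.Perm (Fin n)} (h1 : StableSort (key a b 0) π lo)
    (h2 : StableSort (key a b 1) lo hi) : SearchInv a b lo hi 0 1 := by
  refine ⟨h1.sortedAt, h2.sortedAt, le_rfl, zero_le_one, le_rfl, fun x y hI => ?_⟩
  have e1 := h1.sortedAt.key_le hI.1
  have e2 := (h2 y x).1 hI.2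
  simp only [key, sub_zero, one_mul, zero_mul, add_zero, sub_self, zero_add] at e1 e2
  refine ⟨e1, ?_⟩
  rcases e2 with e2 | e2
  · exact e2
  · exact absurd e2.2 hI.1.asymm

/-- The identity is the only order automorphism of `Fin n`. -/
theorem eq_of_symm_lt {lo hi : Equiv.Perm (Fin n)}
    (h : ∀ x y, lo.symm x < lo.symm y → hi.symm x < hi.symm y) : lo = hi := by
  have hm : StrictMono (fun i => hi.symm (lo i)) := fun i j hij => h _ _ (by simpa using hij)
  have : (fun i => hi.symm (lo i)) = id := by
    have h1 := Subsingleton.elim (StrictMono.orderIsoOfSurjective _ hm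
      (fun y => ⟨lo.symm (hi y), by simp⟩)) (OrderIso.refl (Fin n))
    funext i
    exact congrArg (fun e : Fin n ≃o Fin n => e i) h1
  ext i
  have := congrFun this i
  simp only [id] at this
  rw [Equiv.symm_apply_eq] at this
  rw [this]

theorem eq_of_not_inverted {lo hi : Equiv.Perm (Fin n)} (h : ∀ x y, ¬ Inverted lo hi x y) :
    lo = hi := by
  refine eq_of_symm_lt fun x y hxy => ?_
  have hne : x ≠ y := by rintro rfl; exact lt_irrefl _ hxy
  exact (symm_trichotomy hi hne).resolve_right fun hh => h x y ⟨hxy, hh⟩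

theorem SearchInv.sortedAt_of_eq {lo : Equiv.Perm (Fin n)} {ll lh l : ℝ}
    (h : SearchInv a b lo lo ll lh) (h1 : ll ≤ l) (h2 : l ≤ lh) : SortedAt a b l lo :=
  sortedAt_of_key_le fun _ _ hxy => h.key_le h1 h2 hxy hxy

open Classical in
/-- The set of inversions. -/
noncomputable def inversions (lo hi : Equiv.Perm (Fin n)) : Finset (Fin n × Fin n) :=
  Finset.univ.filter fun p => Inverted lo hi p.1 p.2

@[simp] theorem mem_inversions {lo hi : Equiv.Perm (Fin n)} {p : Fin n × Fin n} :
    p ∈ inversions lo hi ↔ Inverted lo hi p.1 p.2 := by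
  simp [inversions]

theorem card_inversions_le (lo hi : Equiv.Perm (Fin n)) : (inversions lo hi).card ≤ n * n :=
  (Finset.card_le_univ _).trans (by simp)

/-- The array `V` holds the ranking `π`. -/
def Holds (V : ℕ → ℕ) (π : Equiv.Perm (Fin n)) : Prop := ∀ j : Fin n, V j = π j

theorem Holds.isRank {V : ℕ → ℕ} {π : Equiv.Perm (Fin n)} (h : Holds V π) : IsRank n V := by
  refine ⟨fun q hq => by rw [h ⟨q, hq⟩]; exact (π _).2, fun p hp q hq e => ?_⟩
  rw [h ⟨p, hp⟩, h ⟨q, hq⟩] at e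
  simpa using π.injective (Fin.ext e)

theorem IsRank.exists_holds {V : ℕ → ℕ} (h : IsRank n V) :
    ∃ π : Equiv.Perm (Fin n), Holds V π := by
  let g : Fin n → Fin n := fun j => ⟨V j, h.1 j j.2⟩
  have hg : Function.Injective g := fun i j e =>
    Fin.ext (h.2 i i.2 j j.2 (by simpa [g] using e))
  exact ⟨Equiv.ofBijective g (Finite.injective_iff_bijective.1 hg), fun j => rfl⟩

theorem Holds.before_iff {V : ℕ → ℕ} {π : Equiv.Perm (Fin n)} (h : Holds V π) (x y : Fin n) :
    Before n V x y ↔ π.symm x < π.symm y := by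
  have hx : V (π.symm x) = x := by rw [h]; simp
  have hy : V (π.symm y) = y := by rw [h]; simp
  rw [← hx, ← hy, h.isRank.before_iff (π.symm x).2 (π.symm y).2]
  simp

theorem Holds.congr {V V' : ℕ → ℕ} {π : Equiv.Perm (Fin n)} (h : Holds V π)
    (e : ∀ q < n, V' q = V q) : Holds V' π := fun j => by rw [e j j.2, h j]

theorem Holds.unique {V : ℕ → ℕ} {π σ : Equiv.Perm (Fin n)} (h : Holds V π) (h' : Holds V σ) :
    π = σ := by
  ext j
  rw [← h j, ← h' j]

/-- The sum, over all draws, of the number of inversions that remain afterwards. -/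
theorem four_mul_sum_le {m : ℕ} (c : ℕ → ℝ) (F : ℕ → ℕ)
    (h : ∀ k < m, F k ≤ ((Finset.range m).filter fun j => c j < c k).card ∨
      F k ≤ ((Finset.range m).filter fun j => c k < c j).card) :
    4 * ∑ k ∈ Finset.range m, F k ≤ 3 * m ^ 2 := by
  classical
  -- Which bound holds may depend on the draw in an arbitrary way, so the draws are split
  -- accordingly.
  set A := (Finset.range m).filter fun k =>
    F k ≤ ((Finset.range m).filter fun j => c j < c k).card with hA
  set B := (Finset.range m).filter fun k =>
    ¬ F k ≤ ((Finset.range m).filter fun j => c j < c k).card with hB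
  have hAB : A.card + B.card = m := by
    rw [hA, hB, Finset.card_filter_add_card_filter_not, Finset.card_range]
  have hsub : ∀ p : ℕ → Prop, ((Finset.range m).filter p).card =
      (A.filter p).card + (B.filter p).card := by
    intro p
    rw [hA, hB, Finset.filter_comm, Finset.filter_comm (p := fun k => ¬ _)]
    exact (Finset.card_filter_add_card_filter_not _).symm
  -- By double counting, both strict comparisons have the same total, and together they use each
  -- ordered pair at most once.
  have hhalf : ∀ S : Finset ℕ, 2 * ∑ k ∈ S, (S.filter fun j => c j < c k).card ≤ S.card ^ 2 := by
    intro S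
    have e : ∑ k ∈ S, (S.filter fun j => c j < c k).card =
        ∑ k ∈ S, (S.filter fun j => c k < c j).card := by
      have := Finset.sum_card_bipartiteAbove_eq_sum_card_bipartiteBelow (s := S) (t := S)
        (fun k j => c j < c k)
      simpa [Finset.bipartiteAbove, Finset.bipartiteBelow] using this
    have e2 : ∑ k ∈ S, (S.filter fun j => c j < c k).card +
        ∑ k ∈ S, (S.filter fun j => c k < c j).card ≤ S.card * S.card := by
      rw [← Finset.sum_add_distrib, ← smul_eq_mul, ← Finset.sum_const]
      refine Finset.sum_le_sum fun k _ => ?_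
      rw [← Finset.card_union_of_disjoint]
      · exact Finset.card_le_card (Finset.union_subset (Finset.filter_subset _ _)
          (Finset.filter_subset _ _))
      · rw [Finset.disjoint_filter]
        exact fun j _ h1 h2 => absurd h1 h2.asymm
    nlinarith
  have hhalf' : ∀ S : Finset ℕ, 2 * ∑ k ∈ S, (S.filter fun j => c k < c j).card ≤ S.card ^ 2 := by
    intro S
    refine le_of_eq_of_le ?_ (hhalf S)
    congr 1
    have := Finset.sum_card_bipartiteAbove_eq_sum_card_bipartiteBelow (s := S) (t := S)
      (fun k j => c k < c j)
    simpa [Finset.bipartiteAbove, Finset.bipartiteBelow] using this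
  have h1 : ∑ k ∈ A, F k ≤ ∑ k ∈ A, (A.filter fun j => c j < c k).card + A.card * B.card := by
    rw [← smul_eq_mul, ← Finset.sum_const, ← Finset.sum_add_distrib]
    refine Finset.sum_le_sum fun k hk => ?_
    refine (Finset.mem_filter.1 hk).2.trans ?_
    rw [hsub]
    exact Nat.add_le_add_left (Finset.card_filter_le _ _) _
  have h2 : ∑ k ∈ B, F k ≤ ∑ k ∈ B, (B.filter fun j => c k < c j).card + B.card * A.card := by
    rw [← smul_eq_mul, ← Finset.sum_const, ← Finset.sum_add_distrib]
    refine Finset.sum_le_sum fun k hk => ?_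
    have hk' := Finset.mem_filter.1 hk
    refine ((h k (Finset.mem_range.1 hk'.1)).resolve_left hk'.2).trans ?_
    rw [hsub, add_comm]
    exact Nat.add_le_add_left (Finset.card_filter_le _ _) _
  have h3 : ∑ k ∈ Finset.range m, F k = ∑ k ∈ A, F k + ∑ k ∈ B, F k := by
    rw [hA, hB, Finset.sum_filter_add_sum_filter_not]
  have h4 := hhalf A
  have h5 := hhalf' B
  -- With `α` and `β` the sizes of the two classes, the sum is at most `(α + β)² / 2 + α β`, and `α
  -- β ≤ (α + β)² / 4` yields the factor `3 / 4`.
  rw [h3, ← hAB]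
  zify at *
  nlinarith [sq_nonneg ((A.card : ℤ) - B.card)]

end Inversions

end Ranking

/-! ### Keys and stable sorting on the machine -/

namespace Ranking
variable {W n : ℕ} {f : ℝ → ℝ → ℝ} {a b w : Fin n → ℝ}

/-- The input is still in place. -/
structure Input (a b w : Fin n → ℝ) (M : Memory) : Prop where
  n : M.nreg 0 = n
  a : M.rarr 0 = arrayOf a
  b : M.rarr 1 = arrayOf b
  w : M.rarr 2 = arrayOf w

theorem Input.frame {M M' : Memory} {s : Stmt} (h : Input a b w M) (hF : Frame s M M')
    (h0 : s.writesN 0 = false ∧ s.writesRA 0 = false ∧ s.writesRA 1 = false ∧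
      s.writesRA 2 = false) : Input a b w M' :=
  ⟨by rw [hF.n 0 h0.1, h.n], by rw [hF.ra 0 h0.2.1, h.a], by rw [hF.ra 1 h0.2.2.1, h.b],
    by rw [hF.ra 2 h0.2.2.2, h.w]⟩

theorem arrayOf_apply (v : Fin n → ℝ) (j : Fin n) : arrayOf v j = v j := by
  simp [arrayOf]

theorem arrayOf_of_lt (v : Fin n → ℝ) {q : ℕ} (h : q < n) : arrayOf v q = v ⟨q, h⟩ := by
  simp [arrayOf, h]

/-- Compute the weighted scores of all results. -/
def keyStmt : Stmt :=
  forLoop 7 (.putR 3 (.reg 7) (.add (.mul (.sub (.ofWord (.const 1)) (.reg 0)) (.get 0 (.reg 7)))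
    (.mul (.reg 0) (.get 1 (.reg 7)))))

theorem keyStmt_spec {M : Memory} (hW : 8 * n + 8 ≤ W) (hM : Input a b w M) :
    Spec W f keyStmt M (fun t M' => t ≤ 4 * n + 3 ∧
      ∀ x : Fin n, M'.rarr 3 x = key a b (M.rreg 0) x) := by
  have m1 : 1 % W = 1 := Nat.mod_eq_of_lt (by omega)
  refine (Spec.for (n := n) (by decide) (fun q M' => M'.rarr 0 = arrayOf a ∧
    M'.rarr 1 = arrayOf b ∧ M'.rreg 0 = M.rreg 0 ∧
    ∀ x : Fin n, (x : ℕ) < q → M'.rarr 3 x = key a b (M.rreg 0) x) 1 (by omega) M hM.n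
    (by simp [hM.a, hM.b]) (by decide) ?_).mono ?_
  · rintro q hq M' - hr ⟨ha, hb, hl, h⟩
    simp only [spec_putR, NExpr.eval, RExpr.eval, hr, ha, hb, hl, m1]
    refine ⟨le_rfl, by simp [ha], by simp [hb], by simp [hl], fun x hx => ?_⟩
    rcases Nat.lt_succ_iff_lt_or_eq.1 hx with h1 | rfl
    · simp [Function.update_of_ne (show (x : ℕ) ≠ q by omega), h x h1]
    · simp [arrayOf_apply, key]
  · rintro t M' - ⟨ht, -, -, -, h⟩
    exact ⟨by omega, fun x => h x x.2⟩

/-- Take the positions in the ranking in word array `2`, counted from the end, as keys. -/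
def rankKeyStmt : Stmt :=
  forLoop 7 (.putR 3 (.get 2 (.reg 7)) (.ofWord (.sub (.reg 0) (.reg 7))))

theorem rankKeyStmt_spec {M : Memory} (hW : 8 * n + 8 ≤ W) (hM : M.nreg 0 = n)
    {π : Equiv.Perm (Fin n)} (hπ : Holds (M.narr 2) π) :
    Spec W f rankKeyStmt M (fun t M' => t ≤ 4 * n + 3 ∧
      ∀ x : Fin n, M'.rarr 3 x = ((n - π.symm x : ℕ) : ℝ)) := by
  refine (Spec.for (n := n) (by decide) (fun q M' => M'.narr 2 = M.narr 2 ∧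
    ∀ j : Fin n, (j : ℕ) < q → M'.rarr 3 (π j) = ((n - j : ℕ) : ℝ)) 1 (by omega) M hM
    (by simp) (by decide) ?_).mono ?_
  · rintro q hq M' h0 hr ⟨h2, h⟩
    simp only [spec_putR, NExpr.eval, RExpr.eval, hr, h0, h2]
    refine ⟨le_rfl, by simp [h2], fun j hj => ?_⟩
    rcases Nat.lt_succ_iff_lt_or_eq.1 hj with h1 | rfl
    · have : (π j : ℕ) ≠ M.narr 2 q := by
        rw [hπ ⟨q, hq⟩]
        intro e
        have := π.injective (Fin.ext e)
        rw [this] at h1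
        exact lt_irrefl _ h1
      simp [Function.update_of_ne this, h j h1]
    · simp [hπ j]
  · rintro t M' - ⟨ht, -, h⟩
    refine ⟨by omega, fun x => ?_⟩
    have := h (π.symm x) (π.symm x).2
    simpa using this

open Classical in
theorem sortStmt_spec_perm {M : Memory} (hW : 8 * n + 8 ≤ W) (hM : M.nreg 0 = n)
    {π : Equiv.Perm (Fin n)} (hπ : Holds (M.narr 3) π) :
    Spec W f sortStmt M (fun t M' => t ≤ Nat.size n * (22 * n + 20) + 4 * n + 10 ∧
      ∃ σ : Equiv.Perm (Fin n), Holds (M'.narr 3) σ ∧ StableSort (fun x => M.rarr 3 x) π σ ∧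
      ∀ x : Fin n, M'.narr 5 x = (Finset.univ.filter fun y => Inverted π σ y x).card) := by
  refine (sortStmt_spec hW hM hπ.isRank).mono ?_
  rintro t M' - ⟨ht, hS, hs⟩
  obtain ⟨σ, hσ⟩ := hS.rank.exists_holds
  refine ⟨ht, σ, hσ, fun x y => ?_, fun x => ?_⟩
  · have hmono : ∀ x y : Fin n, π.symm y < π.symm x → σ.symm x < σ.symm y →
        M.rarr 3 y < M.rarr 3 x := fun x y h1 h2 =>
      hS.mono x y ((hπ.before_iff y x).2 h1) ((hσ.before_iff x y).2 h2)
    have hle : ∀ x y : Fin n, σ.symm x < σ.symm y → M.rarr 3 y ≤ M.rarr 3 x := by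
      intro x y h
      have := hs (σ.symm x) (σ.symm y) h (σ.symm y).2
      rwa [hσ, hσ, Equiv.apply_symm_apply, Equiv.apply_symm_apply] at this
    constructor
    · intro h
      rcases (hle x y h).lt_or_eq with h1 | h1
      · exact Or.inl h1
      · refine Or.inr ⟨h1.symm, ?_⟩
        have hne : x ≠ y := by rintro rfl; exact lt_irrefl _ h
        exact (symm_trichotomy π hne).resolve_right fun hh => (hmono x y hh h).ne h1
    · rintro (h | ⟨h1, h2⟩)
      · have hne : x ≠ y := by rintro rfl; exact lt_irrefl _ h
        exact (symm_trichotomy σ hne).resolve_right fun hh => absurd (hle y x hh) (not_le.2 h)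
      · have hne : x ≠ y := by rintro rfl; exact lt_irrefl _ h2
        exact (symm_trichotomy σ hne).resolve_right fun hh => (hmono y x h2 hh).ne h1
  · rw [hS.cnt x x.2, ← Finset.card_map Fin.valEmbedding]
    congr 1
    ext y
    simp only [Finset.mem_filter, Finset.mem_range, Finset.mem_map, Finset.mem_univ, true_and,
      Fin.valEmbedding_apply]
    constructor
    · rintro ⟨hy, h1, h2⟩
      exact ⟨⟨y, hy⟩, ⟨(hπ.before_iff ⟨y, hy⟩ x).1 h1, (hσ.before_iff x ⟨y, hy⟩).1 h2⟩, rfl⟩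
    · rintro ⟨y, ⟨h1, h2⟩, rfl⟩
      exact ⟨y.2, (hπ.before_iff y x).2 h1, (hσ.before_iff x y).2 h2⟩

/-! ### The direction test -/

/-- The loop of the direction test: compute both scores of the ranking in word array `3`, and the
best way to use additional weight. -/
def slackLoop : Stmt :=
  forLoop 7
    (.seq (.setR 1 (.add (.reg 1) (.mul (.get 2 (.reg 7)) (.get 0 (.get 3 (.reg 7))))))
    (.seq (.setR 2 (.add (.reg 2) (.mul (.get 2 (.reg 7)) (.get 1 (.get 3 (.reg 7))))))
    (.seq (.ite (.rlt (.get 2 (.reg 7)) (.get 2 (.sub (.reg 7) (.const 1)))) (.setN 8 (.reg 7)) .skip)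
      (.ite (.rlt (.reg 3) (.mul (.sub (.get 2 (.sub (.reg 8) (.const 1))) (.get 2 (.reg 8)))
          (.get 1 (.get 3 (.reg 7)))))
        (.seq (.setR 3 (.mul (.sub (.get 2 (.sub (.reg 8) (.const 1))) (.get 2 (.reg 8)))
            (.get 1 (.get 3 (.reg 7)))))
          (.seq (.setN 9 (.reg 8)) (.setN 10 (.reg 7))))
        .skip))))

/-- The invariant of `slackLoop`; `V` is the ranking, `bs` the start of the current block of equal
weights, `S` the largest gain so far, attained for the positions `J` and `m`. -/
structure SlackInv (n : ℕ) (aA bA wA : ℕ → ℝ) (V : ℕ → ℕ) (q : ℕ) (X Y S : ℝ) (bs J m : ℕ) :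
    Prop where
  X : X = ∑ p ∈ Finset.range q, wA p * aA (V p)
  Y : Y = ∑ p ∈ Finset.range q, wA p * bA (V p)
  bs_le : bs ≤ q - 1
  w_bs : wA bs = wA (q - 1)
  bs_lt : bs = 0 ∨ wA bs < wA (bs - 1)
  S_nonneg : 0 ≤ S
  J_pos : 1 ≤ J
  Jm : J ≤ m
  m_lt : m < n
  w_J : wA m = wA J
  S_le : S ≤ (wA (J - 1) - wA J) * bA (V m)
  le_S : ∀ i p, i + 1 ≤ p → p < q → wA p = wA (i + 1) → (wA i - wA (i + 1)) * bA (V p) ≤ S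

/-- At position `q` only the drop onto the current level of weights matters, and it occurs at the
start of the block; every other admissible index has drop zero. So one comparison per position
yields the maximum over all pairs. -/
theorem SlackInv.step {aA bA wA : ℕ → ℝ} {V : ℕ → ℕ} {q : ℕ} {X Y S : ℝ} {bs bs' J m : ℕ}
    (h : SlackInv n aA bA wA V q X Y S bs J m) (hq : q < n)
    (hw : ∀ i j, i ≤ j → j < n → wA j ≤ wA i)
    (hbs : bs' = if wA q < wA (q - 1) then q else bs) :
    (S < (wA (bs' - 1) - wA bs') * bA (V q) →
      SlackInv n aA bA wA V (q + 1) (X + wA q * aA (V q)) (Y + wA q * bA (V q))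
        ((wA (bs' - 1) - wA bs') * bA (V q)) bs' bs' q) ∧
    (¬ S < (wA (bs' - 1) - wA bs') * bA (V q) →
      SlackInv n aA bA wA V (q + 1) (X + wA q * aA (V q)) (Y + wA q * bA (V q)) S bs' J m) := by
  have e1 : bs' ≤ q := by
    rw [hbs]; split_ifs
    · exact le_rfl
    · have := h.bs_le; omega
  have e2 : wA bs' = wA q := by
    rw [hbs]; split_ifs with hlt
    · rfl
    · rw [h.w_bs]
      exact le_antisymm (not_lt.1 hlt) (hw _ _ (by omega) hq)
  have e3 : bs' = 0 ∨ wA bs' < wA (bs' - 1) := by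
    rw [hbs]; split_ifs with hlt
    · exact Or.inr hlt
    · exact h.bs_lt
  have key : ∀ S', 0 ≤ S' → (wA (bs' - 1) - wA bs') * bA (V q) ≤ S' →
      ∀ i, i + 1 ≤ q → wA q = wA (i + 1) → (wA i - wA (i + 1)) * bA (V q) ≤ S' := by
    intro S' hS' hle i hi hwi
    rcases (hw i (i + 1) (by omega) (by omega)).eq_or_lt with e | hlt
    · rw [e, sub_self, zero_mul]; exact hS'
    · have hb : bs' = i + 1 := by
        rcases lt_trichotomy bs' (i + 1) with h1 | h1 | h1
        · have := hw bs' i (by omega) (by omega)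
          rw [e2, hwi] at this
          exact absurd hlt (not_lt.2 this)
        · exact h1
        · rcases e3 with h2 | h2
          · omega
          · have := hw (i + 1) (bs' - 1) (by omega) (by omega)
            rw [e2, hwi] at h2
            exact absurd h2 (not_lt.2 this)
      subst hb
      simpa using hle
  constructor
  · intro hlt
    have hpos : 0 < (wA (bs' - 1) - wA bs') * bA (V q) := lt_of_le_of_lt h.S_nonneg hlt
    refine ⟨by rw [Finset.sum_range_succ, h.X], by rw [Finset.sum_range_succ, h.Y], by simpa using e1,
      by simpa using e2, e3, hpos.le, ?_, e1, hq, e2.symm, le_rfl, fun i p h1 h2 h3 => ?_⟩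
    -- In the first block `bs' - 1` is truncated to `bs'`, so the drop is zero and cannot beat `S`.
    · rcases Nat.eq_zero_or_pos bs' with e | e
      · rw [e] at hpos; simp at hpos
      · exact e
    · rcases Nat.lt_succ_iff_lt_or_eq.1 h2 with h4 | rfl
      · exact (h.le_S i p h1 h4 h3).trans hlt.le
      · exact key _ hpos.le le_rfl i h1 h3
  · intro hlt
    refine ⟨by rw [Finset.sum_range_succ, h.X], by rw [Finset.sum_range_succ, h.Y], by simpa using e1,
      by simpa using e2, e3, h.S_nonneg, h.J_pos, h.Jm, h.m_lt, h.w_J, h.S_le,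
      fun i p h1 h2 h3 => ?_⟩
    rcases Nat.lt_succ_iff_lt_or_eq.1 h2 with h4 | rfl
    · exact h.le_S i p h1 h4 h3
    · exact key _ h.S_nonneg (not_lt.1 hlt) i h1 h3

theorem slackLoop_spec {M : Memory} (hW : 8 * n + 8 ≤ W) (hn : M.nreg 0 = n)
    (hw : ∀ i j, i ≤ j → j < n → M.rarr 2 j ≤ M.rarr 2 i)
    (h : SlackInv n (M.rarr 0) (M.rarr 1) (M.rarr 2) (M.narr 3) 0 (M.rreg 1) (M.rreg 2) (M.rreg 3)
      (M.nreg 8) (M.nreg 9) (M.nreg 10)) :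
    Spec W f slackLoop M (fun t M' => t ≤ 17 * n + 3 ∧
      SlackInv n (M.rarr 0) (M.rarr 1) (M.rarr 2) (M.narr 3) n (M'.rreg 1) (M'.rreg 2) (M'.rreg 3)
        (M'.nreg 8) (M'.nreg 9) (M'.nreg 10)) := by
  have m1 : 1 % W = 1 := Nat.mod_eq_of_lt (by omega)
  refine (Spec.for (n := n) (by decide) (fun q M' => M'.rarr = M.rarr ∧ M'.narr = M.narr ∧
    SlackInv n (M.rarr 0) (M.rarr 1) (M.rarr 2) (M.narr 3) q (M'.rreg 1) (M'.rreg 2) (M'.rreg 3)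
      (M'.nreg 8) (M'.nreg 9) (M'.nreg 10)) 14 (by omega) M hn (by simpa using h) (by decide)
      ?_).mono ?_
  · rintro q hq M' - hr ⟨hra, hna, hI⟩
    have hst := hI.step hq hw rfl
    simp only [spec_seq, spec_setR, spec_ite, spec_setN, spec_skip, NExpr.eval, RExpr.eval,
      BExpr.Holds, hr, hra, hna, m1, Memory.setR_rreg, Memory.setR_nreg, Memory.setN_rreg,
      Memory.setR_rarr, Memory.setN_rarr, Memory.setR_narr, Memory.setN_narr, Memory.setN_nreg]
    by_cases h1 : M.rarr 2 q < M.rarr 2 (q - 1)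
    · simp only [h1, if_true] at hst ⊢
      by_cases h2 : M'.rreg 3 < (M.rarr 2 (q - 1) - M.rarr 2 q) * M.rarr 1 (M.narr 3 q)
      · simpa [h2, hra, hna, hr, m1] using hst.1 h2
      · simpa [h2, hra, hna, hr, m1] using hst.2 h2
    · simp only [h1, if_false] at hst ⊢
      by_cases h2 : M'.rreg 3 < (M.rarr 2 (M'.nreg 8 - 1) - M.rarr 2 (M'.nreg 8)) *
          M.rarr 1 (M.narr 3 q)
      · simpa [h2, hra, hna, hr, m1] using hst.1 h2
      · simpa [h2, hra, hna, hr, m1] using hst.2 h2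
  · rintro t M' - ⟨ht, -, -, h⟩
    exact ⟨by omega, h⟩

end Ranking

/-! ### The record and the outcome of a direction test -/

namespace Ranking
variable {W n : ℕ} {f : ℝ → ℝ → ℝ} {a b w : Fin n → ℝ}

/-- Word array `0` holds a ranking whose objective, for some advantaged weights, is the content of
real register `4`. -/
def HasRecord (a b w : Fin n → ℝ) (f : ℝ → ℝ → ℝ) (M : Memory) : Prop :=
  ∃ (π : Equiv.Perm (Fin n)) (i : ℕ) (hi : i + 1 < n), Holds (M.narr 0) π ∧
    combined f (advantaged w i hi) a b π = M.rreg 4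

theorem SlackInv.isSlack {V : ℕ → ℕ} {X Y S : ℝ} {bs J m : ℕ} {σ : Equiv.Perm (Fin n)}
    (h : SlackInv n (arrayOf a) (arrayOf b) (arrayOf w) V n X Y S bs J m) (hσ : Holds V σ)
    (hI : IsInstance a b w f) :
    X = cumScore w a σ ∧ Y = cumScore w b σ ∧
    ∃ (hm : m < n) (hJ : J - 1 + 1 < n),
      (⟨J - 1 + 1, hJ⟩ : Fin n) = ⟨J, by have := h.J_pos; omega⟩ ∧
      w ⟨m, hm⟩ = w ⟨J - 1 + 1, hJ⟩ ∧
      arrayOf w (J - 1) - arrayOf w J = w ⟨J - 1, Nat.lt_of_succ_lt hJ⟩ - w ⟨J - 1 + 1, hJ⟩ ∧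
      S = (w ⟨J - 1, Nat.lt_of_succ_lt hJ⟩ - w ⟨J - 1 + 1, hJ⟩) * b (σ ⟨m, hm⟩) ∧
      IsSlack b w σ (w ⟨J - 1, Nat.lt_of_succ_lt hJ⟩ - w ⟨J - 1 + 1, hJ⟩) (σ ⟨m, hm⟩) := by
  have hJ1 := h.J_pos
  have hJm := h.Jm
  have hm := h.m_lt
  have hJ : J - 1 + 1 < n := by omega
  have eJ : (⟨J - 1 + 1, hJ⟩ : Fin n) = ⟨J, by omega⟩ := Fin.ext (by simp only; omega)
  have ew : ∀ p (hp : p < n), arrayOf w p = w ⟨p, hp⟩ := fun p hp => arrayOf_of_lt w hp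
  have eb : ∀ p (hp : p < n), arrayOf b (V p) = b (σ ⟨p, hp⟩) := fun p hp => by
    rw [hσ ⟨p, hp⟩, arrayOf_apply]
  -- During the loop `S` may be below the gain of its pair, because of the initial pair with `S =
  -- 0`; at the end that pair itself is covered by `le_S`.
  have hS : S = (w ⟨J - 1, Nat.lt_of_succ_lt hJ⟩ - w ⟨J - 1 + 1, hJ⟩) * b (σ ⟨m, hm⟩) := by
    refine le_antisymm ?_ ?_
    · have := h.S_le
      rwa [ew (J - 1) (by omega), ew J (by omega), eb m hm, ← eJ] at this
    · have := h.le_S (J - 1) m (by omega) hm (by rw [Nat.sub_add_cancel hJ1]; exact h.w_J)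
      rwa [ew (J - 1) (by omega), ew (J - 1 + 1) hJ, eb m hm] at this
  refine ⟨?_, ?_, hm, hJ, eJ, ?_, ?_, hS, ⟨?_, ?_⟩⟩
  · rw [h.X, Finset.sum_range]
    exact Finset.sum_congr rfl fun j _ => by rw [hσ j, arrayOf_apply, arrayOf_apply]
  · rw [h.Y, Finset.sum_range]
    exact Finset.sum_congr rfl fun j _ => by rw [hσ j, arrayOf_apply, arrayOf_apply]
  · have := h.w_J
    rwa [ew m hm, ew J (by omega), ← eJ] at this
  · rw [ew (J - 1) (by omega), ew J (by omega), ← eJ]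
  · exact sub_nonneg.2 (hI.w_antitone (Fin.mk_le_mk.2 (Nat.le_succ _)))
  · intro i hi p hp hwp
    rw [← hS]
    have := h.le_S i p hp p.2 (by rw [arrayOf_apply, ew _ hi, hwp])
    rwa [ew i (by omega), ew _ hi, eb p p.2] at this

/-- Replace the record if the ranking in word array `3` does better with advantaged weights. -/
def recordStmt : Stmt :=
  .seq (.setR 9 (.sub (.get 2 (.sub (.reg 9) (.const 1))) (.get 2 (.reg 9))))
  (.seq (.setR 5 (.app (.add (.reg 1) (.mul (.reg 9) (.get 0 (.get 3 (.reg 10)))))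
    (.add (.reg 2) (.mul (.reg 9) (.get 1 (.get 3 (.reg 10)))))))
  (.ite (.rle (.reg 4) (.reg 5))
    (.seq (.setR 4 (.reg 5)) (.seq (copyArr 3 0)
      (.seq (.putN 0 (.reg 9) (.get 3 (.reg 10))) (.putN 0 (.reg 10) (.get 3 (.reg 9))))))
    .skip))

/-- Set word register `11` to `1` if the objective increases along the supporting line. -/
def probeStmt : Stmt :=
  .ite (.and (.rlt (.ofWord (.const 0)) (.reg 3))
      (.and (.rle (.ofWord (.const 0)) (.sub (.reg 1)
        (.mul (.div (.reg 0) (.sub (.ofWord (.const 1)) (.reg 0))) (.reg 3))))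
      (.rlt (.app (.reg 1) (.reg 2)) (.app (.sub (.reg 1)
        (.mul (.div (.reg 0) (.sub (.ofWord (.const 1)) (.reg 0))) (.reg 3)))
          (.add (.reg 2) (.reg 3))))))
    (.setN 11 (.const 1)) (.setN 11 (.const 0))

/-- The direction test for the ranking in word array `3` and the weighting in real register `0`. -/
def dirStmt : Stmt :=
  .seq (.setR 1 (.ofWord (.const 0))) (.seq (.setR 2 (.ofWord (.const 0)))
  (.seq (.setR 3 (.ofWord (.const 0))) (.seq (.setN 8 (.const 0)) (.seq (.setN 9 (.const 1))
  (.seq (.setN 10 (.const 1)) (.seq slackLoop (.seq recordStmt probeStmt)))))))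

theorem recordStmt_spec {M : Memory} (hW : 8 * n + 8 ≤ W) (hM : Input a b w M)
    (hI : IsInstance a b w f) {σ : Equiv.Perm (Fin n)} (hσ : Holds (M.narr 3) σ)
    (hg : HasRecord a b w f M ∨ M.rreg 4 ≤ f 0 0) {i m : ℕ} (hi : i + 1 < n) (hm : m < n)
    (h9 : M.nreg 9 = i + 1) (h10 : M.nreg 10 = m)
    (h1 : M.rreg 1 = cumScore w a σ) (h2 : M.rreg 2 = cumScore w b σ)
    (hw : w ⟨m, hm⟩ = w ⟨i + 1, hi⟩) :
    Spec W f recordStmt M (fun t M' => t ≤ 4 * n + 20 ∧ HasRecord a b w f M' ∧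
      M.rreg 4 ≤ M'.rreg 4 ∧
      f (cumScore w a σ + (w ⟨i, Nat.lt_of_succ_lt hi⟩ - w ⟨i + 1, hi⟩) * a (σ ⟨m, hm⟩))
        (cumScore w b σ + (w ⟨i, Nat.lt_of_succ_lt hi⟩ - w ⟨i + 1, hi⟩) * b (σ ⟨m, hm⟩)) ≤
        M'.rreg 4) := by
  have m1 : 1 % W = 1 := Nat.mod_eq_of_lt (by omega)
  set D := w ⟨i, Nat.lt_of_succ_lt hi⟩ - w ⟨i + 1, hi⟩ with hD
  set u := σ ⟨m, hm⟩ with hu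
  have e1 : M.rarr 2 i - M.rarr 2 (i + 1) = D := by
    rw [hM.w, arrayOf_of_lt w hi, arrayOf_of_lt w (Nat.lt_of_succ_lt hi)]
  have e2 : M.narr 3 m = u := hσ ⟨m, hm⟩
  have e3 : M.rarr 0 u = a u := by rw [hM.a, arrayOf_apply]
  have e4 : M.rarr 1 u = b u := by rw [hM.b, arrayOf_apply]
  have hD0 : 0 ≤ D := sub_nonneg.2 (hI.w_antitone (Fin.mk_le_mk.2 (Nat.le_succ i)))
  set v := f (cumScore w a σ + D * a u) (cumScore w b σ + D * b u) with hv
  -- The initial record value `f 0 0` is below every candidate, so the first candidate is always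
  -- stored.
  have hv0 : f 0 0 ≤ v := hI.mono le_rfl le_rfl
    (add_nonneg (cumScore_nonneg hI.w_nonneg hI.a_nonneg σ) (mul_nonneg hD0 (hI.a_nonneg u)))
    (add_nonneg (cumScore_nonneg hI.w_nonneg hI.b_nonneg σ) (mul_nonneg hD0 (hI.b_nonneg u)))
  have hn : M.nreg 0 = n := hM.n
  rw [recordStmt]
  simp only [spec_seq (s₁ := .setR _ _), spec_setR, NExpr.eval, RExpr.eval, h9, h10, m1,
    Nat.add_sub_cancel, e1, e2, Memory.setR_rreg, Memory.setR_narr, Memory.setR_rarr,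
    Memory.setR_nreg, e3, e4, h1, h2, if_true, spec_ite, BExpr.Holds,
    show ((1 : ℕ) = 9) = False by simp, show ((2 : ℕ) = 9) = False by simp,
    show ((4 : ℕ) = 9) = False by simp, show ((4 : ℕ) = 5) = False by simp, if_false, ← hv]
  split_ifs with hle
  · refine Spec.seq (copyArr_spec (n := n) (by decide) (by omega) (by simp [hn])) ?_
    rintro t M₁ hF ⟨ht, hcopy⟩
    have a3 : M₁.narr 3 = M.narr 3 := by rw [hF.na 3 (by decide)]; simp
    have a9 : M₁.nreg 9 = i + 1 := by rw [hF.n 9 (by decide)]; simp [h9]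
    have a10 : M₁.nreg 10 = m := by rw [hF.n 10 (by decide)]; simp [h10]
    have a4 : M₁.rreg 4 = v := by rw [hF.r 4 (by decide)]; simp
    simp only [spec_seq, spec_putN, NExpr.eval, a3, a9, a10, Memory.putN_nreg, Memory.putN_narr,
      show ((3 : ℕ) = 0) = False by simp, if_false]
    refine ⟨by omega, ⟨σ * Equiv.swap ⟨i + 1, hi⟩ ⟨m, hm⟩, i, hi, ?_, ?_⟩, ?_, ?_⟩
    · intro j
      simp only [Memory.putN_narr, if_true]
      rcases eq_or_ne j ⟨m, hm⟩ with rfl | h3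
      · simp only [Function.update_self]
        rw [hσ ⟨i + 1, hi⟩]
        simp
      rw [Function.update_of_ne (fun e => h3 (Fin.ext e))]
      rcases eq_or_ne j ⟨i + 1, hi⟩ with rfl | h4
      · simp [e2, hu]
      rw [Function.update_of_ne (fun e => h4 (Fin.ext e)), hcopy j j.2]
      simp only [Memory.setR_narr]
      rw [hσ j]
      simp [Equiv.swap_apply_of_ne_of_ne h4 h3]
    · simp only [combined, cumScore_advantaged_swap _ hi hw, Memory.putN_rreg]
      rw [a4]
    · simp only [Memory.putN_rreg, a4]; exact hle
    · simp only [Memory.putN_rreg, a4]; exact le_rfl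
  · rw [spec_skip]
    refine ⟨by omega, ?_, le_rfl, (not_le.1 hle).le⟩
    rcases hg with hg | hg
    · exact hg
    · exact absurd (hg.trans hv0) hle

/-- The exclusions refer to the updated record. It never decreases, so exclusions found earlier
remain valid. The clause about a maximal first score serves the initial ranking; the other one needs
a weighting below `1` for the probe. -/
theorem dirStmt_spec {M : Memory} (hn : 2 ≤ n) (hW : 8 * n + 8 ≤ W) (hM : Input a b w M)
    (hI : IsInstance a b w f) {σ : Equiv.Perm (Fin n)} (hσ : Holds (M.narr 3) σ)
    (hg : HasRecord a b w f M ∨ M.rreg 4 ≤ f 0 0) :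
    Spec W f dirStmt M (fun t M' => t ≤ 21 * n + 50 ∧ HasRecord a b w f M' ∧
      M.rreg 4 ≤ M'.rreg 4 ∧
      ((∀ z, cumScore w a z ≤ cumScore w a σ) → ExcludesLeft a b w f (M'.rreg 4) σ) ∧
      (0 ≤ M.rreg 0 → M.rreg 0 < 1 → SortedAt a b (M.rreg 0) σ →
        (M'.nreg 11 = 1 ∧ ExcludesLeft a b w f (M'.rreg 4) σ ∨
          M'.nreg 11 = 0 ∧ ExcludesRight a b w f (M'.rreg 4) σ))) := by
  have m1 : 1 % W = 1 := Nat.mod_eq_of_lt (by omega)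
  rw [dirStmt]
  simp only [spec_seq (s₁ := .setR _ _), spec_setR, spec_seq (s₁ := .setN _ _), spec_setN,
    NExpr.eval, RExpr.eval, m1, Nat.zero_mod, Nat.cast_zero]
  refine Spec.seq (slackLoop_spec (n := n) hW (by simp [hM.n]) ?_ ?_) ?_
  · intro i j hij hj
    simp only [Memory.setN_rarr, Memory.setR_rarr, hM.w]
    rw [arrayOf_of_lt w hj, arrayOf_of_lt w (lt_of_le_of_lt hij hj)]
    exact hI.w_antitone (Fin.mk_le_mk.2 hij)
  · simp only [Memory.setN_rarr, Memory.setR_rarr, Memory.setN_narr, Memory.setR_narr,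
      Memory.setN_rreg, Memory.setR_rreg, Memory.setN_nreg]
    refine ⟨by simp, by simp, by simp, by simp, Or.inl (by simp), by simp, by simp, by simp,
      by simp; omega, by simp, ?_, by intros; omega⟩
    simp only [if_true, hM.w, hM.b]
    simp only [show ((9 : ℕ) = 10) = False by simp, if_false]
    have h0 : arrayOf w 1 ≤ arrayOf w (1 - 1) := by
      rw [arrayOf_of_lt w (show 1 < n by omega), arrayOf_of_lt w (show 1 - 1 < n by omega)]
      exact hI.w_antitone (Fin.mk_le_mk.2 (by omega))
    have h1 : 0 ≤ arrayOf b (M.narr 3 1) := by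
      rw [hσ ⟨1, by omega⟩, arrayOf_apply]
      exact hI.b_nonneg _
    exact mul_nonneg (sub_nonneg.2 h0) h1
  rintro t₁ M₁ hF₁ ⟨ht₁, hS⟩
  simp only [Memory.setN_rarr, Memory.setR_rarr, Memory.setN_narr, Memory.setR_narr] at hS
  rw [hM.a, hM.b, hM.w] at hS
  obtain ⟨hX, hY, hm, hJ, eJ, hwm, hD, hSe, hsl⟩ := hS.isSlack hσ hI
  have hJ1 := hS.J_pos
  have hM₁ : Input a b w M₁ := ⟨by rw [hF₁.n 0 (by decide)]; simp [hM.n],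
    by rw [hF₁.ra 0 (by decide)]; simp [hM.a], by rw [hF₁.ra 1 (by decide)]; simp [hM.b],
    by rw [hF₁.ra 2 (by decide)]; simp [hM.w]⟩
  have a3 : M₁.narr 3 = M.narr 3 := by rw [hF₁.na 3 (by decide)]; simp
  have a0 : M₁.narr 0 = M.narr 0 := by rw [hF₁.na 0 (by decide)]; simp
  have r4 : M₁.rreg 4 = M.rreg 4 := by rw [hF₁.r 4 (by decide)]; simp
  have r0 : M₁.rreg 0 = M.rreg 0 := by rw [hF₁.r 0 (by decide)]; simp
  refine Spec.seq (recordStmt_spec hW hM₁ hI (by rw [a3]; exact hσ) ?_ hJ hm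
    (by omega) rfl hX hY hwm) ?_
  · simpa only [HasRecord, a0, r4] using hg
  rintro t₂ M₂ hF₂ ⟨ht₂, hrec, hle, hv⟩
  rw [r4] at hle
  have s0 : M₂.rreg 0 = M.rreg 0 := by rw [hF₂.r 0 (by decide), r0]
  have s1 : M₂.rreg 1 = cumScore w a σ := by rw [hF₂.r 1 (by decide), hX]
  have s2 : M₂.rreg 2 = cumScore w b σ := by rw [hF₂.r 2 (by decide), hY]
  have s3 : M₂.rreg 3 = (w ⟨M₁.nreg 9 - 1, Nat.lt_of_succ_lt hJ⟩ - w ⟨M₁.nreg 9 - 1 + 1, hJ⟩) *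
    b (σ ⟨M₁.nreg 10, hm⟩) := by rw [hF₂.r 3 (by decide), hSe]
  simp only [probeStmt, spec_ite, spec_setN, BExpr.Holds, NExpr.eval, RExpr.eval, m1, Nat.zero_mod,
    Nat.cast_zero, Nat.cast_one, s0, s1, s2, s3]
  split_ifs with hc
  · refine ⟨by omega, by simpa [HasRecord] using hrec, by simpa using hle, fun hx => ?_,
      fun hl hl1 hs => Or.inl ⟨by simp, ?_⟩⟩
    · simpa using excludesLeft_of_max hI hsl hv hx
    · simpa using excludesLeft_of_lt hI hsl hv hs hl hl1 hc.1 hc.2.1 hc.2.2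
  · refine ⟨by omega, by simpa [HasRecord] using hrec, by simpa using hle, fun hx => ?_,
      fun hl hl1 hs => Or.inr ⟨by simp, ?_⟩⟩
    · simpa using excludesLeft_of_max hI hsl hv hx
    · have := excludesRight_of_not_lt hI hsl hv hs hl hl1 (fun h1 h2 => ?_)
      · simpa using this
      · by_contra! h3
        exact hc ⟨h1, h2, h3⟩

end Ranking

namespace Ranking
variable {W n : ℕ} {f : ℝ → ℝ → ℝ} {a b w : Fin n → ℝ}

/-! ### One round of the search -/

/-- The state of the search: word arrays `1` and `2` hold rankings `lo` and `hi`, and the record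
in word array `0` is at least as good as everything that does not lie between them. -/
structure Search (a b w : Fin n → ℝ) (f : ℝ → ℝ → ℝ) (lo hi : Equiv.Perm (Fin n)) (ll lh : ℝ)
    (M : Memory) : Prop where
  input : Input a b w M
  holds_lo : Holds (M.narr 1) lo
  holds_hi : Holds (M.narr 2) hi
  record : HasRecord a b w f M
  inv : SearchInv a b lo hi ll lh
  left : ExcludesLeft a b w f (M.rreg 4) lo
  right : ExcludesRight a b w f (M.rreg 4) hi
  reg_ll : M.rreg 6 = ll
  reg_lh : M.rreg 7 = lh
  ll_le : ll ≤ M.rreg 0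
  le_lh : M.rreg 0 ≤ lh
  lt_one : M.rreg 0 < 1

theorem HasRecord.frame {M M' : Memory} {s : Stmt} (h : HasRecord a b w f M) (hF : Frame s M M')
    (h0 : s.writesNA 0 = false ∧ s.writesR 4 = false) : HasRecord a b w f M' := by
  simpa only [HasRecord, hF.na 0 h0.1, hF.r 4 h0.2] using h

/-- A bound for the running time of `sortStmt`. -/
def sortTime (n : ℕ) : ℕ := Nat.size n * (22 * n + 20) + 4 * n + 10

/-- Absorbs the linear costs of copies, keys and direction tests into the time of the sorts. -/
theorem le_sortTime (hn : 2 ≤ n) : 44 * n ≤ sortTime n := by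
  have : 2 ≤ Nat.size n := Nat.lt_size.2 (by simpa using hn)
  unfold sortTime
  nlinarith

/-- Compare with the weighting in real register `0`, and replace `lo` or `hi` or both. -/
def roundStmt : Stmt :=
  .seq keyStmt (.seq (copyArr 1 3) (.seq sortStmt (.seq (copyArr 3 6) (.seq dirStmt
    (.ite (.nlt (.reg 11) (.const 1))
      (.seq (copyArr 6 2) (.setR 7 (.reg 0)))
      (.seq (copyArr 2 3) (.seq sortStmt (.seq dirStmt
        (.ite (.nlt (.reg 11) (.const 1))
          (.seq (copyArr 6 1) (.seq (copyArr 3 2) (.seq (.setR 6 (.reg 0)) (.seq (.setR 7 (.reg 0))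
            (.setN 12 (.const 1))))))
          (.seq (copyArr 3 1) (.setR 6 (.reg 0))))))))))))

theorem StableSort.congr {K K' : Fin n → ℝ} {π σ : Equiv.Perm (Fin n)} (h : StableSort K π σ)
    (e : ∀ x, K' x = K x) : StableSort K' π σ := by
  rwa [show K' = K from funext e]

/-- If `σ`, sorted from `lo`, excludes the right, it becomes `hi`. Otherwise it excludes the left,
and `τ`, sorted from `hi`, is tested. If `τ` excludes the left as well, it becomes `lo`. In the
remaining case everything undecided lies between `σ` and `τ`, which are sorted for the same
weighting, and word register `12` signals the end of the search. -/
theorem roundStmt_spec {M : Memory} (hn : 2 ≤ n) (hW : 8 * n + 8 ≤ W) (hI : IsInstance a b w f)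
    {lo hi : Equiv.Perm (Fin n)} {ll lh : ℝ} (hS : Search a b w f lo hi ll lh M) :
    Spec W f roundStmt M (fun t M' => t ≤ 4 * sortTime n + 200 ∧ ∃ lo' hi' ll' lh',
      Search a b w f lo' hi' ll' lh' M' ∧ M'.rreg 0 = M.rreg 0 ∧
      (M'.nreg 12 = M.nreg 12 ∧ ll' = ll ∧ lh' = M.rreg 0 ∧ (∀ x y, Inverted lo' hi' x y ↔
          Inverted lo hi x y ∧ crossing a b x y < M.rreg 0) ∨
        M'.nreg 12 = M.nreg 12 ∧ ll' = M.rreg 0 ∧ lh' = lh ∧ (∀ x y, Inverted lo' hi' x y ↔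
          Inverted lo hi x y ∧ M.rreg 0 < crossing a b x y) ∨
        M'.nreg 12 = 1 ∧ SortedAt a b (M.rreg 0) lo' ∧ SortedAt a b (M.rreg 0) hi')) := by
  have m1 : 1 % W = 1 := Nat.mod_eq_of_lt (by omega)
  have hT := le_sortTime hn
  rw [roundStmt]
  refine Spec.seq (keyStmt_spec hW hS.input) ?_
  rintro t₁ M₁ F₁ ⟨ht₁, hk⟩
  have i₁ := hS.input.frame F₁ (by decide)
  refine Spec.seq (copyArr_spec (by decide) (by omega) i₁.n) ?_
  rintro t₂ M₂ F₂ ⟨ht₂, hc₂⟩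
  have i₂ := i₁.frame F₂ (by decide)
  have h3 : Holds (M₂.narr 3) lo := by
    refine hS.holds_lo.congr fun q hq => ?_
    rw [hc₂ q hq, F₁.na 1 (by decide)]
  refine Spec.seq (sortStmt_spec_perm hW i₂.n h3) ?_
  rintro t₃ M₃ F₃ ⟨ht₃, σ, hσ, hst, -⟩
  have i₃ := i₂.frame F₃ (by decide)
  replace hst : StableSort (key a b (M.rreg 0)) lo σ :=
    hst.congr fun x => by rw [F₂.ra 3 (by decide), hk x]
  refine Spec.seq (copyArr_spec (by decide) (by omega) i₃.n) ?_
  rintro t₄ M₄ F₄ ⟨ht₄, hc₄⟩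
  have i₄ := i₃.frame F₄ (by decide)
  have hσ4 : Holds (M₄.narr 3) σ := by rw [F₄.na 3 (by decide)]; exact hσ
  have hσ6 : Holds (M₄.narr 6) σ := hσ.congr hc₄
  have rec₄ : HasRecord a b w f M₄ := (((hS.record.frame F₁ (by decide)).frame F₂
    (by decide)).frame F₃ (by decide)).frame F₄ (by decide)
  have hr : ∀ r, M₄.rreg r = M.rreg r := fun r => by
    rw [F₄.r r rfl, F₃.r r rfl, F₂.r r rfl, F₁.r r rfl]
  have hl0 : 0 ≤ M.rreg 0 := hS.inv.nonneg.trans hS.ll_le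
  refine Spec.seq (dirStmt_spec hn hW i₄ hI hσ4 (Or.inl rec₄)) ?_
  rintro t₅ M₅ F₅ ⟨ht₅, rec₅, hle₅, -, hdir⟩
  have i₅ := i₄.frame F₅ (by decide)
  rw [hr] at hdir hle₅
  replace hdir := hdir hl0 hS.lt_one hst.sortedAt
  have hr0 : M₅.rreg 0 = M.rreg 0 := by rw [F₅.r 0 (by decide), hr]
  have hr6 : M₅.rreg 6 = ll := by rw [F₅.r 6 (by decide), hr, hS.reg_ll]
  have hr7 : M₅.rreg 7 = lh := by rw [F₅.r 7 (by decide), hr, hS.reg_lh]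
  have hn12 : M₅.nreg 12 = M.nreg 12 := by
    rw [F₅.n 12 (by decide), F₄.n 12 (by decide), F₃.n 12 (by decide), F₂.n 12 (by decide),
      F₁.n 12 (by decide)]
  have ha1 : M₅.narr 1 = M.narr 1 := by
    rw [F₅.na 1 (by decide), F₄.na 1 (by decide), F₃.na 1 (by decide), F₂.na 1 (by decide),
      F₁.na 1 (by decide)]
  have ha2 : M₅.narr 2 = M.narr 2 := by
    rw [F₅.na 2 (by decide), F₄.na 2 (by decide), F₃.na 2 (by decide), F₂.na 2 (by decide),
      F₁.na 2 (by decide)]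
  have ha6 : M₅.narr 6 = M₄.narr 6 := F₅.na 6 (by decide)
  have hk5 : ∀ x : Fin n, M₅.rarr 3 x = key a b (M.rreg 0) x := fun x => by
    rw [F₅.ra 3 (by decide), F₄.ra 3 (by decide), F₃.ra 3 (by decide), F₂.ra 3 (by decide), hk x]
  have inv₁ := hS.inv.left hS.ll_le hS.le_lh hst
  rw [spec_ite]
  simp only [BExpr.Holds, NExpr.eval, m1]
  rcases hdir with ⟨h11, hex⟩ | ⟨h11, hex⟩
  · rw [if_neg (by omega)]
    refine Spec.seq (copyArr_spec (by decide) (by omega) i₅.n) ?_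
    rintro t₆ M₆ F₆ ⟨ht₆, hc₆⟩
    have i₆ := i₅.frame F₆ (by decide)
    have h6 : Holds (M₆.narr 3) hi := hS.holds_hi.congr fun q hq => by rw [hc₆ q hq, ha2]
    refine Spec.seq (sortStmt_spec_perm hW i₆.n h6) ?_
    rintro t₇ M₇ F₇ ⟨ht₇, τ, hτ, hst', -⟩
    have i₇ := i₆.frame F₇ (by decide)
    replace hst' : StableSort (key a b (M.rreg 0)) hi τ :=
      hst'.congr fun x => by rw [F₆.ra 3 (by decide), hk5 x]
    have rec₇ : HasRecord a b w f M₇ := (rec₅.frame F₆ (by decide)).frame F₇ (by decide)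
    have hr' : ∀ r, M₇.rreg r = M₅.rreg r := fun r => by rw [F₇.r r rfl, F₆.r r rfl]
    refine Spec.seq (dirStmt_spec hn hW i₇ hI hτ (Or.inl rec₇)) ?_
    rintro t₈ M₈ F₈ ⟨ht₈, rec₈, hle₈, -, hdir⟩
    have i₈ := i₇.frame F₈ (by decide)
    rw [hr'] at hdir hle₈
    rw [hr0] at hdir
    replace hdir := hdir hl0 hS.lt_one hst'.sortedAt
    have hr0' : M₈.rreg 0 = M.rreg 0 := by rw [F₈.r 0 (by decide), hr', hr0]
    have hr6' : M₈.rreg 6 = ll := by rw [F₈.r 6 (by decide), hr', hr6]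
    have hr7' : M₈.rreg 7 = lh := by rw [F₈.r 7 (by decide), hr', hr7]
    have hn12' : M₈.nreg 12 = M.nreg 12 := by
      rw [F₈.n 12 (by decide), F₇.n 12 (by decide), F₆.n 12 (by decide), hn12]
    have ha2' : M₈.narr 2 = M.narr 2 := by
      rw [F₈.na 2 (by decide), F₇.na 2 (by decide), F₆.na 2 (by decide), ha2]
    have ha3' : M₈.narr 3 = M₇.narr 3 := F₈.na 3 (by decide)
    have ha6' : M₈.narr 6 = M₄.narr 6 := by
      rw [F₈.na 6 (by decide), F₇.na 6 (by decide), F₆.na 6 (by decide), ha6]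
    rw [spec_ite]
    simp only [BExpr.Holds, NExpr.eval, m1]
    rcases hdir with ⟨h11', hex'⟩ | ⟨h11', hex'⟩
    · rw [if_neg (by omega)]
      refine Spec.seq (copyArr_spec (by decide) (by omega) i₈.n) ?_
      rintro t₉ M₉ F₉ ⟨ht₉, hc₉⟩
      have i₉ := i₈.frame F₉ (by decide)
      have rec₉ := rec₈.frame F₉ (by decide)
      simp only [spec_setR, RExpr.eval]
      have q0 : M₉.rreg 0 = M.rreg 0 := by rw [F₉.r 0 rfl, hr0']
      have q4 : M₉.rreg 4 = M₈.rreg 4 := F₉.r 4 rfl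
      refine ⟨by unfold sortTime at *; omega, τ, hi, M.rreg 0, lh,
        ⟨⟨i₉.n, i₉.a, i₉.b, i₉.w⟩, hτ.congr fun q hq => ?_, ?_, ?_,
        hS.inv.right hS.ll_le hS.le_lh hst', ?_, ?_, ?_, ?_, ?_, ?_, ?_⟩, by simp [q0],
        Or.inr (Or.inl ⟨?_, rfl, rfl, hS.inv.inverted_right hS.ll_le hS.le_lh hst'⟩)⟩
      · simp only [Memory.setR_narr]
        rw [hc₉ q hq, ha3']
      · simp only [Memory.setR_narr, F₉.na 2 (by decide), ha2']; exact hS.holds_hi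
      · simpa [HasRecord] using rec₉
      · simpa [q4] using hex'
      · simpa [q4] using hS.right.mono (hle₅.trans hle₈)
      · simp [q0]
      · simp [F₉.r 7 rfl, hr7']
      · simp [q0]
      · simp [q0, hS.le_lh]
      · simp [q0, hS.lt_one]
      · simp [F₉.n 12 (by decide), hn12']
    · rw [if_pos (by omega)]
      refine Spec.seq (copyArr_spec (by decide) (by omega) i₈.n) ?_
      rintro t₉ M₉ F₉ ⟨ht₉, hc₉⟩
      have i₉ := i₈.frame F₉ (by decide)
      have rec₉ := rec₈.frame F₉ (by decide)
      refine Spec.seq (copyArr_spec (by decide) (by omega) i₉.n) ?_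
      rintro t₁₀ M₁₀ F₁₀ ⟨ht₁₀, hc₁₀⟩
      have i₁₀ := i₉.frame F₁₀ (by decide)
      have rec₁₀ := rec₉.frame F₁₀ (by decide)
      simp only [spec_seq, spec_setR, spec_setN, RExpr.eval, NExpr.eval, m1]
      have q0 : M₁₀.rreg 0 = M.rreg 0 := by rw [F₁₀.r 0 rfl, F₉.r 0 rfl, hr0']
      have q4 : M₁₀.rreg 4 = M₈.rreg 4 := by rw [F₁₀.r 4 rfl, F₉.r 4 rfl]
      refine ⟨by unfold sortTime at *; omega, σ, τ, M.rreg 0, M.rreg 0,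
        ⟨⟨i₁₀.n, i₁₀.a, i₁₀.b, i₁₀.w⟩, hσ6.congr fun q hq => ?_, hτ.congr fun q hq => ?_, ?_,
        hS.inv.mid hS.ll_le hS.le_lh hst hst', ?_, ?_, ?_, ?_, ?_, ?_, ?_⟩, by simp [q0],
        Or.inr (Or.inr ⟨by simp, hst.sortedAt, hst'.sortedAt⟩)⟩
      · simp only [Memory.setR_narr, Memory.setN_narr]
        rw [F₁₀.na 1 (by decide), hc₉ q hq, ha6']
      · simp only [Memory.setR_narr, Memory.setN_narr]
        rw [hc₁₀ q hq, F₉.na 3 (by decide), ha3']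
      · simpa [HasRecord] using rec₁₀
      · simpa [q4] using hex.mono hle₈
      · simpa [q4] using hex'
      · simp [q0]
      · simp [q0]
      · simp [q0]
      · simp [q0]
      · simp [q0, hS.lt_one]
  · rw [if_pos (by omega)]
    refine Spec.seq (copyArr_spec (by decide) (by omega) i₅.n) ?_
    rintro t₆ M₆ F₆ ⟨ht₆, hc₆⟩
    have i₆ := i₅.frame F₆ (by decide)
    have rec₆ := rec₅.frame F₆ (by decide)
    simp only [spec_setR, RExpr.eval]
    have q0 : M₆.rreg 0 = M.rreg 0 := by rw [F₆.r 0 rfl, hr0]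
    have q4 : M₆.rreg 4 = M₅.rreg 4 := F₆.r 4 rfl
    refine ⟨by unfold sortTime at *; omega, lo, σ, ll, M.rreg 0,
      ⟨⟨i₆.n, i₆.a, i₆.b, i₆.w⟩, ?_, hσ6.congr fun q hq => ?_, ?_,
      inv₁, ?_, ?_, ?_, ?_, ?_, ?_, ?_⟩, by simp [q0],
      Or.inl ⟨?_, rfl, rfl, hS.inv.inverted_left hS.ll_le hS.le_lh hst⟩⟩
    · simp only [Memory.setR_narr, F₆.na 1 (by decide), ha1]; exact hS.holds_lo
    · simp only [Memory.setR_narr]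
      rw [hc₆ q hq, ha6]
    · simpa [HasRecord] using rec₆
    · simpa [q4] using hS.left.mono hle₅
    · simpa [q4] using hex
    · simp [F₆.r 6 rfl, hr6]
    · simp [q0]
    · simp [q0, hS.ll_le]
    · simp [q0]
    · simp [q0, hS.lt_one]
    · simp [F₆.n 12 (by decide), hn12]

/-- Set up the search. -/
def initStmt : Stmt :=
  .seq (.setR 4 (.app (.ofWord (.const 0)) (.ofWord (.const 0))))
  (.seq (.setR 0 (.ofWord (.const 0)))
  (.seq (forLoop 7 (.putN 3 (.reg 7) (.reg 7)))
  (.seq keyStmt (.seq sortStmt (.seq (copyArr 3 1) (.seq dirStmt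
  (.seq (.setR 0 (.ofWord (.const 1)))
  (.seq keyStmt (.seq sortStmt (.seq (copyArr 3 2)
  (.seq (.setR 0 (.ofWord (.const 0))) (.seq (.setR 6 (.ofWord (.const 0)))
  (.seq (.setR 7 (.ofWord (.const 1))) (.setN 12 (.const 0)))))))))))))))

/-- `lo` maximizes the first score, so its test excludes the left. `hi` maximizes the second score,
so it excludes the right vacuously, and no test at the weighting `1` is needed. -/
theorem initStmt_spec {M : Memory} (hn : 2 ≤ n) (hW : 8 * n + 8 ≤ W) (hI : IsInstance a b w f)
    (hM : Input a b w M) :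
    Spec W f initStmt M (fun t M' => t ≤ 4 * sortTime n + 200 ∧ M'.nreg 12 = 0 ∧ ∃ lo hi,
      Search a b w f lo hi 0 1 M') := by
  have m1 : 1 % W = 1 := Nat.mod_eq_of_lt (by omega)
  have hT := le_sortTime hn
  rw [initStmt]
  simp only [spec_seq (s₁ := .setR _ _), spec_setR, NExpr.eval, RExpr.eval, Nat.zero_mod,
    Nat.cast_zero]
  refine Spec.seq (Spec.for (n := n) (by decide) (fun q M' => ∀ p < q, M'.narr 3 p = p) 1
    (by omega) _ (by simp [hM.n]) (by simp) (by decide) ?_) ?_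
  · rintro q hq M' - hr h
    simp only [spec_putN, NExpr.eval, hr]
    refine ⟨le_rfl, fun p hp => ?_⟩
    rcases Nat.lt_succ_iff_lt_or_eq.1 hp with h1 | rfl
    · simp [Function.update_of_ne (show p ≠ q by omega), h p h1]
    · simp
  rintro t₁ M₁ F₁ ⟨ht₁, h3⟩
  have i₁ : Input a b w M₁ := (show Input a b w _ from ⟨by simp [hM.n], by simp [hM.a],
    by simp [hM.b], by simp [hM.w]⟩ : Input a b w ((M.setR 4 (f 0 0)).setR 0 0)).frame F₁ (by decide)
  have r₁ : M₁.rreg 0 = 0 := by rw [F₁.r 0 (by decide)]; simp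
  have r₁' : M₁.rreg 4 = f 0 0 := by rw [F₁.r 4 (by decide)]; simp
  refine Spec.seq (keyStmt_spec hW i₁) ?_
  rintro t₂ M₂ F₂ ⟨ht₂, hk₂⟩
  have i₂ := i₁.frame F₂ (by decide)
  have h3' : Holds (M₂.narr 3) (1 : Equiv.Perm (Fin n)) := fun j => by
    rw [F₂.na 3 (by decide), h3 j j.2]; rfl
  refine Spec.seq (sortStmt_spec_perm hW i₂.n h3') ?_
  rintro t₃ M₃ F₃ ⟨ht₃, lo, hlo, hst, -⟩
  have i₃ := i₂.frame F₃ (by decide)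
  replace hst : StableSort (key a b 0) 1 lo := hst.congr fun x => by rw [hk₂ x, r₁]
  refine Spec.seq (copyArr_spec (by decide) (by omega) i₃.n) ?_
  rintro t₄ M₄ F₄ ⟨ht₄, hc₄⟩
  have i₄ := i₃.frame F₄ (by decide)
  have hlo4 : Holds (M₄.narr 3) lo := by rw [F₄.na 3 (by decide)]; exact hlo
  have r₄ : M₄.rreg 4 = f 0 0 := by rw [F₄.r 4 rfl, F₃.r 4 rfl, F₂.r 4 rfl, r₁']
  refine Spec.seq (dirStmt_spec hn hW i₄ hI hlo4 (Or.inr r₄.le)) ?_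
  rintro t₅ M₅ F₅ ⟨ht₅, rec₅, -, hmax, -⟩
  have i₅ := i₄.frame F₅ (by decide)
  have hexL := hmax fun z => by
    have := hst.sortedAt.cumScore_le hI.w_antitone z
    simpa using this
  simp only [spec_seq (s₁ := .setR _ _), spec_setR, NExpr.eval, RExpr.eval, m1, Nat.cast_one]
  have i₆ : Input a b w (M₅.setR 0 1) := ⟨by simp [i₅.n], by simp [i₅.a], by simp [i₅.b],
    by simp [i₅.w]⟩
  refine Spec.seq (keyStmt_spec hW i₆) ?_
  rintro t₆ M₆ F₆ ⟨ht₆, hk₆⟩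
  have i₇ := i₆.frame F₆ (by decide)
  have hlo6 : Holds (M₆.narr 3) lo := by
    rw [F₆.na 3 (by decide)]
    simp only [Memory.setR_narr]
    rw [F₅.na 3 (by decide)]; exact hlo4
  refine Spec.seq (sortStmt_spec_perm hW i₇.n hlo6) ?_
  rintro t₇ M₇ F₇ ⟨ht₇, hi, hhi, hst', -⟩
  have i₈ := i₇.frame F₇ (by decide)
  replace hst' : StableSort (key a b 1) lo hi := hst'.congr fun x => by rw [hk₆ x]; simp
  refine Spec.seq (copyArr_spec (by decide) (by omega) i₈.n) ?_
  rintro t₈ M₈ F₈ ⟨ht₈, hc₈⟩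
  have i₉ := i₈.frame F₈ (by decide)
  simp only [spec_seq, spec_setR, spec_setN, NExpr.eval, RExpr.eval, m1, Nat.zero_mod,
    Nat.cast_zero, Nat.cast_one]
  have q4 : M₈.rreg 4 = M₅.rreg 4 := by
    rw [F₈.r 4 rfl, F₇.r 4 rfl, F₆.r 4 rfl]; simp
  have q0 : M₈.narr 0 = M₅.narr 0 := by
    rw [F₈.na 0 (by decide), F₇.na 0 (by decide), F₆.na 0 (by decide)]; simp
  have q1 : M₈.narr 1 = M₄.narr 1 := by
    rw [F₈.na 1 (by decide), F₇.na 1 (by decide), F₆.na 1 (by decide)]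
    simp only [Memory.setR_narr]
    rw [F₅.na 1 (by decide)]
  refine ⟨by unfold sortTime at *; omega, by simp, lo, hi, ⟨i₉.n, i₉.a, i₉.b, i₉.w⟩,
    hlo.congr fun q hq => ?_, hhi.congr fun q hq => ?_, ?_, SearchInv.init hst hst', ?_, ?_, ?_, ?_,
    ?_, ?_, ?_⟩
  · simp only [Memory.setR_narr, Memory.setN_narr]
    rw [q1, hc₄ q hq]
  · simp only [Memory.setR_narr, Memory.setN_narr]
    rw [hc₈ q hq]
  · simpa [HasRecord, q0, q4] using rec₅
  · simpa [q4] using hexL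
  · intro z hz
    have := hst'.sortedAt.cumScore_le hI.w_antitone z
    simp at this
    exact absurd hz (not_lt.2 this)
  all_goals simp

end Ranking

namespace Ranking
variable {W n : ℕ} {f : ℝ → ℝ → ℝ} {a b w : Fin n → ℝ}

/-! ### Counting and selecting inversions -/

/-- Store the number of inversions between `lo` and `hi` in word register `13`. -/
def countStmt : Stmt :=
  .seq rankKeyStmt (.seq (copyArr 1 3) (.seq sortStmt (.seq (.setN 13 (.const 0))
    (forLoop 7 (.setN 13 (.add (.reg 13) (.get 5 (.reg 7))))))))

open Classical in
theorem sum_card_inverted (lo hi : Equiv.Perm (Fin n)) :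
    ∑ x, (Finset.univ.filter fun y => Inverted lo hi y x).card = (inversions lo hi).card := by
  simp only [inversions, Finset.card_filter]
  rw [Fintype.sum_prod_type_right]

-- Sorting `lo` by the positions in `hi` reproduces `hi`, so the overtakings counted by merge sort
-- are the inversions. Their number may be quadratic, hence `hW'`.
open Classical in
theorem countStmt_spec {M : Memory} (hn : 2 ≤ n) (hW : 8 * n + 8 ≤ W) (hW' : n * n + n < W)
    (hM : M.nreg 0 = n) {lo hi : Equiv.Perm (Fin n)} (hlo : Holds (M.narr 1) lo)
    (hhi : Holds (M.narr 2) hi) :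
    Spec W f countStmt M (fun t M' => t ≤ 2 * sortTime n ∧
      M'.nreg 13 = (inversions lo hi).card ∧
      (∀ x : Fin n, M'.narr 5 x = (Finset.univ.filter fun y => Inverted lo hi y x).card) ∧
      ∀ x : Fin n, M'.rarr 3 x = ((n - hi.symm x : ℕ) : ℝ)) := by
  have hT := le_sortTime hn
  rw [countStmt]
  refine Spec.seq (rankKeyStmt_spec hW hM hhi) ?_
  rintro t₁ M₁ F₁ ⟨ht₁, hk⟩
  have n₁ : M₁.nreg 0 = n := by rw [F₁.n 0 (by decide), hM]
  refine Spec.seq (copyArr_spec (by decide) (by omega) n₁) ?_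
  rintro t₂ M₂ F₂ ⟨ht₂, hc⟩
  have n₂ : M₂.nreg 0 = n := by rw [F₂.n 0 (by decide), n₁]
  have h3 : Holds (M₂.narr 3) lo := hlo.congr fun q hq => by rw [hc q hq, F₁.na 1 (by decide)]
  refine Spec.seq (sortStmt_spec_perm hW n₂ h3) ?_
  rintro t₃ M₃ F₃ ⟨ht₃, σ, hσ, hst, hcnt⟩
  have n₃ : M₃.nreg 0 = n := by rw [F₃.n 0 (by decide), n₂]
  replace hst : StableSort (fun x => ((n - hi.symm x : ℕ) : ℝ)) lo σ :=
    hst.congr fun x => by rw [F₂.ra 3 (by decide), hk x]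
  have hσhi : σ = hi := by
    refine (eq_of_symm_lt fun x y hxy => (hst x y).2 (Or.inl ?_)).symm
    have := (hi.symm x).2
    have := (hi.symm y).2
    rw [Fin.lt_def] at hxy
    exact Nat.cast_lt.2 (by omega)
  subst hσhi
  have htotal : ∑ p ∈ Finset.range n, M₃.narr 5 p = (inversions lo σ).card := by
    rw [Finset.sum_range, ← sum_card_inverted]
    exact Finset.sum_congr rfl fun x _ => hcnt x
  have hle := card_inversions_le lo σ
  rw [spec_seq, spec_setN]
  simp only [NExpr.eval, Nat.zero_mod]
  refine (Spec.for (n := n) (by decide) (fun q M' => M'.narr = M₃.narr ∧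
    M'.nreg 13 = ∑ p ∈ Finset.range q, M₃.narr 5 p) 1 (by omega) _ (by simp [n₃]) (by simp)
    (by decide) ?_).mono ?_
  · rintro q hq M' - hr ⟨hna, h⟩
    have hsub : ∑ p ∈ Finset.range (q + 1), M₃.narr 5 p ≤ n * n := by
      refine le_trans (Finset.sum_le_sum_of_subset (Finset.range_subset_range.2 hq)) ?_
      omega
    simp only [spec_setN, NExpr.eval, hr, h, hna]
    refine ⟨le_rfl, by simp [hna], ?_⟩
    rw [Finset.sum_range_succ] at hsub ⊢
    simpa using Nat.mod_eq_of_lt (by omega)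
  · rintro t M' F ⟨ht, hna, h⟩
    refine ⟨by unfold sortTime at *; omega, by rw [h, htotal], fun x => by rw [hna, hcnt x],
      fun x => ?_⟩
    rw [F.ra 3 (by decide)]
    simp only [Memory.setN_rarr]
    rw [F₃.ra 3 (by decide), F₂.ra 3 (by decide), hk x]

/-- Set real register `0` to the crossing of the inversion whose number is in word register `14`. -/
def pickStmt : Stmt :=
  .seq (.setN 17 (.const 0))
  (.seq (forLoop 7 (.seq
    (.ite (.and (.nle (.reg 17) (.reg 14))
        (.nlt (.reg 14) (.add (.reg 17) (.get 5 (.reg 7)))))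
      (.seq (.setN 15 (.reg 7)) (.setN 18 (.sub (.reg 14) (.reg 17)))) .skip)
    (.setN 17 (.add (.reg 17) (.get 5 (.reg 7))))))
  (.seq (.setN 17 (.const 0))
  (.seq (forLoop 7 (.ite (.rlt (.get 3 (.get 1 (.reg 7))) (.get 3 (.reg 15)))
    (.seq (.ite (.and (.nle (.reg 17) (.reg 18)) (.nle (.reg 18) (.reg 17)))
      (.setN 16 (.get 1 (.reg 7))) .skip) (.setN 17 (.add (.reg 17) (.const 1)))) .skip))
  (.setR 0 (.div (.sub (.get 0 (.reg 16)) (.get 0 (.reg 15)))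
    (.add (.sub (.get 0 (.reg 16)) (.get 0 (.reg 15)))
      (.sub (.get 1 (.reg 15)) (.get 1 (.reg 16)))))))))

open Classical in
/-- The number of the inversion `(y, x)` in the enumeration used by `pickStmt`. -/
noncomputable def pickIndex (M : Memory) (lo : Equiv.Perm (Fin n)) (y x : Fin n) : ℕ :=
  ∑ p ∈ Finset.range x, M.narr 5 p +
    ((Finset.range (lo.symm y)).filter fun q => M.rarr 3 (M.narr 1 q) < M.rarr 3 x).card

-- Inversions are grouped by the item `x` that comes second in `lo`. Prefix sums of the counters
-- locate `x`, and the remaining offset selects its partner `y`. The equation with `pickIndex` shows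
-- that different numbers pick different inversions.
open Classical in
theorem pickStmt_spec {M : Memory} (hW : 8 * n + 8 ≤ W) (hW' : n * n + n < W)
    (hM : Input a b w M) {lo hi : Equiv.Perm (Fin n)} (hlo : Holds (M.narr 1) lo)
    (hcnt : ∀ x : Fin n, M.narr 5 x = (Finset.univ.filter fun y => Inverted lo hi y x).card)
    (hK : ∀ x : Fin n, M.rarr 3 x = ((n - hi.symm x : ℕ) : ℝ))
    (hk : M.nreg 14 < (inversions lo hi).card) :
    Spec W f pickStmt M (fun t M' => t ≤ 30 * n + 30 ∧ ∃ y x, Inverted lo hi y x ∧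
      M'.rreg 0 = crossing a b y x ∧ M.nreg 14 = pickIndex M lo y x) := by
  have m1 : 1 % W = 1 := Nat.mod_eq_of_lt (by omega)
  have htotal : ∑ p ∈ Finset.range n, M.narr 5 p = (inversions lo hi).card := by
    rw [Finset.sum_range, ← sum_card_inverted]
    exact Finset.sum_congr rfl fun x _ => hcnt x
  have hle := card_inversions_le lo hi
  have hsub : ∀ q < n, ∑ p ∈ Finset.range (q + 1), M.narr 5 p ≤ n * n := by
    intro q hq
    refine le_trans (Finset.sum_le_sum_of_subset (Finset.range_subset_range.2 hq)) ?_
    omega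
  have hKlt : ∀ y x : Fin n, M.rarr 3 y < M.rarr 3 x ↔ hi.symm x < hi.symm y := by
    intro y x
    rw [hK, hK, Nat.cast_lt, Fin.lt_def]
    have := (hi.symm x).2
    have := (hi.symm y).2
    omega
  rw [pickStmt, spec_seq, spec_setN]
  simp only [NExpr.eval, Nat.zero_mod]
  refine Spec.seq (Spec.for (n := n) (by decide) (fun q M' => M'.narr = M.narr ∧
    M'.nreg 14 = M.nreg 14 ∧ M'.nreg 17 = ∑ p ∈ Finset.range q, M.narr 5 p ∧
    (M.nreg 14 < ∑ p ∈ Finset.range q, M.narr 5 p → ∃ x < n, M'.nreg 15 = x ∧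
      ∑ p ∈ Finset.range x, M.narr 5 p + M'.nreg 18 = M.nreg 14 ∧ M'.nreg 18 < M.narr 5 x)) 8
    (by omega) _ (by simp [hM.n]) (by simp) (by decide) ?_) ?_
  · rintro q hq M' - hr ⟨hna, h14, h17, h⟩
    have hq' := hsub q hq
    rw [Finset.sum_range_succ] at hq'
    have hmod : (∑ p ∈ Finset.range q, M.narr 5 p + M.narr 5 q) % W =
      ∑ p ∈ Finset.range q, M.narr 5 p + M.narr 5 q := Nat.mod_eq_of_lt (by omega)
    simp only [spec_seq, spec_ite, spec_setN, spec_skip, BExpr.Holds, NExpr.eval, hr, h14, h17, hna,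
      hmod]
    split_ifs with hc
    · refine ⟨by omega, by simp [hna], by simp [h14], ?_, fun _ => ⟨q, hq, by simp, ?_, ?_⟩⟩
      · simpa [Finset.sum_range_succ, hr, h17, hna] using hmod
      · simp [h14, h17]; omega
      · simp [h14, h17]; omega
    · refine ⟨by omega, by simp [hna], by simp [h14], ?_, fun h' => ?_⟩
      · simp [Finset.sum_range_succ]
      · rw [Finset.sum_range_succ] at h'
        obtain ⟨x, hx, e1, e2, e3⟩ := h (by
          by_contra hh
          exact hc ⟨by omega, h'⟩)
        exact ⟨x, hx, by simp [e1], by simp [e2], by simp [e3]⟩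
  rintro t₁ M₁ F₁ ⟨ht₁, hna₁, -, -, hx⟩
  obtain ⟨x, hxn, e15, esum, elt⟩ := hx (by omega)
  have i₁ : Input a b w M₁ := ⟨by rw [F₁.n 0 (by decide)]; simp [hM.n],
    by rw [F₁.ra 0 (by decide)]; simp [hM.a], by rw [F₁.ra 1 (by decide)]; simp [hM.b],
    by rw [F₁.ra 2 (by decide)]; simp [hM.w]⟩
  have ra₁ : M₁.rarr = M.rarr := by
    funext r
    rw [F₁.ra r rfl]; simp
  rw [spec_seq, spec_setN]
  simp only [NExpr.eval, Nat.zero_mod]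
  set o := M₁.nreg 18 with ho
  let g : ℕ → ℕ := fun q =>
    ((Finset.range q).filter fun q => M.rarr 3 (M.narr 1 q) < M.rarr 3 x).card
  have hg_succ : ∀ q, g (q + 1) = g q + if M.rarr 3 (M.narr 1 q) < M.rarr 3 x then 1 else 0 := by
    intro q
    simp only [g, Finset.range_add_one, Finset.filter_insert]
    split_ifs
    · rw [Finset.card_insert_of_notMem (by simp)]
    · simp
  have hg_mono : Monotone g := monotone_nat_of_le_succ fun q => by rw [hg_succ]; omega
  have hg_le : ∀ q, g q ≤ q := fun q => (Finset.card_filter_le _ _).trans (by simp)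
  refine Spec.seq (Spec.for (n := n) (by decide) (fun q M' => M'.narr = M.narr ∧
    M'.rarr = M.rarr ∧ M'.nreg 15 = x ∧ M'.nreg 18 = o ∧ M'.nreg 17 = g q ∧
    (o < g q → ∃ q' < n, M'.nreg 16 = M.narr 1 q' ∧ M.rarr 3 (M.narr 1 q') < M.rarr 3 x ∧
      g q' = o)) 8 (by omega) _ (by simp [i₁.n]) ?_ (by decide) ?_) ?_
  · simp [hna₁, ra₁, e15, ← ho, g]
  · rintro q hq M' - hr ⟨hna, hra, h15, h18, h17, h⟩
    have hmod : (g q + 1) % W = g q + 1 := Nat.mod_eq_of_lt (by have := hg_le q; omega)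
    simp only [spec_seq, spec_ite, spec_setN, spec_skip, BExpr.Holds, NExpr.eval, RExpr.eval, hr,
      h15, h18, h17, hna, hra, m1]
    have hs := hg_succ q
    by_cases hc : M.rarr 3 (M.narr 1 q) < M.rarr 3 x
    · rw [if_pos hc] at hs
      simp only [hc, if_true]
      by_cases hc2 : g q ≤ o ∧ o ≤ g q
      · simp only [hc2, and_self, if_true]
        refine ⟨by omega, by simp [hna], by simp [hra], by simp [h15], by simp [h18], ?_,
          fun _ => ⟨q, hq, by simp, hc, by omega⟩⟩
        simp [hs, hmod, h17]
      · simp only [hc2, if_false]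
        refine ⟨by omega, by simp [hna], by simp [hra], by simp [h15], by simp [h18], ?_,
          fun h' => ?_⟩
        · simp [hs, hmod]
        · obtain ⟨q', hq', e1, e2, e3⟩ := h (by omega)
          exact ⟨q', hq', by simp [e1], e2, e3⟩
    · rw [if_neg hc, add_zero] at hs
      simp only [hc, if_false]
      refine ⟨by omega, by simp [hna], by simp [hra], by simp [h15], by simp [h18], ?_,
        fun h' => ?_⟩
      · simp [hs, h17]
      · obtain ⟨q', hq', e1, e2, e3⟩ := h (by omega)
        exact ⟨q', hq', by simp [e1], e2, e3⟩
  rintro t₂ M₂ F₂ ⟨ht₂, hna₂, hra₂, h15, -, -, hy⟩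
  -- the entries before `x` with smaller keys are the ones inverted with `x`
  set X : Fin n := ⟨x, hxn⟩ with hX
  have hgx : g (lo.symm X) = M.narr 5 x := by
    rw [show M.narr 5 x = M.narr 5 X from rfl, hcnt X, ← Finset.card_map Fin.valEmbedding]
    change ((Finset.range (lo.symm X)).filter fun q => M.rarr 3 (M.narr 1 q) < M.rarr 3 x).card = _
    rw [← Finset.card_image_of_injOn (s := (Finset.range (lo.symm X)).filter _)
        (f := M.narr 1)]
    · congr 1
      ext y
      simp only [Finset.mem_image, Finset.mem_filter, Finset.mem_range, Finset.mem_map,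
        Finset.mem_univ, true_and, Fin.valEmbedding_apply]
      constructor
      · rintro ⟨q, ⟨h1, h2⟩, rfl⟩
        have hq : q < n := h1.trans (lo.symm X).2
        have e : M.narr 1 q = lo ⟨q, hq⟩ := hlo ⟨q, hq⟩
        refine ⟨lo ⟨q, hq⟩, ⟨?_, ?_⟩, e.symm⟩
        · rw [Equiv.symm_apply_apply, Fin.lt_def]; exact h1
        · rw [e] at h2
          exact (hKlt _ X).1 h2
      · rintro ⟨y, ⟨h1, h2⟩, rfl⟩
        have e : M.narr 1 (lo.symm y) = y := by rw [hlo]; simp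
        exact ⟨lo.symm y, ⟨h1, by rw [e]; exact (hKlt y X).2 h2⟩, e⟩
    · intro p hp q hq e
      simp only [Finset.coe_filter, Finset.mem_range, Set.mem_ofPred_eq] at hp hq
      exact hlo.isRank.2 p (hp.1.trans (lo.symm X).2) q (hq.1.trans (lo.symm X).2) e
  -- The scan does not stop at `x`, but as many hits as `x` has inversions occur before it, and the
  -- offset is smaller than that.
  obtain ⟨q, hqn, e16, eK, egq⟩ := hy (by
    have := hg_mono (lo.symm X).2.le
    omega)
  have hqx : q < lo.symm X := by
    by_contra hh
    have := hg_mono (not_lt.1 hh)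
    omega
  set y : Fin n := lo ⟨q, hqn⟩ with hy
  have ey : M.narr 1 q = y := hlo ⟨q, hqn⟩
  have hsy : lo.symm y = ⟨q, hqn⟩ := by simp [hy]
  simp only [spec_setR, RExpr.eval, NExpr.eval, h15, e16, ey, hra₂]
  refine ⟨by omega, y, X, ⟨?_, ?_⟩, ?_, ?_⟩
  · rw [hsy, Fin.lt_def]; exact hqx
  · rw [ey] at eK
    exact (hKlt y X).1 eK
  · simp only [Memory.setR_rreg, if_true, crossing, hM.a, hM.b]
    rw [show (x : ℕ) = X from rfl]
    simp only [arrayOf_apply]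
  · rw [pickIndex, hsy, ← esum, ← egq]

end Ranking

namespace Ranking
variable {n : ℕ} {a b : Fin n → ℝ}

/-! ### A path of adjacent transpositions between two rankings -/

section Path

variable {lo hi : Equiv.Perm (Fin n)} {k : ℕ}

/-- The number of items before `y` in `lo` that have position at least `k` in `hi`. -/
def later (lo hi : Equiv.Perm (Fin n)) (k : ℕ) (y : Fin n) : ℕ :=
  (Finset.univ.filter fun z => k ≤ (hi.symm z : ℕ) ∧ lo.symm z < lo.symm y).card

theorem later_lt_later {y z : Fin n} (hy : k ≤ (hi.symm y : ℕ)) (h : lo.symm y < lo.symm z) :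
    later lo hi k y < later lo hi k z := by
  refine Finset.card_lt_card (Finset.ssubset_iff_of_subset ?_ |>.2 ⟨y, ?_, ?_⟩)
  · intro u
    simp only [Finset.mem_filter, Finset.mem_univ, true_and]
    exact fun hu => ⟨hu.1, hu.2.trans h⟩
  · simp [hy, h]
  · simp

theorem add_later_lt {y : Fin n} (hy : k ≤ (hi.symm y : ℕ)) : k + later lo hi k y < n := by
  have h1 : (Finset.univ.filter fun z => k ≤ (hi.symm z : ℕ)).card = n - k := by
    rw [Finset.card_filter, Equiv.sum_comp hi.symm (fun j : Fin n => if k ≤ (j : ℕ) then 1 else 0),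
      ← Finset.sum_range (fun j => if k ≤ j then 1 else 0), ← Finset.card_filter,
      show (Finset.range n).filter (k ≤ ·) = Finset.Ico k n by ext; simp; omega, Nat.card_Ico]
  have h2 : later lo hi k y < n - k := by
    rw [← h1]
    refine Finset.card_lt_card (Finset.ssubset_iff_of_subset ?_ |>.2 ⟨y, ?_, ?_⟩)
    · intro u
      simp only [Finset.mem_filter, Finset.mem_univ, true_and]
      exact fun hu => hu.1
    · simp [hy]
    · simp
  omega

theorem later_eq {x y : Fin n} (hx : (hi.symm x : ℕ) = k) :
    later lo hi k y = later lo hi (k + 1) y + if lo.symm x < lo.symm y then 1 else 0 := by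
  classical
  have h : (Finset.univ.filter fun z => k ≤ (hi.symm z : ℕ) ∧ lo.symm z < lo.symm y) =
      (Finset.univ.filter fun z => k + 1 ≤ (hi.symm z : ℕ) ∧ lo.symm z < lo.symm y) ∪
        if lo.symm x < lo.symm y then {x} else ∅ := by
    ext z
    have hz : (hi.symm z : ℕ) = k ↔ z = x := by
      rw [← hx]
      exact ⟨fun e => hi.symm.injective (Fin.ext e), fun e => by rw [e]⟩
    by_cases hzx : z = x
    · subst hzx
      split_ifs with h <;> simp [hx, h]
    · have : (hi.symm z : ℕ) ≠ k := fun e => hzx (hz.1 e)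
      split_ifs with h <;> simp [hzx] <;> omega
  rw [later, h, Finset.card_union_of_disjoint]
  · rw [later]
    split_ifs <;> simp
  · split_ifs
    · simp [hx]
    · simp

/-- The position of `y` in the ranking that starts with the first `k` items of `hi` and has the
remaining items in the order of `lo`. -/
def mergePos (lo hi : Equiv.Perm (Fin n)) (k : ℕ) (y : Fin n) : ℕ :=
  if (hi.symm y : ℕ) < k then hi.symm y else k + later lo hi k y

theorem mergePos_of_lt {y : Fin n} (h : (hi.symm y : ℕ) < k) : mergePos lo hi k y = hi.symm y :=
  if_pos h

theorem mergePos_of_le {y : Fin n} (h : k ≤ (hi.symm y : ℕ)) :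
    mergePos lo hi k y = k + later lo hi k y := if_neg (not_lt.2 h)

theorem mergePos_lt (y : Fin n) : mergePos lo hi k y < n := by
  rcases lt_or_ge (hi.symm y : ℕ) k with h | h
  · rw [mergePos_of_lt h]; exact (hi.symm y).2
  · rw [mergePos_of_le h]; exact add_later_lt h

theorem mergePos_injective :
    Function.Injective (fun y => (⟨mergePos lo hi k y, mergePos_lt y⟩ : Fin n)) := by
  intro y z e
  simp only [Fin.mk.injEq] at e
  rcases lt_or_ge (hi.symm y : ℕ) k with h | h <;> rcases lt_or_ge (hi.symm z : ℕ) k with h' | h'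
  · rw [mergePos_of_lt h, mergePos_of_lt h'] at e
    exact hi.symm.injective (Fin.ext e)
  · rw [mergePos_of_lt h, mergePos_of_le h'] at e; omega
  · rw [mergePos_of_le h, mergePos_of_lt h'] at e; omega
  · rw [mergePos_of_le h, mergePos_of_le h'] at e
    by_contra hne
    rcases symm_trichotomy lo hne with h1 | h1
    · have := later_lt_later h h1; omega
    · have := later_lt_later h' h1; omega

/-- The ranking that starts with the first `k` items of `hi` and has the remaining items in the
order of `lo`. -/
noncomputable def mergePerm (lo hi : Equiv.Perm (Fin n)) (k : ℕ) : Equiv.Perm (Fin n) :=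
  (Equiv.ofBijective _ (Finite.injective_iff_bijective.1
    (mergePos_injective (lo := lo) (hi := hi) (k := k)))).symm

theorem mergePerm_symm (y : Fin n) : ((mergePerm lo hi k).symm y : ℕ) = mergePos lo hi k y := rfl

theorem mergePerm_zero : mergePerm lo hi 0 = lo := by
  refine eq_of_symm_lt fun x y h => ?_
  rw [Fin.lt_def, mergePerm_symm, mergePerm_symm, mergePos_of_le (Nat.zero_le _),
    mergePos_of_le (Nat.zero_le _)] at h
  have hne : x ≠ y := by rintro rfl; exact lt_irrefl _ h
  refine (symm_trichotomy lo hne).resolve_right fun h' => ?_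
  have := later_lt_later (hi := hi) (k := 0) (Nat.zero_le _) h'
  omega

theorem mergePerm_last : mergePerm lo hi n = hi := by
  refine eq_of_symm_lt fun x y h => ?_
  rwa [Fin.lt_def, mergePerm_symm, mergePerm_symm, mergePos_of_lt (hi.symm x).2,
    mergePos_of_lt (hi.symm y).2, ← Fin.lt_def] at h

theorem holds_iff_symm {V : ℕ → ℕ} {π : Equiv.Perm (Fin n)} :
    Holds V π ↔ ∀ y : Fin n, V (π.symm y) = y :=
  ⟨fun h y => by rw [h]; simp, fun h j => by simpa using h (π j)⟩

/-- Passing from `k` to `k + 1` takes the next item of `hi` out of the part ordered by `lo` and puts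
it at position `k`; the items it passes move back by one. -/
theorem rot_mergePos_succ (hk : k < n) (y : Fin n) :
    rot k (mergePos lo hi k (hi ⟨k, hk⟩)) (mergePos lo hi (k + 1) y) = mergePos lo hi k y := by
  set x := hi ⟨k, hk⟩ with hx
  have hxk : (hi.symm x : ℕ) = k := by simp [hx]
  rw [mergePos_of_le hxk.ge]
  rcases lt_trichotomy (hi.symm y : ℕ) k with h | h | h
  · rw [mergePos_of_lt h, mergePos_of_lt (by omega), rot_of_lt h]
  · have : y = x := hi.symm.injective (Fin.ext (h.trans hxk.symm))
    subst this
    rw [mergePos_of_lt (by omega), mergePos_of_le (by omega), hxk, rot_self]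
  · rw [mergePos_of_le (show k + 1 ≤ _ by omega), mergePos_of_le h.le]
    have e := later_eq (lo := lo) (y := y) hxk
    have hne : x ≠ y := by rintro rfl; omega
    rcases symm_trichotomy lo hne with h1 | h1
    · have := later_lt_later hxk.ge h1
      rw [if_pos h1] at e
      rw [rot_of_gt (by omega) (by omega)]
      omega
    · have := later_lt_later h.le h1
      rw [if_neg h1.asymm] at e
      rw [rot_of_mem (by omega) (by omega)]
      omega

theorem holds_mergePerm_succ (hk : k < n) {V : ℕ → ℕ} (hV : Holds V (mergePerm lo hi k)) :
    Holds (fun r => V (rot k (mergePos lo hi k (hi ⟨k, hk⟩)) r)) (mergePerm lo hi (k + 1)) := by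
  rw [holds_iff_symm] at hV ⊢
  intro y
  rw [mergePerm_symm, rot_mergePos_succ]
  exact hV y

/-- `σ` is the ranking number `t` on a path of `n * n` steps from `lo` to `hi`. Ranking number
`k * n + o` arises from `mergePerm lo hi k` by moving the next item of `hi` ahead by up to `o`
positions. -/
def OnPath (lo hi : Equiv.Perm (Fin n)) (t : ℕ) (σ : Equiv.Perm (Fin n)) : Prop :=
  (∃ (k : ℕ) (hk : k < n) (o : ℕ) (V : ℕ → ℕ), o < n ∧ t = k * n + o ∧
    Holds V (mergePerm lo hi k) ∧
    Holds (fun r => V (rot (max k (mergePos lo hi k (hi ⟨k, hk⟩) - o))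
      (mergePos lo hi k (hi ⟨k, hk⟩)) r)) σ) ∨ t = n * n ∧ σ = hi

theorem exists_holds_perm (π : Equiv.Perm (Fin n)) : ∃ V, Holds V π :=
  ⟨fun r => if h : r < n then π ⟨r, h⟩ else 0, fun j => by simp⟩

theorem rot_same (k r : ℕ) : rot k k r = r := by
  unfold rot; split_ifs <;> omega

theorem le_mergePos (hk : k < n) : k ≤ mergePos lo hi k (hi ⟨k, hk⟩) := by
  rw [mergePos_of_le (by simp)]
  exact Nat.le_add_right _ _

theorem onPath_zero (hn : 0 < n) : OnPath lo hi 0 lo := by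
  obtain ⟨V, hV⟩ := exists_holds_perm lo
  refine Or.inl ⟨0, hn, 0, V, hn, by simp, by rwa [mergePerm_zero], ?_⟩
  simpa [rot_same] using hV

theorem onPath_last : OnPath lo hi (n * n) hi := Or.inr ⟨rfl, rfl⟩

theorem Holds.rot_congr {V V' : ℕ → ℕ} {π : Equiv.Perm (Fin n)} (h : Holds V π) (h' : Holds V' π)
    {e p : ℕ} (hp : p < n) (r : ℕ) (hr : r < n) : V (rot e p r) = V' (rot e p r) := by
  rw [h ⟨_, rot_lt hp hr⟩, h' ⟨_, rot_lt hp hr⟩]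

/-- For fixed `k` the next ranking moves the item one place further ahead, or not at all once it has
reached `k`. When `k` changes, the offset was `n - 1`, so the item has arrived and both descriptions
give the same ranking. -/
theorem OnPath.step {t : ℕ} {σ τ : Equiv.Perm (Fin n)} (h : OnPath lo hi t σ)
    (h' : OnPath lo hi (t + 1) τ) : τ = σ ∨ ∃ (i : ℕ) (hin : i + 1 < n),
      τ = σ * Equiv.swap ⟨i, Nat.lt_of_succ_lt hin⟩ ⟨i + 1, hin⟩ := by
  rcases h with ⟨k, hk, o, V, ho, rfl, hV, hσ⟩ | ⟨ht, -⟩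
  swap
  · rcases h' with ⟨k', hk', o', V', ho', e', -⟩ | ⟨e, -⟩
    · have : (k' + 1) * n ≤ n * n := Nat.mul_le_mul_right _ hk'
      rw [Nat.succ_mul] at this
      omega
    · omega
  set p := mergePos lo hi k (hi ⟨k, hk⟩) with hp
  have hpn : p < n := mergePos_lt _
  have hkp : k ≤ p := le_mergePos hk
  have hlast : n ≤ o + 1 → Holds (fun r => V (rot k p r)) τ → τ = σ := by
    intro h1 h2
    rw [show max k (p - o) = k by omega] at hσ
    exact h2.unique hσ
  rcases h' with ⟨k', hk', o', V', ho', e', hV', hτ⟩ | ⟨e', rfl⟩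
  · rcases lt_trichotomy k' k with h1 | rfl | h1
    · have : (k' + 1) * n ≤ k * n := Nat.mul_le_mul_right _ h1
      rw [Nat.succ_mul] at this
      omega
    · have ho1 : o' = o + 1 := by omega
      subst ho1
      replace hτ : Holds (fun r => V (rot (max k' (p - (o + 1))) p r)) τ :=
        hτ.congr fun r hr => hV.rot_congr hV' hpn r hr
      by_cases h2 : k' < p - o
      · rw [show max k' (p - (o + 1)) = p - o - 1 by omega] at hτ
        rw [show max k' (p - o) = p - o - 1 + 1 by omega] at hσ
        generalize he : p - o - 1 = e at hτ hσ
        have hen : e + 1 < n := by omega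
        refine Or.inr ⟨e, hen, hτ.unique fun r => ?_⟩
        have key : rot e p r = rot (e + 1) p
            (Equiv.swap (⟨e, Nat.lt_of_succ_lt hen⟩ : Fin n) ⟨e + 1, hen⟩ r : Fin n) := by
          rcases eq_or_ne r ⟨e, Nat.lt_of_succ_lt hen⟩ with rfl | h3
          · simp [rot]
          rcases eq_or_ne r ⟨e + 1, hen⟩ with rfl | h4
          · rw [Equiv.swap_apply_right]
            simp only [rot]; split_ifs <;> omega
          rw [Equiv.swap_apply_of_ne_of_ne h3 h4]
          rw [Ne, Fin.ext_iff] at h3 h4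
          simp only at h3 h4
          simp only [rot]; split_ifs <;> omega
        simp only [key]
        exact hσ _
      · left
        rw [show max k' (p - (o + 1)) = max k' (p - o) by omega] at hτ
        exact hτ.unique hσ
    · have h2 : k' = k + 1 ∧ o' = 0 ∧ n ≤ o + 1 := by
        have : (k + 1) * n ≤ k' * n := Nat.mul_le_mul_right _ h1
        rw [Nat.succ_mul] at this
        have h3 : k' = k + 1 := by
          by_contra hne
          have : (k + 2) * n ≤ k' * n := Nat.mul_le_mul_right _ (by omega)
          nlinarith
        subst h3
        rw [Nat.succ_mul] at e'
        omega
      obtain ⟨rfl, rfl, ho1⟩ := h2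
      left
      refine hlast ho1 ?_
      have := le_mergePos (lo := lo) (hi := hi) hk'
      rw [Nat.sub_zero, max_eq_right this] at hτ
      simp only [rot_same] at hτ
      rw [hτ.unique hV']
      exact holds_mergePerm_succ hk hV
  · have hk1 : k + 1 = n := by
      by_contra hne
      have : (k + 2) * n ≤ n * n := Nat.mul_le_mul_right _ (by omega)
      nlinarith
    left
    refine hlast ?_ ?_
    · subst hk1; rw [Nat.succ_mul] at e'; omega
    · have := holds_mergePerm_succ hk hV
      simp only [hk1, mergePerm_last] at this
      exact this

/-- Every pair stands in the order of `lo` or in that of `hi`, and both are sorted for `l`. -/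
theorem key_le_of_mergePerm {l : ℝ} (hlo : SortedAt a b l lo) (hhi : SortedAt a b l hi)
    {x y : Fin n} (h : mergePos lo hi k x < mergePos lo hi k y) :
    key a b l y ≤ key a b l x := by
  rcases lt_or_ge (hi.symm x : ℕ) k with hx | hx <;> rcases lt_or_ge (hi.symm y : ℕ) k with hy | hy
  · rw [mergePos_of_lt hx, mergePos_of_lt hy] at h
    exact hhi.key_le h
  · exact hhi.key_le (Fin.lt_def.2 (by omega))
  · rw [mergePos_of_le hx, mergePos_of_lt hy] at h; omega
  · rw [mergePos_of_le hx, mergePos_of_le hy] at h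
    have hne : x ≠ y := by rintro rfl; exact lt_irrefl _ h
    refine hlo.key_le ((symm_trichotomy lo hne).resolve_right fun h' => ?_)
    have := later_lt_later hy h'
    omega

theorem OnPath.sortedAt {l : ℝ} (hlo : SortedAt a b l lo) (hhi : SortedAt a b l hi) {t : ℕ}
    {σ : Equiv.Perm (Fin n)} (h : OnPath lo hi t σ) : SortedAt a b l σ := by
  rcases h with ⟨k, hk, o, V, ho, rfl, hV, hσ⟩ | ⟨-, rfl⟩
  swap
  · exact hhi
  set x := hi ⟨k, hk⟩ with hx
  set p := mergePos lo hi k x with hp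
  have hpn : p < n := mergePos_lt _
  have hkp : k ≤ p := le_mergePos hk
  have hpos : ∀ r : Fin n, mergePos lo hi k (σ r) = rot (max k (p - o)) p r := by
    intro r
    have e1 : (mergePerm lo hi k ⟨rot (max k (p - o)) p r, rot_lt hpn r.2⟩ : ℕ) = σ r := by
      rw [← hV, ← hσ r]
    rw [← mergePerm_symm, ← Fin.ext e1]
    simp
  intro i j hij
  rcases hij.eq_or_lt with rfl | hlt
  · exact le_rfl
  rw [Fin.lt_def] at hlt
  -- Only the moved item and an item that it passed change their order; the passed item comes later
  -- in `hi`.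
  by_cases hc : (i : ℕ) = max k (p - o) ∧ (j : ℕ) ≤ p
  · have hi' := hpos i
    have hj' := hpos j
    rw [hc.1, rot_self] at hi'
    rw [rot_of_mem (by omega) hc.2] at hj'
    have e : σ i = x := by
      have := mergePos_injective (lo := lo) (hi := hi) (k := k)
        (a₁ := σ i) (a₂ := x) (Fin.ext hi')
      exact this
    have hjk : k < (hi.symm (σ j) : ℕ) := by
      rcases lt_trichotomy (hi.symm (σ j) : ℕ) k with h1 | h1 | h1
      · rw [mergePos_of_lt h1] at hj'; omega
      · have : σ j = x := hi.symm.injective (Fin.ext (by simpa [hx] using h1))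
        rw [this] at hj'; omega
      · exact h1
    rw [e]
    refine hhi.key_le ?_
    rw [Fin.lt_def]
    simpa [hx] using hjk
  · refine key_le_of_mergePerm (k := k) hlo hhi ?_
    rw [hpos, hpos]
    unfold rot
    split_ifs <;> omega

end Path

end Ranking

namespace Ranking
variable {W n : ℕ} {f : ℝ → ℝ → ℝ} {a b w : Fin n → ℝ}

/-! ### The search among the rankings that are sorted for the same weighting -/

/-- Store the inverse of word array `2` in word array `7`. -/
def invStmt : Stmt := forLoop 7 (.putN 7 (.get 2 (.reg 7)) (.reg 7))

theorem invStmt_spec {M : Memory} (hW : 8 * n + 8 ≤ W) (hM : M.nreg 0 = n)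
    {π : Equiv.Perm (Fin n)} (hπ : Holds (M.narr 2) π) :
    Spec W f invStmt M (fun t M' => t ≤ 4 * n + 3 ∧ ∀ x : Fin n, M'.narr 7 x = π.symm x) := by
  refine (Spec.for (n := n) (by decide) (fun q M' => M'.narr 2 = M.narr 2 ∧
    ∀ j : Fin n, (j : ℕ) < q → M'.narr 7 (π j) = j) 1 (by omega) M hM
    (by simp) (by decide) ?_).mono ?_
  · rintro q hq M' h0 hr ⟨h2, h⟩
    simp only [spec_putN, NExpr.eval, hr, h2]
    refine ⟨le_rfl, by simp [h2], fun j hj => ?_⟩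
    rcases Nat.lt_succ_iff_lt_or_eq.1 hj with h1 | rfl
    · have : (π j : ℕ) ≠ M.narr 2 q := by
        rw [hπ ⟨q, hq⟩]
        intro e
        have := π.injective (Fin.ext e)
        rw [this] at h1
        exact lt_irrefl _ h1
      simp [Function.update_of_ne this, h j h1]
    · simp [hπ j]
  · rintro t M' - ⟨ht, -, h⟩
    refine ⟨by omega, fun x => ?_⟩
    have := h (π.symm x) (π.symm x).2
    simpa using this

/-- Store `mergePerm lo hi k` in word array `8` and the position of the next item of `hi` in word
register `26`, where `k` is in word register `23`. -/
def mergeStmt : Stmt :=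
  .seq (copyArr 2 8) (.seq (.setN 25 (.reg 23))
    (forLoop 7 (.ite (.nle (.reg 23) (.get 7 (.get 1 (.reg 7))))
      (.seq (.putN 8 (.reg 25) (.get 1 (.reg 7)))
      (.seq (.ite (.nle (.get 7 (.get 1 (.reg 7))) (.reg 23)) (.setN 26 (.reg 25)) .skip)
        (.setN 25 (.add (.reg 25) (.const 1))))) .skip)))

theorem card_filter_later_succ {lo hi : Equiv.Perm (Fin n)} {k q : ℕ} (hq : q < n) :
    (Finset.univ.filter fun z => k ≤ (hi.symm z : ℕ) ∧ (lo.symm z : ℕ) < q + 1).card =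
      (Finset.univ.filter fun z => k ≤ (hi.symm z : ℕ) ∧ (lo.symm z : ℕ) < q).card +
        if k ≤ (hi.symm (lo ⟨q, hq⟩) : ℕ) then 1 else 0 := by
  classical
  have hz : ∀ z, (lo.symm z : ℕ) = q ↔ z = lo ⟨q, hq⟩ := fun z => by
    rw [← Equiv.symm_apply_eq, Fin.ext_iff]
  have h : (Finset.univ.filter fun z => k ≤ (hi.symm z : ℕ) ∧ (lo.symm z : ℕ) < q + 1) =
      (Finset.univ.filter fun z => k ≤ (hi.symm z : ℕ) ∧ (lo.symm z : ℕ) < q) ∪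
        if k ≤ (hi.symm (lo ⟨q, hq⟩) : ℕ) then {lo ⟨q, hq⟩} else ∅ := by
    ext z
    by_cases hzx : z = lo ⟨q, hq⟩
    · subst hzx
      split_ifs with h <;> simp [h]
    · have : (lo.symm z : ℕ) ≠ q := fun e => hzx ((hz z).1 e)
      split_ifs with h <;> simp [hzx] <;> omega
  rw [h, Finset.card_union_of_disjoint]
  · split_ifs <;> simp
  · split_ifs <;> simp

/-- The copy of `hi` provides the first `k` places, and a single scan of `lo` appends the other
items. The inverse of `hi` in word array `7` decides in constant time which items these are. -/
theorem mergeStmt_spec {M : Memory} (hW : 8 * n + 8 ≤ W) (hM : M.nreg 0 = n)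
    {lo hi : Equiv.Perm (Fin n)} (hlo : Holds (M.narr 1) lo) (hhi : Holds (M.narr 2) hi)
    (hP : ∀ x : Fin n, M.narr 7 x = hi.symm x) {k : ℕ} (hk : k < n) (h23 : M.nreg 23 = k) :
    Spec W f mergeStmt M (fun t M' => t ≤ 14 * n + 10 ∧ Holds (M'.narr 8) (mergePerm lo hi k) ∧
      M'.nreg 26 = mergePos lo hi k (hi ⟨k, hk⟩)) := by
  have m1 : 1 % W = 1 := Nat.mod_eq_of_lt (by omega)
  rw [mergeStmt]
  refine Spec.seq (copyArr_spec (by decide) (by omega) hM) ?_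
  rintro t₁ M₁ F₁ ⟨ht₁, hc⟩
  rw [spec_seq, spec_setN]
  have h23' : M₁.nreg 23 = k := by rw [F₁.n 23 (by decide), h23]
  have ha1 : M₁.narr 1 = M.narr 1 := F₁.na 1 (by decide)
  have ha7 : M₁.narr 7 = M.narr 7 := F₁.na 7 (by decide)
  simp only [NExpr.eval, h23']
  refine (Spec.for (n := n) (by decide) (fun q M' => M'.narr 1 = M.narr 1 ∧
    M'.narr 7 = M.narr 7 ∧ M'.nreg 23 = k ∧ M'.nreg 25 =
      k + (Finset.univ.filter fun z => k ≤ (hi.symm z : ℕ) ∧ (lo.symm z : ℕ) < q).card ∧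
    (∀ y : Fin n, (hi.symm y : ℕ) < k ∨ (lo.symm y : ℕ) < q →
      M'.narr 8 (mergePos lo hi k y) = y) ∧
    ((lo.symm (hi ⟨k, hk⟩) : ℕ) < q → M'.nreg 26 = mergePos lo hi k (hi ⟨k, hk⟩))) 7 (by omega) _
    (by simp [F₁.n 0 rfl, hM]) ?_ (by decide) ?_).mono ?_
  · refine ⟨by simp [ha1], by simp [ha7], by simp [h23'], by simp, ?_, by simp⟩
    rintro y (hy | hy)
    · rw [mergePos_of_lt hy]
      simp [hc, hhi (hi.symm y)]
    · omega
  · rintro q hq M' - hr ⟨h1, h7, h23, h25, h8, h26⟩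
    set x := lo ⟨q, hq⟩ with hx
    have hxq : (lo.symm x : ℕ) = q := by simp [hx]
    have e1 : M.narr 1 q = x := hlo ⟨q, hq⟩
    have hpos : ∀ y, (mergePos lo hi k y = mergePos lo hi k x) → y = x := fun y e =>
      mergePos_injective (lo := lo) (hi := hi) (k := k) (Fin.ext e)
    have hlt : ∀ y : Fin n, (lo.symm y : ℕ) < q + 1 → (lo.symm y : ℕ) < q ∨ y = x := by
      intro y hy
      rcases Nat.lt_succ_iff_lt_or_eq.1 hy with h | h
      · exact Or.inl h
      · exact Or.inr (lo.symm.injective (Fin.ext (h.trans hxq.symm)))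
    have hs := card_filter_later_succ (lo := lo) (hi := hi) (k := k) hq
    rw [← hx] at hs
    simp only [Order.lt_add_one_iff (x := (_ : ℕ))] at hs
    simp only [spec_seq, spec_ite, spec_setN, spec_putN, spec_skip, BExpr.Holds, NExpr.eval, hr,
      h1, h7, e1, hP, h23, m1]
    by_cases hkx : k ≤ (hi.symm x : ℕ)
    · have hmp : mergePos lo hi k x =
          k + (Finset.univ.filter fun z => k ≤ (hi.symm z : ℕ) ∧ (lo.symm z : ℕ) < q).card := by
        rw [mergePos_of_le hkx, later]
        simp only [Fin.lt_def, hxq]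
      rw [if_pos hkx] at hs
      rw [← hmp] at h25
      have hxn : mergePos lo hi k x < n := mergePos_lt x
      have hmod : (mergePos lo hi k x + 1) % W = mergePos lo hi k x + 1 :=
        Nat.mod_eq_of_lt (by omega)
      have hnew : ∀ y : Fin n, (hi.symm y : ℕ) < k ∨ (lo.symm y : ℕ) < q + 1 →
          Function.update (M'.narr 8) (mergePos lo hi k x) x (mergePos lo hi k y) = y := by
        intro y hy
        by_cases hyx : y = x
        · rw [hyx, Function.update_self]
        · rw [Function.update_of_ne fun e => hyx (hpos y e)]
          exact h8 y (hy.imp_right fun hy => (hlt y hy).resolve_right hyx)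
      have hkk : (hi.symm x : ℕ) ≤ k ↔ hi ⟨k, hk⟩ = x := by
        constructor
        · intro h
          rw [← Equiv.eq_symm_apply]
          exact Fin.ext (by simp only; omega)
        · rintro h
          rw [← h]; simp
      rw [if_pos hkx]
      simp only [Memory.putN_narr, Memory.putN_nreg, if_neg (show (7 : ℕ) ≠ 8 by decide),
        if_neg (show (1 : ℕ) ≠ 8 by decide), h1, h7, hr, e1, hP, h23, hkk]
      split_ifs with hc
      · refine ⟨by omega, by simp [h1], by simp [h7], by simp [h23], ?_, ?_, ?_⟩
        · simp [h25, hmod]; omega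
        · simpa [h25] using hnew
        · simp [h25, hc]
      · refine ⟨by omega, by simp [h1], by simp [h7], by simp [h23], ?_, ?_, ?_⟩
        · simp [h25, hmod]; omega
        · simpa [h25] using hnew
        · intro h
          simpa using h26 ((hlt _ h).resolve_right hc)
    · rw [if_neg hkx, add_zero] at hs
      rw [if_neg hkx]
      refine ⟨by omega, by simp [h1], by simp [h7], by simp [h23], by simp [h25]; omega, ?_, ?_⟩
      · intro y hy
        refine h8 y ?_
        rcases hy with hy | hy
        · exact Or.inl hy
        · rcases hlt y hy with h | rfl
          · exact Or.inr h
          · exact Or.inl (not_le.1 hkx)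
      · intro h
        refine h26 ((hlt _ h).resolve_right fun e => hkx ?_)
        rw [← e]; simp
  · rintro t M' - ⟨ht, -, -, -, -, h8, h26⟩
    refine ⟨by omega, ?_, h26 (Fin.is_lt _)⟩
    rw [holds_iff_symm]
    exact fun y => h8 y (Or.inr (Fin.is_lt _))

/-- Store in word array `3` the ranking on the path from `lo` to `hi` whose number is in word
register `22`. -/
def pathStmt : Stmt :=
  .seq (.setN 23 (.div (.reg 22) (.reg 0)))
  (.seq (.setN 24 (.sub (.reg 22) (.mul (.reg 23) (.reg 0))))
  (.seq mergeStmt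
  (.seq (.ite (.nle (.sub (.reg 26) (.reg 24)) (.reg 23)) (.setN 28 (.reg 23))
    (.setN 28 (.sub (.reg 26) (.reg 24))))
  (forLoop 7 (.ite (.and (.nle (.reg 7) (.reg 28)) (.nle (.reg 28) (.reg 7)))
    (.putN 3 (.reg 7) (.get 8 (.reg 26)))
    (.ite (.and (.nlt (.reg 28) (.reg 7)) (.nle (.reg 7) (.reg 26)))
      (.putN 3 (.reg 7) (.get 8 (.sub (.reg 7) (.const 1))))
      (.putN 3 (.reg 7) (.get 8 (.reg 7)))))))))

/-- The number `t` splits into `k = t / n` and `o = t % n`, and the rotation is applied while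
copying. So any ranking of the path is reached directly in linear time. -/
theorem pathStmt_spec {M : Memory} (hW : 8 * n + 8 ≤ W) (hW' : n * n + n < W) (hM : M.nreg 0 = n)
    {lo hi : Equiv.Perm (Fin n)} (hlo : Holds (M.narr 1) lo) (hhi : Holds (M.narr 2) hi)
    (hP : ∀ x : Fin n, M.narr 7 x = hi.symm x) {t : ℕ} (ht : t < n * n) (h22 : M.nreg 22 = t) :
    Spec W f pathStmt M (fun T M' => T ≤ 20 * n + 30 ∧
      ∃ σ, OnPath lo hi t σ ∧ Holds (M'.narr 3) σ) := by
  have m1 : 1 % W = 1 := Nat.mod_eq_of_lt (by omega)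
  have hn : 0 < n := Nat.pos_of_ne_zero (by rintro rfl; omega)
  have hk : t / n < n := Nat.div_lt_of_lt_mul ht
  have hmod := Nat.div_add_mod t n
  have hlt := Nat.mod_lt t hn
  have hmul : t / n * n % W = t / n * n := Nat.mod_eq_of_lt (by rw [mul_comm]; omega)
  have hsub : t - t / n * n = t % n := by rw [mul_comm]; omega
  rw [pathStmt]
  simp only [spec_seq (s₁ := .setN _ _), spec_setN, NExpr.eval, Memory.setN_nreg]
  simp only [hM, h22, if_true, if_neg (show (22 : ℕ) ≠ 23 by decide),
    if_neg (show (0 : ℕ) ≠ 23 by decide), hmul, hsub]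
  refine Spec.seq (mergeStmt_spec (lo := lo) (hi := hi) (k := t / n) hW (by simp [hM]) (by simpa)
    (by simpa) (by simpa) hk (by simp)) ?_
  rintro t₁ M₁ F₁ ⟨ht₁, h8, h26⟩
  have h0 : M₁.nreg 0 = n := by rw [F₁.n 0 (by decide)]; simp [hM]
  have h23 : M₁.nreg 23 = t / n := by rw [F₁.n 23 (by decide)]; simp
  have h24 : M₁.nreg 24 = t % n := by rw [F₁.n 24 (by decide)]; simp
  set p := mergePos lo hi (t / n) (hi ⟨t / n, hk⟩) with hp
  have hpn : p < n := mergePos_lt _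
  have hkp : t / n ≤ p := le_mergePos hk
  set e := max (t / n) (p - t % n) with he
  obtain ⟨σ, hσ⟩ := (h8.isRank.rot (o := e) (k := p) (by omega) hpn).exists_holds
  refine Spec.seq (P := fun T M' => T = 2 ∧ M'.nreg 28 = e) ?_ ?_
  · simp only [spec_ite, spec_setN, BExpr.Holds, NExpr.eval, h23, h24, h26]
    split_ifs with hc
    · simp; omega
    · simp; omega
  rintro t₂ M₂ F₂ ⟨rfl, h28⟩
  have h26' : M₂.nreg 26 = p := by rw [F₂.n 26 (by decide), h26]
  have h8' : M₂.narr 8 = M₁.narr 8 := F₂.na 8 (by decide)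
  refine (Spec.for (n := n) (by decide) (fun q M' => M'.narr 8 = M₁.narr 8 ∧ M'.nreg 26 = p ∧
    M'.nreg 28 = e ∧ ∀ r < q, M'.narr 3 r = M₁.narr 8 (rot e p r)) 3 (by omega) _
    (by rw [F₂.n 0 (by decide), h0]) (by simp [h8', h26', h28]) (by decide) ?_).mono ?_
  · rintro q hq M' - hr ⟨h8, h26, h28, h⟩
    have hupd : ∀ v, v = M₁.narr 8 (rot e p q) → ∀ r < q + 1,
        Function.update (M'.narr 3) q v r = M₁.narr 8 (rot e p r) := by
      intro v hv r hr
      rcases Nat.lt_succ_iff_lt_or_eq.1 hr with h1 | rfl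
      · rw [Function.update_of_ne h1.ne, h r h1]
      · rw [Function.update_self, hv]
    simp only [spec_ite, spec_putN, BExpr.Holds, NExpr.eval, hr, h26, h28, h8, m1]
    split_ifs with h1 h2
    · refine ⟨by omega, by simp [h8], by simp [h26], by simp [h28], ?_⟩
      simpa using hupd _ (by rw [show q = e by omega, rot_self])
    · refine ⟨by omega, by simp [h8], by simp [h26], by simp [h28], ?_⟩
      simpa using hupd _ (by rw [rot_of_mem h2.1 h2.2])
    · refine ⟨by omega, by simp [h8], by simp [h26], by simp [h28], ?_⟩
      simpa using hupd _ (by unfold rot; split_ifs <;> omega)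
  · rintro T M' - ⟨hT, -, -, -, h⟩
    refine ⟨by omega, σ, Or.inl ⟨t / n, hk, t % n, M₁.narr 8, hlt, by rw [mul_comm]; omega, h8, hσ⟩,
      hσ.congr h⟩

/-- Bisect the path between two rankings that are sorted for the same weighting. -/
def bisectStmt : Stmt :=
  .seq invStmt (.seq (.setN 20 (.const 0)) (.seq (.setN 21 (.mul (.reg 0) (.reg 0)))
  (.while (.nlt (.add (.reg 20) (.const 1)) (.reg 21))
    (.seq (.setN 22 (.div (.add (.reg 20) (.reg 21)) (.const 2)))
    (.seq pathStmt (.seq dirStmt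
    (.ite (.nlt (.reg 11) (.const 1)) (.setN 21 (.reg 22)) (.setN 20 (.reg 22)))))))))

/-- A good ranking is stored in word array `0`. -/
def Solved (a b w : Fin n → ℝ) (f : ℝ → ℝ → ℝ) (M : Memory) : Prop :=
  ∃ π : Equiv.Perm (Fin n), Holds (M.narr 0) π ∧ IsGood a b w f π

theorem HasRecord.solved {M : Memory} (h : HasRecord a b w f M)
    (hz : ∀ z, combined f w a b z ≤ M.rreg 4) : Solved a b w f M := by
  obtain ⟨π, i, hi, hπ, e⟩ := h
  exact ⟨π, hπ, i, hi, by rw [e]; exact Finset.sup'_le _ _ fun z _ => hz z⟩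

/-- A bound for the running time of `bisectStmt`. -/
def bisectTime (n : ℕ) : ℕ := 2 * Nat.size n * (41 * n + 100) + 4 * n + 10

/-- The binary search maintains a ranking that excludes the left and a later one that excludes the
right. Every test allows one of them to be replaced, so no monotonicity of the tests along the path
is needed. The end is a single step of the path. -/
theorem bisectStmt_spec {M : Memory} (hn : 2 ≤ n) (hW : 8 * n + 8 ≤ W) (hW' : 2 * (n * n) + n < W)
    (hI : IsInstance a b w f) {lo hi : Equiv.Perm (Fin n)} {ll lh : ℝ}
    (hS : Search a b w f lo hi ll lh M) (hlo : SortedAt a b (M.rreg 0) lo)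
    (hhi : SortedAt a b (M.rreg 0) hi) :
    Spec W f bisectStmt M (fun t M' => t ≤ bisectTime n ∧ Solved a b w f M') := by
  have m0 : 0 % W = 0 := Nat.zero_mod _
  have m1 : 1 % W = 1 := Nat.mod_eq_of_lt (by omega)
  have m2 : 2 % W = 2 := Nat.mod_eq_of_lt (by omega)
  have mn : n * n % W = n * n := Nat.mod_eq_of_lt (by omega)
  have hl0 : 0 ≤ M.rreg 0 := hS.inv.nonneg.trans hS.ll_le
  have hnn : n * n ≤ 2 ^ (2 * Nat.size n) := by
    have := (Nat.lt_size_self n).le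
    rw [two_mul, pow_add]
    exact Nat.mul_le_mul this this
  rw [bisectStmt]
  refine Spec.seq (invStmt_spec hW hS.input.n hS.holds_hi) ?_
  rintro t₁ M₁ F₁ ⟨ht₁, hP⟩
  have i₁ := hS.input.frame F₁ (by decide)
  have rec₁ := hS.record.frame F₁ (by decide)
  simp only [spec_seq (s₁ := .setN _ _), spec_setN, NExpr.eval, Memory.setN_nreg]
  simp only [if_neg (show (0 : ℕ) ≠ 20 by decide), i₁.n, m0, mn]
  refine (Spec.while (fun j M' => Input a b w M' ∧ HasRecord a b w f M' ∧
    M'.rreg 0 = M.rreg 0 ∧ Holds (M'.narr 1) lo ∧ Holds (M'.narr 2) hi ∧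
    (∀ x : Fin n, M'.narr 7 x = hi.symm x) ∧ ∃ tl tr σ τ, M'.nreg 20 = tl ∧ M'.nreg 21 = tr ∧
      tl < tr ∧ tr ≤ n * n ∧ tr - tl ≤ 2 ^ j ∧ OnPath lo hi tl σ ∧ OnPath lo hi tr τ ∧
      ExcludesLeft a b w f (M'.rreg 4) σ ∧ ExcludesRight a b w f (M'.rreg 4) τ)
    (41 * n + 90) ?_ (2 * Nat.size n) _ ?_).mono ?_
  · rintro j M' ⟨hin, hrec, h0, h1, h2, h7, tl, tr, σ, τ, h20, h21, hlt, hle, hj, hσ, hτ, hL, hR⟩ hh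
    have ml : (tl + 1) % W = tl + 1 := Nat.mod_eq_of_lt (by omega)
    have ms : (tl + tr) % W = tl + tr := Nat.mod_eq_of_lt (by omega)
    simp only [BExpr.Holds, NExpr.eval, h20, h21, m1, ml] at hh
    obtain ⟨i, rfl⟩ : ∃ i, j = i + 1 := ⟨j - 1, by
      rcases j with _ | j
      · simp at hj; omega
      · omega⟩
    rw [pow_succ] at hj
    refine ⟨i, by omega, ?_⟩
    rw [spec_seq, spec_setN]
    simp only [NExpr.eval, h20, h21, ms, m2]
    have hm1 : tl < (tl + tr) / 2 := by omega
    have hm2 : (tl + tr) / 2 < tr := by omega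
    have hm3 : (tl + tr) / 2 - tl ≤ 2 ^ i := by omega
    have hm4 : tr - (tl + tr) / 2 ≤ 2 ^ i := by omega
    generalize (tl + tr) / 2 = m at hm1 hm2 hm3 hm4
    refine Spec.seq (pathStmt_spec (lo := lo) (hi := hi) (t := m) hW (by omega) (by simp [hin.n])
      (by simpa) (by simpa) (by simpa) (by omega) (by simp)) ?_
    rintro t₂ M₂ F₂ ⟨ht₂, ρ, hρ, h3⟩
    have i₂ : Input a b w M₂ := by
      refine Input.frame ?_ F₂ (by decide)
      exact ⟨by simp [hin.n], hin.a, hin.b, hin.w⟩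
    have rec₂ : HasRecord a b w f M₂ := HasRecord.frame (M := M'.setN 22 m) hrec F₂ (by decide)
    have e0 : M₂.rreg 0 = M.rreg 0 := by rw [F₂.r 0 (by decide)]; simp [h0]
    refine Spec.seq (dirStmt_spec hn hW i₂ hI h3 (Or.inl rec₂)) ?_
    rintro t₃ M₃ F₃ ⟨ht₃, rec₃, hle₃, -, hdir⟩
    have i₃ := i₂.frame F₃ (by decide)
    replace hdir := hdir (by rwa [e0]) (by rw [e0]; exact hS.lt_one)
      (by rw [e0]; exact hρ.sortedAt hlo hhi)
    have e4 : M'.rreg 4 ≤ M₃.rreg 4 := by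
      refine le_trans (le_of_eq ?_) hle₃
      rw [F₂.r 4 (by decide)]; simp
    have f0 : M₃.rreg 0 = M.rreg 0 := by rw [F₃.r 0 (by decide), e0]
    have f1 : Holds (M₃.narr 1) lo := by
      rw [F₃.na 1 (by decide), F₂.na 1 (by decide)]; exact h1
    have f2 : Holds (M₃.narr 2) hi := by
      rw [F₃.na 2 (by decide), F₂.na 2 (by decide)]; exact h2
    have f7 : M₃.narr 7 = M'.narr 7 := by
      rw [F₃.na 7 (by decide), F₂.na 7 (by decide)]; rfl
    have f20 : M₃.nreg 20 = tl := by
      rw [F₃.n 20 (by decide), F₂.n 20 (by decide)]; simp [h20]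
    have f21 : M₃.nreg 21 = tr := by
      rw [F₃.n 21 (by decide), F₂.n 21 (by decide)]; simp [h21]
    have f22 : M₃.nreg 22 = m := by
      rw [F₃.n 22 (by decide), F₂.n 22 (by decide)]; simp
    simp only [spec_ite, spec_setN, BExpr.Holds, NExpr.eval, f22, m1]
    rcases hdir with ⟨h11, hex⟩ | ⟨h11, hex⟩
    · rw [if_neg (by omega)]
      refine ⟨by omega, ⟨by simp [i₃.n], i₃.a, i₃.b, i₃.w⟩, rec₃, f0, f1, f2, by simp [f7, h7],
        m, tr, ρ, τ, by simp, by simp [f21], hm2, hle, hm4, hρ, hτ, hex, hR.mono e4⟩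
    · rw [if_pos (by omega)]
      refine ⟨by omega, ⟨by simp [i₃.n], i₃.a, i₃.b, i₃.w⟩, rec₃, f0, f1, f2, by simp [f7, h7],
        tl, m, σ, ρ, by simp [f20], by simp, hm1, by omega, hm3, hσ, hρ, hL.mono e4, hex⟩
  · refine ⟨⟨by simp [i₁.n], i₁.a, i₁.b, i₁.w⟩, rec₁, ?_, ?_, ?_, hP,
      0, n * n, lo, hi, by simp, by simp, by positivity, le_rfl, by simpa using hnn,
      onPath_zero (by omega), onPath_last, ?_, ?_⟩
    · rw [← F₁.r 0 (by decide)]; rfl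
    · simp only [Memory.setN_narr]; rw [F₁.na 1 (by decide)]; exact hS.holds_lo
    · simp only [Memory.setN_narr]; rw [F₁.na 2 (by decide)]; exact hS.holds_hi
    · simp only [Memory.setN_rreg]; rw [F₁.r 4 (by decide)]; exact hS.left
    · simp only [Memory.setN_rreg]; rw [F₁.r 4 (by decide)]; exact hS.right
  · rintro t M' - ⟨ht, ⟨j, hin, hrec, h0, h1, h2, h7, tl, tr, σ, τ, h20, h21, hlt, hle, hj, hσ, hτ,
      hL, hR⟩, hh⟩
    have ml : (tl + 1) % W = tl + 1 := Nat.mod_eq_of_lt (by omega)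
    simp only [BExpr.Holds, NExpr.eval, h20, h21, m1, ml] at hh
    refine ⟨?_, hrec.solved fun z => ?_⟩
    · unfold bisectTime
      have : 2 * n.size * (41 * n + 90 + 1) ≤ 2 * n.size * (41 * n + 100) :=
        Nat.mul_le_mul_left _ (by omega)
      omega
    · obtain rfl : tr = tl + 1 := by omega
      rcases hσ.step hτ with rfl | ⟨i, hi, rfl⟩
      · exact combined_le_of_excludes hn hI hL hR z
      · exact combined_le_of_adjacent hI hL hR hi rfl z

end Ranking

namespace Ranking
variable {W n : ℕ} {f : ℝ → ℝ → ℝ} {a b w : Fin n → ℝ}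

/-! ### Rounds at the crossing of a selected inversion -/

theorem Search.frame {lo hi : Equiv.Perm (Fin n)} {ll lh : ℝ} {M M' : Memory} {s : Stmt}
    (h : Search a b w f lo hi ll lh M) (hF : Frame s M M')
    (hs : s.writesN 0 = false ∧ s.writesRA 0 = false ∧ s.writesRA 1 = false ∧
      s.writesRA 2 = false) (hr : s.writesR 4 = false ∧ s.writesR 6 = false ∧ s.writesR 7 = false)
    (ha : s.writesNA 0 = false ∧ s.writesNA 1 = false ∧ s.writesNA 2 = false)
    (h1 : ll ≤ M'.rreg 0) (h2 : M'.rreg 0 ≤ lh) (h3 : M'.rreg 0 < 1) :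
    Search a b w f lo hi ll lh M' where
  input := h.input.frame hF hs
  holds_lo := by rw [hF.na 1 ha.2.1]; exact h.holds_lo
  holds_hi := by rw [hF.na 2 ha.2.2]; exact h.holds_hi
  record := h.record.frame hF ⟨ha.1, hr.1⟩
  inv := h.inv
  left := by rw [hF.r 4 hr.1]; exact h.left
  right := by rw [hF.r 4 hr.1]; exact h.right
  reg_ll := by rw [hF.r 6 hr.2.1]; exact h.reg_ll
  reg_lh := by rw [hF.r 7 hr.2.2]; exact h.reg_lh
  ll_le := h1
  le_lh := h2
  lt_one := h3

theorem Search.frame' {lo hi : Equiv.Perm (Fin n)} {ll lh : ℝ} {M M' : Memory} {s : Stmt}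
    (h : Search a b w f lo hi ll lh M) (hF : Frame s M M')
    (hs : s.writesN 0 = false ∧ s.writesRA 0 = false ∧ s.writesRA 1 = false ∧
      s.writesRA 2 = false) (hr : s.writesR 4 = false ∧ s.writesR 6 = false ∧ s.writesR 7 = false)
    (ha : s.writesNA 0 = false ∧ s.writesNA 1 = false ∧ s.writesNA 2 = false)
    (h0 : s.writesR 0 = false) : Search a b w f lo hi ll lh M' :=
  h.frame hF hs hr ha (by rw [hF.r 0 h0]; exact h.ll_le) (by rw [hF.r 0 h0]; exact h.le_lh)
    (by rw [hF.r 0 h0]; exact h.lt_one)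

open Classical in
/-- The auxiliary arrays of `countStmt` are in place. -/
structure Counted (lo hi : Equiv.Perm (Fin n)) (M : Memory) : Prop where
  total : M.nreg 13 = (inversions lo hi).card
  count : ∀ x : Fin n, M.narr 5 x = (Finset.univ.filter fun y => Inverted lo hi y x).card
  rank : ∀ x : Fin n, M.rarr 3 x = ((n - hi.symm x : ℕ) : ℝ)

/-- One round at the crossing of the inversion whose number is in word register `14`. -/
def pickRoundStmt : Stmt := .seq pickStmt roundStmt

theorem pickRoundStmt_spec {M : Memory} (hn : 2 ≤ n) (hW : 8 * n + 8 ≤ W) (hW' : n * n + n < W)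
    (hI : IsInstance a b w f) {lo hi : Equiv.Perm (Fin n)} {ll lh : ℝ}
    (hS : Search a b w f lo hi ll lh M) (hC : Counted lo hi M)
    (hk : M.nreg 14 < (inversions lo hi).card) :
    Spec W f pickRoundStmt M (fun t M' => t ≤ 5 * sortTime n + 240 ∧ ∃ y x lo' hi' ll' lh',
      Inverted lo hi y x ∧ M.nreg 14 = pickIndex M lo y x ∧ M'.rreg 0 = crossing a b y x ∧
      Search a b w f lo' hi' ll' lh' M' ∧
      (M'.nreg 12 = M.nreg 12 ∧ (∀ u v, Inverted lo' hi' u v ↔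
          Inverted lo hi u v ∧ crossing a b u v < crossing a b y x) ∨
        M'.nreg 12 = M.nreg 12 ∧ (∀ u v, Inverted lo' hi' u v ↔
          Inverted lo hi u v ∧ crossing a b y x < crossing a b u v) ∨
        M'.nreg 12 = 1 ∧ SortedAt a b (M'.rreg 0) lo' ∧ SortedAt a b (M'.rreg 0) hi')) := by
  have hT := le_sortTime hn
  rw [pickRoundStmt]
  refine Spec.seq (pickStmt_spec hW hW' hS.input hS.holds_lo hC.count hC.rank hk) ?_
  rintro t₁ M₁ F₁ ⟨ht₁, y, x, hyx, h0, hidx⟩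
  have hmem := hS.inv.crossing_mem hyx
  have S₁ := hS.frame F₁ (by decide) (by decide) (by decide) (by rw [h0]; exact hmem.1)
    (by rw [h0]; exact hmem.2) (by rw [h0]; exact crossing_lt_one (hS.inv.inv y x hyx))
  have h12 : M₁.nreg 12 = M.nreg 12 := F₁.n 12 (by decide)
  refine (roundStmt_spec hn hW hI S₁).mono ?_
  rintro t₂ M₂ F₂ ⟨ht₂, lo', hi', ll', lh', S₂, e0, hout⟩
  refine ⟨by omega, y, x, lo', hi', ll', lh', hyx, hidx, e0.trans h0, S₂, ?_⟩
  rw [e0, ← h12, ← h0]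
  rcases hout with ⟨h1, -, -, h2⟩ | ⟨h1, -, -, h2⟩ | h1
  · exact Or.inl ⟨h1, h2⟩
  · exact Or.inr (Or.inl ⟨h1, h2⟩)
  · exact Or.inr (Or.inr h1)

/-- The invariant of the randomized search. -/
def LoopInv (a b w : Fin n → ℝ) (f : ℝ → ℝ → ℝ) (M : Memory) : Prop :=
  ∃ lo hi ll lh, Search a b w f lo hi ll lh M ∧ (M.nreg 12 = 0 ∧ Counted lo hi M ∨
    M.nreg 12 = 1 ∧ SortedAt a b (M.rreg 0) lo ∧ SortedAt a b (M.rreg 0) hi)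

/-- The number of inversions that are left. -/
def pending (M : Memory) : ℕ := if M.nreg 12 = 0 then M.nreg 13 else 0

theorem countStmt_loopInv {M : Memory} (hn : 2 ≤ n) (hW : 8 * n + 8 ≤ W) (hW' : n * n + n < W)
    {lo hi : Equiv.Perm (Fin n)} {ll lh : ℝ} (hS : Search a b w f lo hi ll lh M)
    (h12 : M.nreg 12 = 0 ∨ M.nreg 12 = 1 ∧ SortedAt a b (M.rreg 0) lo ∧
      SortedAt a b (M.rreg 0) hi) :
    Spec W f countStmt M (fun t M' => t ≤ 2 * sortTime n ∧ LoopInv a b w f M' ∧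
      pending M' = if M.nreg 12 = 0 then (inversions lo hi).card else 0) := by
  refine (countStmt_spec hn hW hW' hS.input.n hS.holds_lo hS.holds_hi).mono ?_
  rintro t M' F ⟨ht, h13, hc, hk⟩
  have S' := hS.frame' F (by decide) (by decide) (by decide) (by decide)
  have e12 : M'.nreg 12 = M.nreg 12 := F.n 12 (by decide)
  have e0 : M'.rreg 0 = M.rreg 0 := F.r 0 (by decide)
  refine ⟨ht, ⟨lo, hi, ll, lh, S', ?_⟩, by rw [pending, e12, h13]⟩
  rw [e12, e0]
  exact h12.imp_left fun h => ⟨h, h13, hc, hk⟩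

/-- The loop body of the randomized search after the random draw. -/
def drawnStmt : Stmt := .seq pickRoundStmt countStmt

/-- As many elements of `I` as it has, with distinct indices, exhaust `I`. Thus a uniform number
amounts to a uniform inversion, and injectivity of `idx` need not be proved. -/
theorem exists_enumeration {α : Type*} [Nonempty α] {I : Finset α} (idx : α → ℕ)
    (h : ∀ k < I.card, ∃ x ∈ I, idx x = k) :
    ∃ p : ℕ → α, (∀ x ∈ I, ∀ k < I.card, idx x = k → p k = x) ∧ ∀ (q : α → Prop) [DecidablePred q],
      (I.filter q).card ≤ ((Finset.range I.card).filter fun j => q (p j)).card := by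
  classical
  have : ∀ k, ∃ x, k < I.card → x ∈ I ∧ idx x = k := fun k => by
    by_cases hk : k < I.card
    · obtain ⟨x, hx⟩ := h k hk
      exact ⟨x, fun _ => hx⟩
    · exact ⟨Classical.arbitrary α, fun h => absurd h hk⟩
  choose p hp using this
  have hinj : Set.InjOn p (Finset.range I.card : Set ℕ) := by
    intro i hi j hj e
    simp only [Finset.coe_range, Set.mem_Iio] at hi hj
    rw [← (hp i hi).2, ← (hp j hj).2, e]
  have himg : (Finset.range I.card).image p = I := by
    refine Finset.eq_of_subset_of_card_le ?_ ?_
    · intro x hx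
      obtain ⟨k, hk, rfl⟩ := Finset.mem_image.1 hx
      exact (hp k (Finset.mem_range.1 hk)).1
    · rw [Finset.card_image_of_injOn hinj, Finset.card_range]
  refine ⟨p, fun x hx k hk e => ?_, fun q _ => ?_⟩
  · rw [← himg] at hx
    obtain ⟨j, hj, rfl⟩ := Finset.mem_image.1 hx
    rw [← e, (hp j (Finset.mem_range.1 hj)).2]
  · conv_lhs => rw [← himg]
    rw [Finset.filter_image]
    exact Finset.card_image_le

/-- A bound for the running time of `drawnStmt`. -/
def drawnTime (n : ℕ) : ℕ := 7 * sortTime n + 250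

/-- `c j` is the crossing of inversion number `j`. The direction tests decide which of the two
bounds holds. -/
theorem drawnStmt_spec {M : Memory} (hn : 2 ≤ n) (hW : 8 * n + 8 ≤ W) (hW' : n * n + n < W)
    (hI : IsInstance a b w f) (hL : LoopInv a b w f M) :
    ∃ c : ℕ → ℝ, ∀ k < pending M, Spec W f drawnStmt (M.setN 14 k) (fun t M' =>
      t ≤ drawnTime n ∧ LoopInv a b w f M' ∧
      (pending M' ≤ ((Finset.range (pending M)).filter fun j => c j < c k).card ∨
        pending M' ≤ ((Finset.range (pending M)).filter fun j => c k < c j).card)) := by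
  classical
  obtain ⟨lo, hi, ll, lh, hS, ⟨h12, hC⟩ | ⟨h12, -⟩⟩ := hL
  swap
  · exact ⟨0, fun k hk => by simp [pending, h12] at hk⟩
  have hm : pending M = (inversions lo hi).card := by rw [pending, if_pos h12, hC.total]
  have hS' : ∀ k, Search a b w f lo hi ll lh (M.setN 14 k) := fun k =>
    ⟨⟨by simp [hS.input.n], hS.input.a, hS.input.b, hS.input.w⟩, hS.holds_lo, hS.holds_hi,
      hS.record, hS.inv, hS.left, hS.right, hS.reg_ll, hS.reg_lh, hS.ll_le, hS.le_lh, hS.lt_one⟩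
  have hC' : ∀ k, Counted lo hi (M.setN 14 k) := fun k =>
    ⟨by simp [hC.total], hC.count, hC.rank⟩
  have hspec : ∀ k, k < (inversions lo hi).card → _ := fun k hk =>
    pickRoundStmt_spec hn hW hW' hI (hS' k) (hC' k) (by simpa using hk)
  have : Nonempty (Fin n) := ⟨⟨0, by omega⟩⟩
  obtain ⟨p, hp, hcard⟩ := exists_enumeration (I := inversions lo hi)
    (fun p => pickIndex M lo p.1 p.2) (fun k hk => by
      obtain ⟨-, -, -, -, y, x, -, -, -, -, hyx, hidx, -⟩ := hspec k hk
      refine ⟨(y, x), mem_inversions.2 hyx, ?_⟩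
      exact hidx.symm.trans (by simp))
  refine ⟨fun j => crossing a b (p j).1 (p j).2, fun k hk => ?_⟩
  rw [hm] at hk ⊢
  rw [drawnStmt]
  refine Spec.seq (hspec k hk) ?_
  rintro t₁ M₁ F₁ ⟨ht₁, y, x, lo', hi', ll', lh', hyx, hidx, -, S₁, hout⟩
  have hpk : p k = (y, x) :=
    hp (y, x) (mem_inversions.2 hyx) k hk (hidx.symm.trans (by simp))
  simp only [hpk]
  refine (countStmt_loopInv hn hW hW' S₁ ?_).mono ?_
  · rcases hout with h | h | h
    · exact Or.inl (by simp [h.1, h12])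
    · exact Or.inl (by simp [h.1, h12])
    · exact Or.inr h
  · rintro t₂ M₂ - ⟨ht₂, L₂, hpend⟩
    refine ⟨by unfold drawnTime; omega, L₂, ?_⟩
    rcases hout with h | h | h
    · rw [if_pos (by simp [h.1, h12])] at hpend
      left
      refine le_trans (le_of_eq ?_)
        (hcard fun p => crossing a b p.1 p.2 < crossing a b y x)
      rw [hpend]
      congr 1
      ext ⟨u, v⟩
      simp [h.2]
    · rw [if_pos (by simp [h.1, h12])] at hpend
      right
      refine le_trans (le_of_eq ?_)
        (hcard fun p => crossing a b y x < crossing a b p.1 p.2)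
      rw [hpend]
      congr 1
      ext ⟨u, v⟩
      simp [h.2]
    · rw [if_neg (by rw [h.1]; decide)] at hpend
      simp [hpend]

theorem LoopInv.sorted {M : Memory} (hL : LoopInv a b w f M) (h0 : pending M = 0) :
    ∃ lo hi ll lh, Search a b w f lo hi ll lh M ∧ SortedAt a b (M.rreg 0) lo ∧
      SortedAt a b (M.rreg 0) hi := by
  obtain ⟨lo, hi, ll, lh, hS, ⟨h12, hC⟩ | ⟨-, h⟩⟩ := hL
  swap
  · exact ⟨lo, hi, ll, lh, hS, h⟩
  rw [pending, if_pos h12, hC.total, Finset.card_eq_zero] at h0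
  have hlh : lo = hi := eq_of_not_inverted fun x y h => by
    have := mem_inversions (p := (x, y)).2 h
    simp [h0] at this
  subst hlh
  have := hS.inv.sortedAt_of_eq hS.ll_le hS.le_lh
  exact ⟨lo, lo, ll, lh, hS, this, this⟩

end Ranking

namespace Ranking
variable {W n : ℕ} {f : ℝ → ℝ → ℝ} {a b w : Fin n → ℝ}

/-! ### The randomized algorithm -/

theorem run_nil (T : ℕ) (M : Memory) : run W f T ⟨[], M⟩ = PMF.pure ⟨[], M⟩ := by
  induction T with
  | zero => rfl
  | succ T ih => rw [run_succ_of_step rfl, ih]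

/-- As elaborated, the outer map in the definition is the identity, and the cast to `ℕ` sits inside
its argument. -/
theorem uniformBelow_eq (m : ℕ) :
    uniformBelow m = PMF.map Fin.val (PMF.uniformOfFintype (Fin (m - 1 + 1))) :=
  (PMF.map_id _).trans rfl

theorem mem_support_uniformBelow {m k : ℕ} (hm : 0 < m) :
    k ∈ (uniformBelow m).support ↔ k < m := by
  simp only [uniformBelow_eq, PMF.support_map, PMF.support_uniformOfFintype, Set.mem_image,
    Set.top_eq_univ, Set.mem_univ, true_and]
  constructor
  · rintro ⟨v, rfl⟩
    have := v.2
    omega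
  · intro h
    exact ⟨⟨k, by omega⟩, rfl⟩

theorem toOuterMeasure_bind_uniformBelow {m : ℕ} (hm : 0 < m) (g : ℕ → PMF Config)
    (S : Set Config) : ((uniformBelow m).bind g).toOuterMeasure S =
      (m : ℝ≥0∞)⁻¹ * ∑ k ∈ Finset.range m, (g k).toOuterMeasure S := by
  rw [uniformBelow_eq, PMF.bind_map, PMF.toOuterMeasure_bind_apply, tsum_fintype, Finset.mul_sum,
    Finset.sum_range]
  obtain ⟨m, rfl⟩ : ∃ m', m = m' + 1 := ⟨m - 1, by omega⟩
  simp [PMF.uniformOfFintype_apply]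

/-- Rounds at the crossing of a random inversion. -/
def randomLoop : Stmt :=
  .while (.and (.nlt (.const 0) (.reg 13)) (.nlt (.reg 12) (.const 1)))
    (.seq (.rand 14 (.reg 13)) drawnStmt)

/-- The randomized algorithm. -/
def randomStmt : Stmt :=
  .seq (.seq initStmt countStmt) (.seq randomLoop bisectStmt)

theorem LoopInv.holds_iff {M : Memory} (hW : 1 < W) (hL : LoopInv a b w f M) :
    (BExpr.and (.nlt (.const 0) (.reg 13)) (.nlt (.reg 12) (.const 1))).Holds W f M ↔
      0 < pending M := by
  obtain ⟨lo, hi, ll, lh, hS, h⟩ := hL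
  simp only [BExpr.Holds, NExpr.eval, Nat.zero_mod, Nat.mod_eq_of_lt hW, pending]
  rcases h with ⟨h, -⟩ | ⟨h, -⟩ <;> simp [h]

/-- The three steps are the loop test, the sequencing and the draw. Randomness enters the analysis
only here. -/
theorem run_randomLoop_of_pending {M : Memory} (hW : 1 < W) (hL : LoopInv a b w f M)
    (hp : 0 < pending M) (T : ℕ) :
    run W f (T + 3) ⟨[randomLoop, bisectStmt], M⟩ = (uniformBelow (pending M)).bind fun k =>
      run W f T ⟨[drawnStmt, randomLoop, bisectStmt], M.setN 14 k⟩ := by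
  have h13 : M.nreg 13 = pending M := by
    unfold pending at hp ⊢
    split_ifs at hp ⊢ with h
    · rfl
    · omega
  rw [randomLoop, run_succ_of_step (c' := ⟨[.seq (.rand 14 (.reg 13)) drawnStmt, randomLoop,
    bisectStmt], M⟩), run_succ_of_step (c' := ⟨[.rand 14 (.reg 13), drawnStmt, randomLoop,
    bisectStmt], M⟩) rfl, run, step, PMF.bind_map, NExpr.eval, h13]
  · rfl
  · rw [step, if_pos ((hL.holds_iff hW).2 hp)]
    rfl

theorem run_randomLoop_of_not_pending {M : Memory} (hn : 2 ≤ n) (hW : 8 * n + 8 ≤ W)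
    (hW' : 2 * (n * n) + n < W) (hI : IsInstance a b w f) (hL : LoopInv a b w f M)
    (hp : pending M = 0) : ∃ M', Solved a b w f M' ∧ ∀ T, bisectTime n + 1 ≤ T →
      run W f T ⟨[randomLoop, bisectStmt], M⟩ = PMF.pure ⟨[], M'⟩ := by
  obtain ⟨lo, hi, ll, lh, hS, hlo, hhi⟩ := hL.sorted hp
  obtain ⟨t, M', hb, ht, hs⟩ := bisectStmt_spec (f := f) hn hW hW' hI hS hlo hhi
  refine ⟨M', hs, fun T hT => ?_⟩
  obtain ⟨T, rfl⟩ : ∃ T', T = t + T' + 1 := ⟨T - t - 1, by omega⟩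
  rw [run_succ_of_step (c' := ⟨[bisectStmt], M⟩), hb.run_eq, run_nil]
  rw [randomLoop, step, if_neg]
  rw [hL.holds_iff (by omega), hp]
  exact lt_irrefl 0

/-- The drawn inversion lies in neither set of strict comparisons, so `pending` strictly decreases,
which forces termination. The bound for the sum controls the mean and hence the speed. -/
theorem drawnStmt_run {M : Memory} (hn : 2 ≤ n) (hW : 8 * n + 8 ≤ W) (hW' : n * n + n < W)
    (hI : IsInstance a b w f) (hL : LoopInv a b w f M) :
    ∃ (t : ℕ → ℕ) (N : ℕ → Memory), (∀ k < pending M, t k ≤ drawnTime n ∧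
      LoopInv a b w f (N k) ∧ pending (N k) < pending M ∧
      ∀ K T, run W f (t k + T) ⟨drawnStmt :: K, M.setN 14 k⟩ = run W f T ⟨K, N k⟩) ∧
      4 * ∑ k ∈ Finset.range (pending M), pending (N k) ≤ 3 * pending M ^ 2 := by
  obtain ⟨c, hc⟩ := drawnStmt_spec (f := f) hn hW hW' hI hL
  have : ∀ k, ∃ (t : ℕ) (N : Memory), k < pending M → Big W f drawnStmt (M.setN 14 k) t N ∧
      t ≤ drawnTime n ∧ LoopInv a b w f N ∧
      (pending N ≤ ((Finset.range (pending M)).filter fun j => c j < c k).card ∨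
        pending N ≤ ((Finset.range (pending M)).filter fun j => c k < c j).card) := by
    intro k
    by_cases hk : k < pending M
    · obtain ⟨t, N, h⟩ := hc k hk
      exact ⟨t, N, fun _ => h⟩
    · exact ⟨0, M, fun h => absurd h hk⟩
  choose t N h using this
  refine ⟨t, N, fun k hk => ?_, four_mul_sum_le c _ fun k hk => (h k hk).2.2.2⟩
  obtain ⟨hb, ht, hL', hp⟩ := h k hk
  refine ⟨ht, hL', ?_, fun K T => hb.run_eq K T⟩
  have hlt : ∀ q : ℕ → Prop, [DecidablePred q] → ¬ q k →
      ((Finset.range (pending M)).filter q).card < pending M := by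
    intro q _ hq
    conv_rhs => rw [← Finset.card_range (pending M)]
    refine Finset.card_lt_card (Finset.filter_ssubset.2 ⟨k, Finset.mem_range.2 hk, hq⟩)
  rcases hp with hp | hp
  · exact hp.trans_lt (hlt _ (lt_irrefl _))
  · exact hp.trans_lt (hlt _ (lt_irrefl _))

theorem support_run_randomLoop (hn : 2 ≤ n) (hW : 8 * n + 8 ≤ W) (hW' : 2 * (n * n) + n < W)
    (hI : IsInstance a b w f) (m : ℕ) {M : Memory} (hL : LoopInv a b w f M) (hm : pending M ≤ m)
    {T : ℕ} (hT : m * (drawnTime n + 3) + bisectTime n + 1 ≤ T) :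
    ∀ c ∈ (run W f T ⟨[randomLoop, bisectStmt], M⟩).support, c.Halted ∧ Solved a b w f c.mem := by
  induction m generalizing M T with
  | zero =>
    obtain ⟨M', hs, hr⟩ := run_randomLoop_of_not_pending hn hW hW' hI hL (by omega)
    rw [hr T (by omega)]
    simpa [Config.Halted] using hs
  | succ m ih =>
    rcases Nat.eq_zero_or_pos (pending M) with h0 | h0
    · exact ih hL (by omega) (by rw [Nat.succ_mul] at hT; omega)
    obtain ⟨t, N, h, -⟩ := drawnStmt_run (f := f) hn hW (by omega) hI hL
    rw [Nat.succ_mul] at hT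
    obtain ⟨T, rfl⟩ : ∃ T', T = T' + 3 := ⟨T - 3, by omega⟩
    rw [run_randomLoop_of_pending (by omega) hL h0]
    intro c hc
    obtain ⟨k, hk, hc⟩ := (PMF.mem_support_bind_iff _ _ _).1 hc
    rw [mem_support_uniformBelow h0] at hk
    obtain ⟨ht, hL', hlt, hr⟩ := h k hk
    obtain ⟨T, rfl⟩ : ∃ T', T = t k + T' := ⟨T - t k, by omega⟩
    rw [hr] at hc
    exact ih hL' (by omega) (by omega) c hc

/-- Markov's inequality in inductive form: each draw shrinks the mean of `pending` by the factor `3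
/ 4`, and without rounds the bound is trivial because `pending` is at least `1` unless the loop is
over. -/
theorem prob_run_randomLoop_le (hn : 2 ≤ n) (hW : 8 * n + 8 ≤ W) (hW' : 2 * (n * n) + n < W)
    (hI : IsInstance a b w f) (m : ℕ) {M : Memory} (hL : LoopInv a b w f M)
    {T : ℕ} (hT : m * (drawnTime n + 3) + bisectTime n + 1 ≤ T) :
    (run W f T ⟨[randomLoop, bisectStmt], M⟩).toOuterMeasure {c | ¬ c.Halted} ≤
      (3 / 4) ^ m * pending M := by
  induction m generalizing M T with
  | zero =>
    rcases Nat.eq_zero_or_pos (pending M) with h0 | h0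
    · obtain ⟨M', hs, hr⟩ := run_randomLoop_of_not_pending hn hW hW' hI hL h0
      rw [hr T (by omega)]
      simp [Config.Halted, PMF.toOuterMeasure_pure_apply]
    · refine (PMF.toOuterMeasure_mono _ (Set.subset_univ _) |>.trans_eq
        ((PMF.toOuterMeasure_apply_eq_one_iff _ _).2 (Set.subset_univ _))).trans ?_
      rw [pow_zero, one_mul]
      exact_mod_cast h0
  | succ m ih =>
    rcases Nat.eq_zero_or_pos (pending M) with h0 | h0
    · obtain ⟨M', hs, hr⟩ := run_randomLoop_of_not_pending hn hW hW' hI hL h0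
      rw [hr T (by omega)]
      simp [Config.Halted, PMF.toOuterMeasure_pure_apply]
    obtain ⟨t, N, h, hsum⟩ := drawnStmt_run (f := f) hn hW (by omega) hI hL
    rw [Nat.succ_mul] at hT
    obtain ⟨T, rfl⟩ : ∃ T', T = T' + 3 := ⟨T - 3, by omega⟩
    rw [run_randomLoop_of_pending (by omega) hL h0, toOuterMeasure_bind_uniformBelow h0]
    have hle : ∀ k ∈ Finset.range (pending M), (run W f T ⟨[drawnStmt, randomLoop, bisectStmt],
        M.setN 14 k⟩).toOuterMeasure {c | ¬ c.Halted} ≤ (3 / 4) ^ m * pending (N k) := by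
      intro k hk
      obtain ⟨ht, hL', -, hr⟩ := h k (Finset.mem_range.1 hk)
      have : T = t k + (T - t k) := by omega
      rw [this, hr]
      exact ih hL' (by omega)
    refine (mul_le_mul_right (Finset.sum_le_sum hle) _).trans ?_
    rw [← Finset.mul_sum, ← Nat.cast_sum, pow_succ]
    set s := ∑ k ∈ Finset.range (pending M), pending (N k)
    have hs : (s : ℝ≥0∞) ≤ 3 / 4 * (pending M : ℝ≥0∞) ^ 2 := by
      have h4 : (4 : ℝ≥0∞) * s ≤ 3 * (pending M : ℝ≥0∞) ^ 2 := by exact_mod_cast hsum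
      rw [ENNReal.div_eq_inv_mul, mul_assoc, ← ENNReal.mul_le_iff_le_inv (by simp) (by simp)]
      exact h4
    have hpos : (pending M : ℝ≥0∞) ≠ 0 := by exact_mod_cast h0.ne'
    calc (pending M : ℝ≥0∞)⁻¹ * ((3 / 4) ^ m * s)
        ≤ (pending M : ℝ≥0∞)⁻¹ * ((3 / 4) ^ m * (3 / 4 * (pending M : ℝ≥0∞) ^ 2)) := by gcongr
      _ = (3 / 4) ^ m * (3 / 4) * ((pending M : ℝ≥0∞)⁻¹ * pending M * pending M) := by ring
      _ = _ := by rw [ENNReal.inv_mul_cancel hpos (by simp), one_mul]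

/-- A bound for the time before the randomized loop. -/
def startTime (n : ℕ) : ℕ := 6 * sortTime n + 210

theorem randomStmt_start {M : Memory} (hn : 2 ≤ n) (hW : 8 * n + 8 ≤ W)
    (hW' : 2 * (n * n) + n < W) (hI : IsInstance a b w f) (hM : Input a b w M) :
    ∃ t M', t ≤ startTime n ∧ LoopInv a b w f M' ∧ pending M' ≤ n * n ∧
      ∀ T, run W f (t + T) ⟨[randomStmt], M⟩ = run W f T ⟨[randomLoop, bisectStmt], M'⟩ := by
  have : Spec W f (.seq initStmt countStmt) M (fun t M' => t ≤ 6 * sortTime n + 201 ∧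
      LoopInv a b w f M' ∧ pending M' ≤ n * n) := by
    refine Spec.seq (initStmt_spec hn hW hI hM) ?_
    rintro t₁ M₁ - ⟨ht₁, h12, lo, hi, hS⟩
    refine (countStmt_loopInv hn hW (by omega) hS (Or.inl h12)).mono ?_
    rintro t₂ M₂ - ⟨ht₂, hL, hp⟩
    refine ⟨by omega, hL, ?_⟩
    rw [hp, if_pos h12]
    exact card_inversions_le lo hi
  obtain ⟨t, M', hb, ht, hL, hp⟩ := this
  refine ⟨t + 2, M', by unfold startTime; omega, hL, hp, fun T => ?_⟩
  rw [show t + 2 + T = t + (T + 1) + 1 by ring, randomStmt,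
    run_succ_of_step (c' := ⟨[.seq initStmt countStmt, .seq randomLoop bisectStmt], M⟩) rfl,
    hb.run_eq, run_succ_of_step rfl]

theorem input_inputMemory (a b w : Fin n → ℝ) : Input a b w (inputMemory a b w) :=
  ⟨by simp [inputMemory], rfl, rfl, rfl⟩

/-- Inversion counts and sums of two positions on the path reach order `2 * n ^ 2`. Three times the
bits of `n` give at least `(n + 1) ^ 3` words; twice the bits would not suffice for all `n`. -/
theorem word_bounds (hn : 2 ≤ n) : 8 * n + 8 ≤ 2 ^ (3 * Nat.size n) ∧
    2 * (n * n) + n < 2 ^ (3 * Nat.size n) := by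
  have h : n + 1 ≤ 2 ^ Nat.size n := Nat.lt_size_self n
  have h3 : (n + 1) ^ 3 ≤ 2 ^ (3 * Nat.size n) := by
    rw [mul_comm, pow_mul]
    exact Nat.pow_le_pow_left h 3
  have h2 : 3 * 3 * (n + 1) ≤ (n + 1) ^ 3 := by
    rw [pow_succ, sq]
    exact Nat.mul_le_mul_right _ (Nat.mul_le_mul (by omega) (by omega))
  have h4 : 3 * (n + 1) ^ 2 ≤ (n + 1) ^ 3 := by
    rw [pow_succ _ 2, mul_comm]
    exact Nat.mul_le_mul_left _ (by omega)
  constructor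
  · omega
  · nlinarith

theorem randomStmt_solves (hn : 2 ≤ n) (hI : IsInstance a b w f) :
    ∃ T, SolvesWithin randomStmt 3 a b w f T := by
  obtain ⟨hW, hW'⟩ := word_bounds hn
  obtain ⟨t, M, -, hL, -, hr⟩ := randomStmt_start hn hW hW' hI (input_inputMemory a b w)
  refine ⟨t + (pending M * (drawnTime n + 3) + bisectTime n + 1), fun c hc => ?_⟩
  rw [runOn, hr] at hc
  exact support_run_randomLoop hn hW hW' hI _ hL le_rfl le_rfl c hc

theorem randomStmt_prob_le (hn : 2 ≤ n) (hI : IsInstance a b w f) (m : ℕ) {T : ℕ}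
    (hT : startTime n + (m * (drawnTime n + 3) + bisectTime n + 1) ≤ T) :
    probRunning randomStmt 3 a b w f T ≤ (3 / 4) ^ m * (n : ℝ≥0∞) ^ 2 := by
  obtain ⟨hW, hW'⟩ := word_bounds hn
  obtain ⟨t, M, ht, hL, hp, hr⟩ := randomStmt_start hn hW hW' hI (input_inputMemory a b w)
  have : T = t + (T - t) := by omega
  rw [probRunning, runOn, this, hr]
  refine (prob_run_randomLoop_le hn hW hW' hI m hL (by omega)).trans ?_
  gcongr
  rw [sq]
  exact_mod_cast hp

/-! ### Running times in terms of the logarithm -/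

theorem half_lt_log (hn : 2 ≤ n) : 1 / 2 < Real.log n := by
  have h := Real.log_two_gt_d9
  have : Real.log 2 ≤ Real.log n := Real.log_le_log (by norm_num) (by exact_mod_cast hn)
  linarith

theorem size_le_log (hn : 2 ≤ n) : (Nat.size n : ℝ) ≤ 3 * Real.log n := by
  have h2 := Real.log_two_gt_d9
  have hs : 2 ≤ Nat.size n := Nat.lt_size.2 (by simpa using hn)
  have h1 : 2 ^ (Nat.size n - 1) ≤ n := Nat.lt_size.1 (by omega)
  have h3 : ((Nat.size n - 1 : ℕ) : ℝ) * Real.log 2 ≤ Real.log n := by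
    rw [← Real.log_pow]
    exact Real.log_le_log (by positivity) (by exact_mod_cast h1)
  rw [Nat.cast_sub (by omega), Nat.cast_one] at h3
  have h4 : (2 : ℝ) ≤ Nat.size n := by exact_mod_cast hs
  -- As `Nat.size n ≥ 2`, it is at most `2 * (Nat.size n - 1)`, and `2 / log 2 < 3`.
  nlinarith

theorem sortTime_le (hn : 2 ≤ n) : (sortTime n : ℝ) ≤ 120 * (n * Real.log n) := by
  have h1 := half_lt_log hn
  have h2 := size_le_log hn
  have h3 : (2 : ℝ) ≤ n := by exact_mod_cast hn
  rw [sortTime]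
  push_cast
  have h4 : (Nat.size n : ℝ) * (22 * n + 20) ≤ 3 * Real.log n * (32 * n) := by
    gcongr
    linarith
  nlinarith

theorem bisectTime_le (hn : 2 ≤ n) : (bisectTime n : ℝ) ≤ 570 * (n * Real.log n) := by
  have h1 := half_lt_log hn
  have h2 := size_le_log hn
  have h3 : (2 : ℝ) ≤ n := by exact_mod_cast hn
  rw [bisectTime]
  push_cast
  have h4 : 2 * (Nat.size n : ℝ) * (41 * n + 100) ≤ 2 * (3 * Real.log n) * (91 * n) := by
    gcongr
    linarith
  nlinarith

theorem three_quarters_pow_le {d m : ℕ} (hn : 2 ≤ n) (hm : 4 * (d + 2 : ℕ) * Real.log n ≤ m) :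
    (3 / 4 : ℝ≥0∞) ^ m * (n : ℝ≥0∞) ^ 2 ≤ ((n : ℝ≥0∞) ^ d)⁻¹ := by
  have hn0 : (0 : ℝ) < n := by positivity
  have h1 : (3 / 4 : ℝ) ^ m ≤ ((n : ℝ) ^ (d + 2))⁻¹ := by
    -- This turns the choice of `m` into the factor `n ^ (-(d + 2))`, of which `n ^ 2` pays for the
    -- initial number of inversions.
    have h34 : (3 / 4 : ℝ) ≤ Real.exp (-(1 / 4)) := by
      have := Real.add_one_le_exp (-(1 / 4) : ℝ)
      linarith
    calc (3 / 4 : ℝ) ^ m ≤ Real.exp (-(1 / 4)) ^ m := by gcongr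
      _ = Real.exp (-(m / 4)) := by rw [← Real.exp_nat_mul]; ring_nf
      _ ≤ Real.exp (-((d + 2 : ℕ) * Real.log n)) := by
          apply Real.exp_le_exp.2
          linarith
      _ = _ := by rw [Real.exp_neg, Real.exp_nat_mul, Real.exp_log hn0]
  have h2 : (3 / 4 : ℝ) ^ m * (n : ℝ) ^ 2 ≤ ((n : ℝ) ^ d)⁻¹ := by
    calc (3 / 4 : ℝ) ^ m * (n : ℝ) ^ 2 ≤ ((n : ℝ) ^ (d + 2))⁻¹ * (n : ℝ) ^ 2 := by gcongr
      _ = _ := by rw [pow_add]; field_simp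
  have h3 := ENNReal.ofReal_le_ofReal h2
  rw [ENNReal.ofReal_mul (by positivity), ENNReal.ofReal_pow (by norm_num),
    ENNReal.ofReal_pow hn0.le, ENNReal.ofReal_inv_of_pos (by positivity),
    ENNReal.ofReal_pow hn0.le, ENNReal.ofReal_natCast, ENNReal.ofReal_div_of_pos (by norm_num)]
    at h3
  simpa using h3

theorem randomStmt_fast (d : ℕ) (hn : 2 ≤ n) (hI : IsInstance a b w f) {T : ℕ}
    (hT : (4400 * d + 15000 : ℝ) * n * Real.log n ^ 2 ≤ T) :
    probRunning randomStmt 3 a b w f T ≤ ((n : ℝ≥0∞) ^ d)⁻¹ := by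
  have h1 := half_lt_log hn
  have h3 : (2 : ℝ) ≤ n := by exact_mod_cast hn
  set L := Real.log n with hL
  refine (randomStmt_prob_le hn hI ⌈4 * (d + 2 : ℕ) * L⌉₊ ?_).trans
    (three_quarters_pow_le hn (Nat.le_ceil _))
  have hm := (Nat.ceil_lt_add_one (a := 4 * (d + 2 : ℕ) * L) (by positivity)).le
  set m := ⌈4 * (d + 2 : ℕ) * L⌉₊
  have hs := sortTime_le hn
  have hb := bisectTime_le hn
  rw [← hL] at hs hb
  have hnL : 1 ≤ n * L := by nlinarith
  have hD : ((drawnTime n + 3 : ℕ) : ℝ) ≤ 1100 * (n * L) := by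
    rw [drawnTime]; push_cast; linarith
  have hS : (startTime n : ℝ) ≤ 930 * (n * L) := by
    rw [startTime]; push_cast; linarith
  have hm' : (m : ℝ) ≤ (4 * d + 10) * L := by
    push_cast at hm; linarith
  have hmD : (m : ℝ) * ((drawnTime n + 3 : ℕ) : ℝ) ≤ (4 * d + 10) * L * (1100 * (n * L)) := by
    gcongr
  have hq : n * L ≤ 2 * (n * L ^ 2) := by nlinarith
  rw [← Nat.cast_le (α := ℝ)]
  refine le_trans ?_ hT
  rw [Nat.cast_add, Nat.cast_add, Nat.cast_add, Nat.cast_mul, Nat.cast_one]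
  -- The rounds contribute `4400 * d + 11000`, and start and bisection at most `2 * 1501`, by `hq`.
  nlinarith

end Ranking

namespace Ranking
variable {W n : ℕ} {f : ℝ → ℝ → ℝ} {a b w : Fin n → ℝ}

/-! ### The algorithm for integer scores -/

/-- Store the maximum of all scores in real register `8`. -/
def maxStmt : Stmt :=
  .seq (.setR 8 (.ofWord (.const 0))) (forLoop 7 (.seq
    (.ite (.rlt (.reg 8) (.get 0 (.reg 7))) (.setR 8 (.get 0 (.reg 7))) .skip)
    (.ite (.rlt (.reg 8) (.get 1 (.reg 7))) (.setR 8 (.get 1 (.reg 7))) .skip)))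

/-- The program is not told the bound for the integers, so it has to use the largest score as its
own bound. -/
theorem maxStmt_spec {M : Memory} (hW : 8 * n + 8 ≤ W) (hM : Input a b w M) {β : ℝ} (hβ : 0 ≤ β)
    (ha : ∀ j, a j ≤ β) (hb : ∀ j, b j ≤ β) :
    Spec W f maxStmt M (fun t M' => t ≤ 8 * n + 5 ∧ 0 ≤ M'.rreg 8 ∧ M'.rreg 8 ≤ β ∧
      (∀ j, a j ≤ M'.rreg 8) ∧ ∀ j, b j ≤ M'.rreg 8) := by
  rw [maxStmt, spec_seq, spec_setR]
  simp only [RExpr.eval, NExpr.eval, Nat.zero_mod, Nat.cast_zero]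
  refine (Spec.for (n := n) (by decide) (fun q M' => M'.rarr 0 = arrayOf a ∧
    M'.rarr 1 = arrayOf b ∧ 0 ≤ M'.rreg 8 ∧ M'.rreg 8 ≤ β ∧
    ∀ j : Fin n, (j : ℕ) < q → a j ≤ M'.rreg 8 ∧ b j ≤ M'.rreg 8) 5 (by omega) _
    (by simp [hM.n]) (by simp [hM.a, hM.b, hβ]) (by decide) ?_).mono ?_
  · rintro q hq M' - hr ⟨h0, h1, hpos, hle, h⟩
    have e0 : arrayOf a q = a ⟨q, hq⟩ := arrayOf_of_lt a hq
    have e1 : arrayOf b q = b ⟨q, hq⟩ := arrayOf_of_lt b hq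
    have hnew : ∀ v, M'.rreg 8 ≤ v → a ⟨q, hq⟩ ≤ v → b ⟨q, hq⟩ ≤ v →
        ∀ j : Fin n, (j : ℕ) < q + 1 → a j ≤ v ∧ b j ≤ v := by
      intro v hv hav hbv j hj
      rcases Nat.lt_succ_iff_lt_or_eq.1 hj with hj | hj
      · exact ⟨(h j hj).1.trans hv, (h j hj).2.trans hv⟩
      · obtain rfl : j = ⟨q, hq⟩ := Fin.ext hj
        exact ⟨hav, hbv⟩
    have ha' := ha ⟨q, hq⟩
    have hb' := hb ⟨q, hq⟩
    simp only [spec_seq, spec_ite, spec_setR, spec_skip, BExpr.Holds, RExpr.eval, NExpr.eval, hr,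
      h0, h1, e0, e1, Memory.setR_rreg, Memory.setR_nreg, Memory.setR_rarr, if_true]
    split_ifs with c1 c2 c2
    · exact ⟨by omega, by simpa using h0, by simpa using h1, by simp; linarith, by simpa using hb',
        by simpa using hnew _ (by linarith) c2.le le_rfl⟩
    · exact ⟨by omega, by simpa using h0, by simpa using h1, by simp; linarith, by simpa using ha',
        by simpa using hnew _ (by linarith) le_rfl (by linarith)⟩
    · exact ⟨by omega, by simpa using h0, by simpa using h1, by simp; linarith, by simpa using hb',
        by simpa using hnew _ (by linarith) (by linarith) le_rfl⟩
    · exact ⟨by omega, by simpa using h0, by simpa using h1, by simpa using hpos, by simpa using hle,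
        by simpa using hnew _ le_rfl (by linarith) (by linarith)⟩
  · rintro t M' - ⟨ht, -, -, h1, h2, h⟩
    exact ⟨by omega, h1, h2, fun j => (h j j.2).1, fun j => (h j j.2).2⟩

/-- Bisect the weightings until at most one crossing can be left. -/
def bisectionLoop : Stmt :=
  .while (.and (.nlt (.reg 12) (.const 1)) (.rle (.ofWord (.const 1))
      (.mul (.sub (.reg 7) (.reg 6)) (.mul (.ofWord (.const 4)) (.mul (.reg 8) (.reg 8))))))
    (.seq (.setR 0 (.div (.add (.reg 6) (.reg 7)) (.ofWord (.const 2)))) roundStmt)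

/-- Each round at the midpoint halves `lh - ll` or ends the search. -/
theorem bisectionLoop_spec {M : Memory} (hn : 2 ≤ n) (hW : 8 * n + 8 ≤ W)
    (hI : IsInstance a b w f) {lo hi : Equiv.Perm (Fin n)} (hS : Search a b w f lo hi 0 1 M)
    (h12 : M.nreg 12 = 0) {m : ℕ} (hm : 4 * (M.rreg 8 * M.rreg 8) < 2 ^ m) :
    Spec W f bisectionLoop M (fun t M' => t ≤ m * (4 * sortTime n + 203) + 1 ∧
      M'.rreg 8 = M.rreg 8 ∧ ∃ lo' hi' ll lh, Search a b w f lo' hi' ll lh M' ∧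
      (M'.nreg 12 = 0 ∧ (lh - ll) * (4 * (M.rreg 8 * M.rreg 8)) < 1 ∨
        M'.nreg 12 = 1 ∧ SortedAt a b (M'.rreg 0) lo' ∧ SortedAt a b (M'.rreg 0) hi')) := by
  have m1 : 1 % W = 1 := Nat.mod_eq_of_lt (by omega)
  have m2 : 2 % W = 2 := Nat.mod_eq_of_lt (by omega)
  have m4 : 4 % W = 4 := Nat.mod_eq_of_lt (by omega)
  rw [bisectionLoop]
  refine (Spec.while (fun j M' => M'.rreg 8 = M.rreg 8 ∧ ∃ lo' hi' ll lh,
    Search a b w f lo' hi' ll lh M' ∧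
      (M'.nreg 12 = 0 ∧ (lh - ll) * (4 * (M.rreg 8 * M.rreg 8)) < 2 ^ j ∨
        M'.nreg 12 = 1 ∧ SortedAt a b (M'.rreg 0) lo' ∧ SortedAt a b (M'.rreg 0) hi'))
    (4 * sortTime n + 202) ?_ m M ⟨rfl, lo, hi, 0, 1, hS, Or.inl ⟨h12, by simpa using hm⟩⟩).mono ?_
  · rintro j M₀ ⟨h8, lo, hi, ll, lh, hS, h⟩ hh
    simp only [BExpr.Holds, NExpr.eval, RExpr.eval, m1, m4, hS.reg_ll, hS.reg_lh, h8,
      Nat.cast_one, Nat.cast_ofNat] at hh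
    set g := 4 * (M.rreg 8 * M.rreg 8) with hg
    have hg0 : 0 ≤ g := by have := mul_self_nonneg (M.rreg 8); linarith
    obtain ⟨h12, hj⟩ : M₀.nreg 12 = 0 ∧ (lh - ll) * g < 2 ^ j :=
      h.resolve_right fun h => by omega
    -- The loop test forces `ll < lh`, which keeps the midpoint below `1`.
    have hll : ll < lh := by
      by_contra hc
      have : (lh - ll) * g ≤ 0 := mul_nonpos_of_nonpos_of_nonneg (by linarith) hg0
      linarith [hh.2]
    obtain ⟨i, rfl⟩ : ∃ i, j = i + 1 := ⟨j - 1, by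
      rcases j with _ | j
      · simp at hj; linarith [hh.2]
      · omega⟩
    have hhalf : (lh - ll) * g / 2 < 2 ^ i := by rw [pow_succ] at hj; linarith
    refine ⟨i, by omega, ?_⟩
    rw [spec_seq, spec_setR]
    simp only [RExpr.eval, NExpr.eval, hS.reg_ll, hS.reg_lh, m2, Nat.cast_ofNat]
    have S₁ : Search a b w f lo hi ll lh (M₀.setR 0 ((ll + lh) / 2)) :=
      ⟨⟨hS.input.n, hS.input.a, hS.input.b, hS.input.w⟩, hS.holds_lo, hS.holds_hi, hS.record,
        hS.inv, hS.left, hS.right, hS.reg_ll, hS.reg_lh, by simp; linarith, by simp; linarith,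
        by have := hS.inv.le_one; simp; linarith⟩
    refine (roundStmt_spec hn hW hI S₁).mono ?_
    rintro t M' F ⟨ht, lo', hi', ll', lh', S', e0, hout⟩
    simp only [Memory.setR_rreg, Memory.setR_nreg, if_true] at e0 hout
    refine ⟨by omega, by rw [F.r 8 (by decide)]; simpa using h8, lo', hi', ll', lh', S', ?_⟩
    rcases hout with ⟨h1, rfl, rfl, -⟩ | ⟨h1, rfl, rfl, -⟩ | ⟨h1, h2⟩
    · exact Or.inl ⟨by rw [h1, h12], lt_of_eq_of_lt (by ring) hhalf⟩
    · exact Or.inl ⟨by rw [h1, h12], lt_of_eq_of_lt (by ring) hhalf⟩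
    · exact Or.inr ⟨h1, by rwa [e0]⟩
  · rintro t M' - ⟨ht, ⟨j, h8, lo', hi', ll, lh, hS', h⟩, hh⟩
    refine ⟨ht, h8, lo', hi', ll, lh, hS', h.imp_left fun h => ⟨h.1, ?_⟩⟩
    simp only [BExpr.Holds, NExpr.eval, RExpr.eval, m1, m4, hS'.reg_ll, hS'.reg_lh, h8, h.1,
      Nat.cast_one, Nat.cast_ofNat, zero_lt_one, true_and, not_le] at hh
    exact hh

/-- Multiplied by both denominators, whose product is at most `4 * (β * β)`, the difference of the
crossings becomes an integer of absolute value less than one. -/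
theorem crossing_eq_of_close (ha : ∀ j, ∃ z : ℤ, a j = z) (hb : ∀ j, ∃ z : ℤ, b j = z)
    (ha0 : ∀ j, 0 ≤ a j) (hb0 : ∀ j, 0 ≤ b j) {β : ℝ} (haβ : ∀ j, a j ≤ β) (hbβ : ∀ j, b j ≤ β)
    {x y u v : Fin n} (hxy : a y ≤ a x ∧ b x < b y) (huv : a v ≤ a u ∧ b u < b v)
    (h : |crossing a b x y - crossing a b u v| * (4 * (β * β)) < 1) :
    crossing a b x y = crossing a b u v := by
  choose A hA using ha
  choose B hB using hb
  unfold crossing at *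
  have hβ : 0 ≤ β := (ha0 x).trans (haβ x)
  set p := a x - a y
  set q := a u - a v
  set D := p + (b y - b x) with hD
  set E := q + (b v - b u) with hE
  have hD0 : 0 < D := by simp only [hD, p]; linarith
  have hE0 : 0 < E := by simp only [hE, q]; linarith
  have hD1 : D ≤ 2 * β := by
    simp only [hD, p]; linarith [haβ x, ha0 y, hbβ y, hb0 x]
  have hE1 : E ≤ 2 * β := by
    simp only [hE, q]; linarith [haβ u, ha0 v, hbβ v, hb0 u]
  have hDE : D * E ≤ 4 * (β * β) := by nlinarith
  obtain ⟨z, hz⟩ : ∃ z : ℤ, p * E - q * D = z :=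
    ⟨(A x - A y) * (A u - A v + (B v - B u)) - (A u - A v) * (A x - A y + (B y - B x)), by
      simp only [hD, hE, p, q, hA, hB]; push_cast; ring⟩
  have e : (p / D - q / E) * (D * E) = z := by
    rw [← hz]; field_simp
  have hlt : |(z : ℝ)| < 1 := by
    rw [← e, abs_mul, abs_of_pos (mul_pos hD0 hE0)]
    exact lt_of_le_of_lt (mul_le_mul_of_nonneg_left hDE (abs_nonneg _)) h
  have hz0 : z = 0 := by
    rw [← Int.cast_abs, ← Int.cast_one, Int.cast_lt] at hlt
    exact Int.abs_lt_one_iff.1 hlt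
  rw [hz0, Int.cast_zero, mul_eq_zero] at e
  exact sub_eq_zero.1 (e.resolve_right (mul_pos hD0 hE0).ne')

/-- A round at the crossing of the first inversion, if the search is not over. -/
def lastRoundStmt : Stmt :=
  .ite (.nlt (.reg 12) (.const 1))
    (.seq countStmt (.ite (.nlt (.const 0) (.reg 13))
      (.seq (.setN 14 (.const 0)) pickRoundStmt) .skip)) .skip

/-- All remaining crossings coincide, so after a round at any of them, here that of inversion number
`0`, no inversion is left strictly on either side. -/
theorem lastRoundStmt_spec {M : Memory} (hn : 2 ≤ n) (hW : 8 * n + 8 ≤ W) (hW' : n * n + n < W)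
    (hI : IsInstance a b w f) (ha : ∀ j, ∃ z : ℤ, a j = z) (hb : ∀ j, ∃ z : ℤ, b j = z) {β : ℝ}
    (haβ : ∀ j, a j ≤ β) (hbβ : ∀ j, b j ≤ β) {lo hi : Equiv.Perm (Fin n)} {ll lh : ℝ}
    (hS : Search a b w f lo hi ll lh M)
    (h : M.nreg 12 = 0 ∧ (lh - ll) * (4 * (β * β)) < 1 ∨
      M.nreg 12 = 1 ∧ SortedAt a b (M.rreg 0) lo ∧ SortedAt a b (M.rreg 0) hi) :
    Spec W f lastRoundStmt M (fun t M' => t ≤ 7 * sortTime n + 250 ∧ ∃ lo' hi' ll lh,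
      Search a b w f lo' hi' ll lh M' ∧ SortedAt a b (M'.rreg 0) lo' ∧
        SortedAt a b (M'.rreg 0) hi') := by
  have m1 : 1 % W = 1 := Nat.mod_eq_of_lt (by omega)
  have finish : ∀ {M : Memory} {lo hi : Equiv.Perm (Fin n)} {ll lh : ℝ},
      Search a b w f lo hi ll lh M → (∀ x y, ¬ Inverted lo hi x y) → ∃ lo' hi' ll lh,
      Search a b w f lo' hi' ll lh M ∧ SortedAt a b (M.rreg 0) lo' ∧
        SortedAt a b (M.rreg 0) hi' := by
    intro M lo hi ll lh hS hinv
    obtain rfl := eq_of_not_inverted hinv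
    have := hS.inv.sortedAt_of_eq hS.ll_le hS.le_lh
    exact ⟨lo, lo, ll, lh, hS, this, this⟩
  rw [lastRoundStmt, spec_ite]
  simp only [BExpr.Holds, NExpr.eval, m1]
  rcases h with ⟨h12, hclose⟩ | ⟨h12, h⟩
  swap
  · rw [if_neg (by omega), spec_skip]
    exact ⟨by omega, lo, hi, ll, lh, hS, h⟩
  rw [if_pos (by omega)]
  refine Spec.seq (countStmt_spec hn hW hW' hS.input.n hS.holds_lo hS.holds_hi) ?_
  rintro t₁ M₁ F₁ ⟨ht₁, h13, hc, hk⟩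
  have S₁ := hS.frame' F₁ (by decide) (by decide) (by decide) (by decide)
  simp only [spec_ite, spec_seq (s₁ := .setN _ _), spec_setN, spec_skip, BExpr.Holds, NExpr.eval,
    Nat.zero_mod, h13]
  split_ifs with hpos
  swap
  · refine ⟨by omega, finish S₁ fun x y hxy => hpos ?_⟩
    exact Finset.card_pos.2 ⟨(x, y), mem_inversions.2 hxy⟩
  have S₂ : Search a b w f lo hi ll lh (M₁.setN 14 0) :=
    ⟨⟨by simp [S₁.input.n], S₁.input.a, S₁.input.b, S₁.input.w⟩, S₁.holds_lo, S₁.holds_hi,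
      S₁.record, S₁.inv, S₁.left, S₁.right, S₁.reg_ll, S₁.reg_lh, S₁.ll_le, S₁.le_lh, S₁.lt_one⟩
  refine (pickRoundStmt_spec hn hW hW' hI S₂ ⟨by simp [h13], hc, hk⟩ (by simpa using hpos)).mono ?_
  rintro t₂ M₂ - ⟨ht₂, y, x, lo', hi', ll', lh', hyx, -, -, S', hout⟩
  refine ⟨by omega, ?_⟩
  have hsame : ∀ u v, Inverted lo hi u v → crossing a b u v = crossing a b y x := by
    intro u v huv
    refine crossing_eq_of_close ha hb hI.a_nonneg hI.b_nonneg haβ hbβ (hS.inv.inv u v huv)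
      (hS.inv.inv y x hyx) (lt_of_le_of_lt (mul_le_mul_of_nonneg_right ?_ ?_) hclose)
    · have h1 := hS.inv.crossing_mem huv
      have h2 := hS.inv.crossing_mem hyx
      rw [abs_le]
      constructor <;> linarith
    · have := mul_self_nonneg β
      linarith
  rcases hout with ⟨-, h⟩ | ⟨-, h⟩ | ⟨-, h⟩
  · exact finish S' fun u v huv => by
      have := (h u v).1 huv
      exact absurd (hsame u v this.1) this.2.ne
  · exact finish S' fun u v huv => by
      have := (h u v).1 huv
      exact absurd (hsame u v this.1) this.2.ne'
  · exact ⟨lo', hi', ll', lh', S', h⟩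

/-- The algorithm for integer scores. -/
def integerStmt : Stmt :=
  .seq initStmt (.seq maxStmt (.seq bisectionLoop (.seq lastRoundStmt bisectStmt)))

theorem integerStmt_spec {M : Memory} (hn : 2 ≤ n) (hW : 8 * n + 8 ≤ W)
    (hW' : 2 * (n * n) + n < W) (hI : IsInstance a b w f) (ha : ∀ j, ∃ z : ℤ, a j = z)
    (hb : ∀ j, ∃ z : ℤ, b j = z) {B : ℕ} (haB : ∀ j, a j ≤ B) (hbB : ∀ j, b j ≤ B)
    (hM : Input a b w M) :
    Spec W f integerStmt M (fun t M' => t ≤ (2 * Nat.size B + 2) * (4 * sortTime n + 203) +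
      11 * sortTime n + bisectTime n + 8 * n + 470 ∧ Solved a b w f M') := by
  rw [integerStmt]
  refine Spec.seq (initStmt_spec hn hW hI hM) ?_
  rintro t₁ M₁ - ⟨ht₁, h12, lo, hi, hS⟩
  refine Spec.seq (maxStmt_spec hW hS.input (Nat.cast_nonneg B) haB hbB) ?_
  rintro t₂ M₂ F₂ ⟨ht₂, h0, hB, haβ, hbβ⟩
  have S₂ := hS.frame' F₂ (by decide) (by decide) (by decide) (by decide)
  have h12' : M₂.nreg 12 = 0 := by rw [F₂.n 12 (by decide), h12]
  have hm : 4 * (M₂.rreg 8 * M₂.rreg 8) < 2 ^ (2 * Nat.size B + 2) := by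
    have h1 : (B : ℝ) < 2 ^ Nat.size B := by exact_mod_cast Nat.lt_size_self B
    rw [pow_add, two_mul, pow_add]
    nlinarith
  refine Spec.seq (bisectionLoop_spec hn hW hI S₂ h12' hm) ?_
  rintro t₃ M₃ - ⟨ht₃, -, lo', hi', ll, lh, S₃, h⟩
  refine Spec.seq (lastRoundStmt_spec hn hW (by omega) hI ha hb haβ hbβ S₃ h) ?_
  rintro t₄ M₄ - ⟨ht₄, lo₄, hi₄, ll₄, lh₄, S₄, hlo, hhi⟩
  refine (bisectStmt_spec hn hW hW' hI S₄ hlo hhi).mono ?_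
  rintro t₅ M₅ - ⟨ht₅, hs⟩
  exact ⟨by omega, hs⟩

theorem integerStmt_solves (hn : 2 ≤ n) (hI : IsInstance a b w f) (ha : ∀ j, ∃ z : ℤ, a j = z)
    (hb : ∀ j, ∃ z : ℤ, b j = z) {B : ℕ} (hB : 2 ≤ B) (haB : ∀ j, a j ≤ B) (hbB : ∀ j, b j ≤ B)
    {T : ℕ} (hT : (12000 : ℝ) * n * Real.log n * Real.log B ≤ T) :
    SolvesWithin integerStmt 3 a b w f T := by
  obtain ⟨hW, hW'⟩ := word_bounds hn
  obtain ⟨t, M, hb, ht, hs⟩ := integerStmt_spec (f := f) hn hW hW' hI ha hb haB hbB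
    (input_inputMemory a b w)
  have htT : t ≤ T := by
    have h1 := half_lt_log hn
    have h2 := half_lt_log hB
    have h3 : (2 : ℝ) ≤ n := by exact_mod_cast hn
    have h4 := size_le_log hB
    have h5 := sortTime_le hn
    have h6 := bisectTime_le hn
    set L := Real.log n
    set K := Real.log B
    have hnL : 1 ≤ n * L := by nlinarith
    have hnn : n ≤ 2 * (n * L) := by nlinarith
    -- Since `K > 1 / 2`, the first factor is at most `6 * K + 4 * K`; the second uses `4 * 120 +
    -- 203 = 683`.
    have h7 : (2 * (Nat.size B : ℝ) + 2) * (4 * sortTime n + 203) ≤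
        (10 * K) * (683 * (n * L)) := by
      gcongr <;> linarith
    have h8 : n * L ≤ 2 * (n * L * K) := by nlinarith
    have ht' : (t : ℝ) ≤ (2 * (Nat.size B : ℝ) + 2) * (4 * sortTime n + 203) +
        11 * sortTime n + bisectTime n + 8 * n + 470 := by exact_mod_cast ht
    rw [← Nat.cast_le (α := ℝ)]
    refine le_trans ?_ hT
    nlinarith
  intro c hc
  obtain ⟨T, rfl⟩ := Nat.exists_eq_add_of_le htT
  rw [runOn, hb.run_eq, run_nil, PMF.support_pure, Set.mem_singleton_iff] at hc
  subst hc
  exact ⟨rfl, hs⟩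

end Ranking

theorem theorem1 :
    -- a Las Vegas algorithm: always correct, and fast with high probability
    (∃ (P : Ranking.Stmt) (κ : ℕ),
      (∀ (n : ℕ), 2 ≤ n → ∀ (a b w : Fin n → ℝ) (f : ℝ → ℝ → ℝ), Ranking.IsInstance a b w f →
        ∃ T : ℕ, Ranking.SolvesWithin P κ a b w f T) ∧
      (∀ d : ℕ, ∃ C : ℝ, ∀ (n : ℕ), 2 ≤ n → ∀ (a b w : Fin n → ℝ) (f : ℝ → ℝ → ℝ),
        Ranking.IsInstance a b w f → ∀ T : ℕ, C * n * Real.log n ^ 2 ≤ T →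
          Ranking.probRunning P κ a b w f T ≤ ((n : ENNReal) ^ d)⁻¹)) ∧
    -- a worst-case bound for integers bounded by `B`
    (∃ (P : Ranking.Stmt) (κ : ℕ) (C : ℝ),
      ∀ (n B : ℕ), 2 ≤ n → 2 ≤ B → ∀ (a b : Fin n → ℤ) (w : Fin n → ℝ) (f : ℝ → ℝ → ℝ),
        Ranking.IsInstance (fun j => (a j : ℝ)) (fun j => (b j : ℝ)) w f →
        (∀ j, |a j| ≤ B) → (∀ j, |b j| ≤ B) →
        ∀ T : ℕ, C * n * Real.log n * Real.log B ≤ T →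
          Ranking.SolvesWithin P κ (fun j => (a j : ℝ)) (fun j => (b j : ℝ)) w f T) := by
  refine ⟨⟨Ranking.randomStmt, 3, fun n hn a b w f hI => Ranking.randomStmt_solves hn hI,
    fun d => ⟨4400 * d + 15000, fun n hn a b w f hI T hT => Ranking.randomStmt_fast d hn hI hT⟩⟩,
    Ranking.integerStmt, 3, 12000, fun n B hn hB a b w f hI ha hb T hT =>
      Ranking.integerStmt_solves hn hI (fun j => ⟨a j, rfl⟩) (fun j => ⟨b j, rfl⟩) hB
        (fun j => ?_) (fun j => ?_) hT⟩
  · exact_mod_cast (le_abs_self _).trans (ha j)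
  · exact_mod_cast (le_abs_self _).trans (hb j)
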